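/- Let $m\ge 0$ be an integer. For $a=(a_1,\dots,a_m)\in\mathbb C^m$, $b=(b_1,\dots,b_m)\in\mathbb C^m$ and $c\in\mathbb C\setminus\{0,-1,-2,\dots\}$, the Lauricella function of type B is defined for $|y_1|<1,\dots,|y_m|<1$ by the absolutely convergent series $$F_B^{[m]}(a,b;c\,|\,y)=\sum_{k_1,\dots,k_m\ge 0}\frac{(a_1)_{k_1}(b_1)_{k_1}\cdots(a_m)_{k_m}(b_m)_{k_m}}{(c)_{k_1+\dots+k_m}\,k_1!\cdots k_m!}\,y_1^{k_1}\cdots y_m^{k_m},\qquad (x)_k=x(x+1)\cdots(x+k-1),$$ and outside the polydisc by analytic continuation to the domain $\{y\in\mathbb C^m:\ y_i\notin[1,\infty)\text{ for all } i\}$. This continuation exists and is unique whenever $a_i,b_i\notin\{0,-1,-2,\dots\}$ and $a_i-b_i\notin\mathbb Z$ for all $i$. Moreover, there is $R>0$, depending only on $m$, such that for all such $a,b,c$ and all $y\in\mathbb C^m$ with $\operatorname{Re}y_i<-R$ for all $i$, $$F_B^{[m]}(a,b;c\,|\,y)=\frac{\Gamma(c)}{\prod_{i=1}^m\Gamma(a_i)\Gamma(b_i)}\sum_{I\subset\{1,\dots,m\}}\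 \prod_{i\in I}(-y_i)^{-a_i}\prod_{j\notin I}(-y_j)^{-b_j}\; S_I(y),$$ $$S_I(y)=\sum_{k_1,\dots,k_m\ge 0}\ \prod_{i\in I}\frac{\Gamma(b_i-a_i-k_i)\,\Gamma(a_i+k_i)}{k_i!\;y_i^{k_i}}\ \prod_{j\notin I}\frac{\Gamma(a_j-b_j-k_j)\,\Gamma(b_j+k_j)}{k_j!\;y_j^{k_j}}\ \cdot\ \frac{1}{\Gamma\bigl(c-\sum_{i\in I}(a_i+k_i)-\sum_{j\notin I}(b_j+k_j)\bigr)},$$ where each of the $2^m$ series $S_I(y)$ converges absolutely. Here the powers $(-y_i)^{s}$ are the principal ones, and $1/\Gamma$ is the entire function, equal to $0$ at the poles of $\Gamma$. -/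

import Mathlib

open scoped Nat

noncomputable section

namespace LauricellaB

/-- The general term of the series of type B, indexed by `k = (k₁, …, kₘ)`:
`∏ᵢ (aᵢ)_{kᵢ} (bᵢ)_{kᵢ} yᵢ^{kᵢ} / ((c)_{k₁ + … + kₘ} k₁! ⋯ kₘ!)`. -/
def seriesTerm {m : ℕ} (a b : Fin m → ℂ) (c : ℂ) (y : Fin m → ℂ) (k : Fin m → ℕ) : ℂ :=
  (∏ i, (ascPochhammer ℂ (k i)).eval (a i) * (ascPochhammer ℂ (k i)).eval (b i)) /
      ((ascPochhammer ℂ (∑ i, k i)).eval c * ∏ i, ((k i)! : ℂ)) *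
    ∏ i, y i ^ k i

/-- The product of the cut planes `ℂ \ [1, ∞)`. It is star-shaped about the origin and contains
the unit polydisc and the product of the left half-planes `Re yᵢ < 0`. -/
def cutDomain (m : ℕ) : Set (Fin m → ℂ) :=
  {y | ∀ i, ¬ ((y i).im = 0 ∧ 1 ≤ (y i).re)}

/-- `F` is the function `F_B^{[m]}(a, b; c | ·)`: the sum of the series in the unit polydisc,
continued analytically to the product of the planes cut along `[1, ∞)`. -/
structure IsLauricellaB {m : ℕ} (a b : Fin m → ℂ) (c : ℂ) (F : (Fin m → ℂ) → ℂ) : Prop where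
  differentiableOn : DifferentiableOn ℂ F (cutDomain m)
  hasSum : ∀ y : Fin m → ℂ, (∀ i, ‖y i‖ < 1) → HasSum (seriesTerm a b c y) (F y)

/-- The general term of the power series in `1/y₁, …, 1/yₘ` attached to a subset `I` of the
indices. The exponent `k i` is `α` for `i ∈ I` and `β` for `i ∉ I`. Mathlib's `Complex.Gamma`
vanishes at its poles, so that the last factor is the entire function `1/Γ`. -/
def infinityTerm {m : ℕ} (a b : Fin m → ℂ) (c : ℂ) (I : Finset (Fin m)) (y : Fin m → ℂ)
    (k : Fin m → ℕ) : ℂ :=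
  (∏ i ∈ I, Complex.Gamma (b i - a i - k i) * Complex.Gamma (a i + k i) /
      (((k i)! : ℂ) * y i ^ k i)) *
  (∏ j ∈ Iᶜ, Complex.Gamma (a j - b j - k j) * Complex.Gamma (b j + k j) /
      (((k j)! : ℂ) * y j ^ k j)) *
  (1 / Complex.Gamma (c - ∑ i ∈ I, (a i + k i) - ∑ j ∈ Iᶜ, (b j + k j)))

end LauricellaB

end

/-! Divide by `Γ(c)` and let z = c vary. Since 1/(c)ₙ = Γ(c)/Γ(c+n), summing over one index amounts
to applying f(z) ↦ ∑ₖ (a)ₖ(b)ₖ/k! · yᵏ · f(z+k) to the function of the remaining variables. Thus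
F_B/Γ (`regularized`) arises from the entire function 1/Γ by m one-variable operators, and
everything reduces to one operator acting on a suitable class of entire functions.

Continuation. The operator is also the Mellin–Barnes integral of Γ(-s)Γ(a+s)Γ(b+s)(-y)ˢ f(z+s). On
vertical lines the Gamma factors decay at every rate below 3π/2, and (-y)ˢ costs |arg(-y)| < π, so
the integral converges if f grows at every rate above π/2 at most. The function 1/Γ has this
property, and both forms of the operator preserve the class (`GrowthBound`, `Admissible`), so the
construction can be iterated. Bounds that are locally uniform in y give joint holomorphy
(`regularized_spec`). The series serves |y| < 1, the integral serves y off [0,∞). They agree on the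
overlap: for small negative y move the contour to the right, then use the identity theorem.

Expansion. For y = -x with x large, moving the contour to the left collects the residues at s = -a-k
and s = -b-k (`exists_barnesShift_neg_eq_infinity`). Each variable chooses one of these two
families, whence the 2ᵐ subsets. How large x must be depends on all the data, but both sides are
holomorphic in a half-plane of y₀, to which the identity theorem extends the equality
(`regularized_eq_infinityExpansion`). The half-plane depends only on m because the terms at infinity
are at most a constant times ∏ (4m/|yᵢ|)^{kᵢ} (`exists_norm_exponentTerm_le`).

Uniqueness. The cut domain is star-shaped about 0, so the identity theorem on the complex line
through 0 and y suffices (`IsLauricellaB.eqOn`). -/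

/-! ### Holomorphic dependence on parameters and the identity theorem -/

open MeasureTheory Filter Topology Metric in
/-- An integral depending on a parameter in a finite-dimensional complex space is holomorphic if
the integrand is holomorphic in the parameter and locally dominated. -/
theorem differentiableAt_integral_of_dominated {α E : Type*} [MeasurableSpace α] {μ : Measure α}
    [NormedAddCommGroup E] [NormedSpace ℂ E] [FiniteDimensional ℂ E] {f : E → α → ℂ} {x₀ : E}
    {s : Set E} (hs : s ∈ 𝓝 x₀) {bound : α → ℝ}
    (hmeas : ∀ x ∈ s, AEStronglyMeasurable (f x) μ)
    (hbound : ∀ᵐ t ∂μ, ∀ x ∈ s, ‖f x t‖ ≤ bound t) (hintg : Integrable bound μ)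
    (hd : ∀ t, ∀ x ∈ s, DifferentiableAt ℂ (f · t) x) :
    DifferentiableAt ℂ (fun x ↦ ∫ t, f x t ∂μ) x₀ := by
  obtain ⟨r, hr, hrs⟩ := Metric.mem_nhds_iff.1 hs
  have hx₀ : x₀ ∈ s := mem_of_mem_nhds hs
  have hball : ball x₀ (r / 2) ⊆ s := (ball_subset_ball (by linarith)).trans hrs
  have hline : ∀ v : E, ∀ t, ∀ x ∈ s,
      HasDerivAt (fun l : ℂ ↦ f (x + l • v) t) (fderiv ℂ (f · t) x v) 0 := by
    intro v t x hx
    have h1 : HasDerivAt (fun l : ℂ ↦ x + l • v) v 0 := by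
      simpa using ((hasDerivAt_id (0 : ℂ)).smul_const v).const_add x
    have h2 : HasFDerivAt (f · t) (fderiv ℂ (f · t) x) (x + (0 : ℂ) • v) := by
      simpa using (hd t x hx).hasFDerivAt
    exact h2.comp_hasDerivAt (0 : ℂ) h1
  have hkey : HasFDerivAt (fun x ↦ ∫ t, f x t ∂μ) (∫ t, fderiv ℂ (f · t) x₀ ∂μ) x₀ := by
    refine hasFDerivAt_integral_of_dominated_of_fderiv_le (𝕜 := ℂ)
      (F' := fun x t ↦ fderiv ℂ (f · t) x) (bound := fun t ↦ bound t * (4 / r))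
      (ball_mem_nhds x₀ (half_pos hr)) ?_ ?_ ?_ ?_ (hintg.mul_const _) ?_
    · filter_upwards [hs] with x hx using hmeas x hx
    · exact hintg.mono' (hmeas _ hx₀) (hbound.mono fun t ht ↦ ht _ hx₀)
    · -- measurability of the derivative
      have happly : ∀ v : E, AEStronglyMeasurable (fun t ↦ fderiv ℂ (f · t) x₀ v) μ := by
        intro v
        have hseq : Tendsto (fun n : ℕ ↦ (((n : ℂ) + 1)⁻¹)) atTop (𝓝[≠] 0) := by
          refine tendsto_nhdsWithin_iff.2 ⟨?_, Eventually.of_forall fun n ↦ ?_⟩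
          · simpa using tendsto_one_div_add_atTop_nhds_zero_nat (𝕜 := ℂ)
          · exact inv_ne_zero (Nat.cast_add_one_ne_zero n)
        have hin : ∀ᶠ n : ℕ in atTop, x₀ + (((n : ℂ) + 1)⁻¹) • v ∈ s := by
          have h0 : Tendsto (fun l : ℂ ↦ x₀ + l • v) (𝓝 0) (𝓝 x₀) := by
            have : Continuous (fun l : ℂ ↦ x₀ + l • v) := by fun_prop
            simpa using this.tendsto 0
          exact (h0.comp (hseq.mono_right nhdsWithin_le_nhds)).eventually hs
        obtain ⟨n₀, hn₀⟩ := eventually_atTop.1 hin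
        -- A directional derivative is a pointwise limit of measurable difference quotients; the
        -- offset `n₀` keeps all the sample points in `s`.
        refine aestronglyMeasurable_of_tendsto_ae (u := atTop)
          (f := fun n : ℕ ↦ fun t ↦ (((n + n₀ : ℕ) : ℂ) + 1) •
            (f (x₀ + ((((n + n₀ : ℕ) : ℂ) + 1)⁻¹) • v) t - f x₀ t)) ?_ ?_
        · intro n
          exact ((hmeas _ (hn₀ (n + n₀) (by omega))).sub (hmeas _ hx₀)).const_smul (((n + n₀ : ℕ) : ℂ) + 1)
        · refine ae_of_all _ fun t ↦ ?_
          have h1 := (hasDerivAt_iff_tendsto_slope_zero.1 (hline v t x₀ hx₀)).comp hseq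
          have h2 := h1.comp (tendsto_add_atTop_nat n₀)
          refine h2.congr fun n ↦ ?_
          simp
      let B := Module.finBasis ℂ E
      have hexp : (fun t ↦ fderiv ℂ (f · t) x₀) = fun t ↦
          ∑ i, (fderiv ℂ (f · t) x₀ (B i)) • (LinearMap.toContinuousLinearMap (B.coord i)) := by
        funext t
        refine ContinuousLinearMap.coe_injective (B.ext fun j ↦ ?_)
        simp [Finsupp.single_apply]
      rw [hexp]
      exact Finset.aestronglyMeasurable_fun_sum _ fun i _ ↦ (happly (B i)).smul_const _
    · filter_upwards [hbound] with t hbt x hx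
      have hb0 : 0 ≤ bound t := (norm_nonneg _).trans (hbt _ hx₀)
      refine ContinuousLinearMap.opNorm_le_bound _ (by positivity) fun v ↦ ?_
      rcases eq_or_ne v 0 with rfl | hv
      · simp
      have hv' : 0 < ‖v‖ := norm_pos_iff.2 hv
      -- Here x is within r/2 of x₀ and l • v has norm at most r/4, so the disc stays in `s`;
      -- Cauchy's estimate on it produces the factor 4/r.
      have hρ : 0 < r / 4 / ‖v‖ := by positivity
      have hmem : ∀ l ∈ closedBall (0 : ℂ) (r / 4 / ‖v‖), x + l • v ∈ s := by
        intro l hl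
        apply hrs
        rw [mem_closedBall_zero_iff, le_div_iff₀ hv'] at hl
        rw [mem_ball, dist_eq_norm] at hx ⊢
        calc ‖x + l • v - x₀‖ = ‖(x - x₀) + l • v‖ := by congr 1; abel
          _ ≤ ‖x - x₀‖ + ‖l‖ * ‖v‖ := (norm_add_le _ _).trans (by rw [norm_smul])
          _ < r := by linarith
      have hdc : DiffContOnCl ℂ (fun l : ℂ ↦ f (x + l • v) t) (ball 0 (r / 4 / ‖v‖)) := by
        apply DifferentiableOn.diffContOnCl
        rw [closure_ball _ hρ.ne']
        intro l hl
        have := hd t _ (hmem l hl)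
        refine (DifferentiableAt.comp (g := (f · t)) l this ?_).differentiableWithinAt
        fun_prop
      have := Complex.norm_deriv_le_of_forall_mem_sphere_norm_le hρ hdc
        (fun l hl ↦ hbt _ (hmem l (sphere_subset_closedBall hl)))
      rw [(hline v t x (hball hx)).deriv] at this
      refine this.trans (le_of_eq ?_)
      field_simp
    · exact ae_of_all _ fun t x hx ↦ (hd t x (hball hx)).hasFDerivAt
  exact hkey.differentiableAt

open Filter Topology in
/-- A locally normally convergent series of holomorphic functions of several variables is
holomorphic. -/
theorem differentiableAt_tsum_of_dominated {α E : Type*} [Countable α]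
    [NormedAddCommGroup E] [NormedSpace ℂ E] [FiniteDimensional ℂ E] {f : E → α → ℂ} {x₀ : E}
    {s : Set E} (hs : s ∈ 𝓝 x₀) {bound : α → ℝ}
    (hbound : ∀ x ∈ s, ∀ t, ‖f x t‖ ≤ bound t) (hsum : Summable bound)
    (hd : ∀ t, ∀ x ∈ s, DifferentiableAt ℂ (f · t) x) :
    DifferentiableAt ℂ (fun x ↦ ∑' t, f x t) x₀ := by
  -- A series is an integral against counting measure, and on a countable discrete space
  -- measurability is automatic.
  let _ : MeasurableSpace α := ⊤
  have _ : MeasurableSingletonClass α := ⟨fun _ ↦ trivial⟩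
  have hb : MeasureTheory.Integrable bound MeasureTheory.Measure.count :=
    MeasureTheory.integrable_count_iff.2 hsum.norm
  have h := differentiableAt_integral_of_dominated (μ := MeasureTheory.Measure.count) hs
    (fun x _ ↦ (measurable_of_countable (f x)).aestronglyMeasurable)
    (MeasureTheory.ae_of_all _ fun t x hx ↦ hbound x hx t) hb hd
  refine h.congr_of_eventuallyEq ?_
  filter_upwards [hs] with x hx
  rw [MeasureTheory.integral_countable (MeasureTheory.integrable_count_iff.2
    (Summable.of_nonneg_of_le (fun _ ↦ norm_nonneg _) (hbound x hx) hsum))]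
  simp

open Filter Topology in
/-- Two holomorphic functions on a connected open set that agree at the real points near a real
point are equal. -/
theorem Complex.eqOn_of_eventually_real_eq {f g : ℂ → ℂ} {U : Set ℂ} (hU : IsOpen U)
    (hc : IsPreconnected U) (hf : DifferentiableOn ℂ f U) (hg : DifferentiableOn ℂ g U) {x₀ : ℝ}
    (hx₀ : (x₀ : ℂ) ∈ U) (h : ∀ᶠ x : ℝ in 𝓝 x₀, f x = g x) : Set.EqOn f g U := by
  refine (hf.analyticOnNhd hU).eqOn_of_preconnected_of_frequently_eq (hg.analyticOnNhd hU) hc hx₀ ?_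
  have ht : Tendsto (fun x : ℝ ↦ (x : ℂ)) (𝓝[≠] x₀) (𝓝[≠] (x₀ : ℂ)) := by
    refine tendsto_nhdsWithin_iff.2
      ⟨(Complex.continuous_ofReal.tendsto x₀).mono_left nhdsWithin_le_nhds, ?_⟩
    filter_upwards [self_mem_nhdsWithin] with x hx
    simpa using hx
  exact ht.frequently (h.filter_mono nhdsWithin_le_nhds).frequently

/-! ### Exponential decay of the Gamma function -/

open MeasureTheory Filter Topology Set in
/-- The Laplace transform of a power, for a complex parameter with positive real part. -/
theorem Complex.integral_cpow_mul_exp_neg_mul_Ioi_of_re_pos {s r : ℂ} (hs : 0 < s.re)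
    (hr : 0 < r.re) :
    ∫ t : ℝ in Ioi 0, (t : ℂ) ^ (s - 1) * Complex.exp (-(r * t)) =
      (1 / r) ^ s * Complex.Gamma s := by
  have hopen : IsOpen {r : ℂ | 0 < r.re} := isOpen_lt continuous_const Complex.continuous_re
  have hconn : IsPreconnected {r : ℂ | 0 < r.re} := (convex_halfSpace_re_gt 0).isPreconnected
  -- For real r this is the classical formula; both sides are holomorphic in r on the right
  -- half-plane.
  refine Complex.eqOn_of_eventually_real_eq
    (f := fun r : ℂ ↦ ∫ t : ℝ in Ioi 0, (t : ℂ) ^ (s - 1) * Complex.exp (-(r * t)))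
    (g := fun r : ℂ ↦ (1 / r) ^ s * Complex.Gamma s) hopen hconn ?_ ?_
    (x₀ := 1) (by simp) ?_ hr
  · intro r₀ hr₀
    have hr₀' : 0 < r₀.re / 2 := half_pos hr₀
    have hnhds : {r : ℂ | r₀.re / 2 < r.re} ∈ 𝓝 r₀ :=
      (isOpen_lt continuous_const Complex.continuous_re).mem_nhds
        (by simp only [mem_ofPred_eq]; linarith)
    refine (differentiableAt_integral_of_dominated hnhds
      (bound := fun t : ℝ ↦ ‖t ^ (s.re - 1) * Real.exp (-(r₀.re / 2 * t))‖)
      ?_ ?_ ?_ ?_).differentiableWithinAt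
    · intro r _
      refine ContinuousOn.aestronglyMeasurable ?_ measurableSet_Ioi
      intro t ht
      refine (ContinuousAt.mul ?_ ?_).continuousWithinAt
      · exact continuousAt_ofReal_cpow_const _ _ (Or.inr (ne_of_gt ht))
      · fun_prop
    · refine (ae_restrict_iff' measurableSet_Ioi).2 (ae_of_all _ fun t ht r hr ↦ ?_)
      have ht' : (0 : ℝ) < t := ht
      rw [norm_mul, Complex.norm_cpow_eq_rpow_re_of_pos ht', Complex.norm_exp,
        Real.norm_of_nonneg (by positivity)]
      have : r₀.re / 2 * t ≤ r.re * t := mul_le_mul_of_nonneg_right (le_of_lt hr) ht'.le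
      simp only [Complex.sub_re, Complex.one_re, Complex.neg_re, Complex.mul_re,
        Complex.ofReal_re, Complex.ofReal_im, mul_zero, sub_zero]
      gcongr
    · have := integrableOn_rpow_mul_exp_neg_mul_rpow (p := 1) (s := s.re - 1) (by linarith)
        one_pos hr₀'
      simpa [neg_mul] using this.norm
    · intro t r _
      fun_prop
  · intro r hr
    have hr0 : r ≠ 0 := by rintro rfl; simp at hr
    refine DifferentiableAt.differentiableWithinAt ?_
    refine ((DifferentiableAt.cpow_const ?_ ?_)).mul_const _
    · fun_prop (disch := assumption)
    · left
      rw [one_div, Complex.inv_re]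
      exact div_pos hr (Complex.normSq_pos.2 hr0)
  · filter_upwards [lt_mem_nhds (zero_lt_one : (0 : ℝ) < 1)] with x hx
    exact Complex.integral_cpow_mul_exp_neg_mul_Ioi hs hx

open MeasureTheory Set in
/-- Exponential decay of the Gamma function on vertical lines. -/
theorem Complex.norm_Gamma_le {s : ℂ} (hs : 0 < s.re) {θ : ℝ} (hθ0 : 0 ≤ θ) (hθ : θ < Real.pi / 2) :
    ‖Complex.Gamma s‖ ≤
      Real.Gamma s.re * (1 / Real.cos θ) ^ s.re * Real.exp (-θ * |s.im|) := by
  have hcos : 0 < Real.cos θ := Real.cos_pos_of_mem_Ioo ⟨by linarith, hθ⟩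
  -- Take r = exp(iη) in the Laplace transform: |(1/r)ˢ| = exp(η Im s), while the integral is at
  -- most its value for cos θ and Re s. The sign of η is chosen so that the exponential is large,
  -- which forces Γ(s) to be small.
  obtain ⟨η, hη, hηim⟩ : ∃ η : ℝ, (η = θ ∨ η = -θ) ∧ η * s.im = θ * |s.im| := by
    rcases le_total 0 s.im with h | h
    · exact ⟨θ, Or.inl rfl, by rw [abs_of_nonneg h]⟩
    · exact ⟨-θ, Or.inr rfl, by rw [abs_of_nonpos h]; ring⟩
  have hηcos : Real.cos η = Real.cos θ := by rcases hη with rfl | rfl <;> simp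
  have hηmem : η ∈ Ioo (-(Real.pi / 2)) (Real.pi / 2) := by
    rcases hη with rfl | rfl <;> constructor <;> linarith
  set r : ℂ := Complex.exp (η * Complex.I) with hr
  have hrre : r.re = Real.cos θ := by rw [hr, Complex.exp_ofReal_mul_I_re, hηcos]
  have key := Complex.integral_cpow_mul_exp_neg_mul_Ioi_of_re_pos hs (r := r) (by rw [hrre]; exact hcos)
  have hpow : ‖(1 / r) ^ s‖ = Real.exp (η * s.im) := by
    rw [hr, one_div, ← Complex.exp_neg, Complex.cpow_def_of_ne_zero (Complex.exp_ne_zero _),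
      Complex.log_exp, Complex.norm_exp]
    · simp
    · simp; linarith [hηmem.2, Real.pi_pos]
    · simp; linarith [hηmem.1, Real.pi_pos]
  have hle : ‖∫ t : ℝ in Ioi 0, (t : ℂ) ^ (s - 1) * Complex.exp (-(r * t))‖ ≤
      (1 / Real.cos θ) ^ s.re * Real.Gamma s.re := by
    rw [← Real.integral_rpow_mul_exp_neg_mul_Ioi hs hcos]
    refine (norm_integral_le_integral_norm _).trans (le_of_eq ?_)
    refine setIntegral_congr_fun measurableSet_Ioi fun t ht ↦ ?_
    simp only [norm_mul]
    rw [Complex.norm_cpow_eq_rpow_re_of_pos ht, Complex.norm_exp]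
    simp [hrre]
  have h2 : Real.exp (η * s.im) * ‖Complex.Gamma s‖ ≤ (1 / Real.cos θ) ^ s.re * Real.Gamma s.re := by
    rw [← hpow, ← norm_mul, ← key]; exact hle
  rw [hηim] at h2
  calc ‖Complex.Gamma s‖ = Real.exp (-θ * |s.im|) * (Real.exp (θ * |s.im|) * ‖Complex.Gamma s‖) := by
        rw [← mul_assoc, ← Real.exp_add]; simp
    _ ≤ Real.exp (-θ * |s.im|) * ((1 / Real.cos θ) ^ s.re * Real.Gamma s.re) := by gcongr
    _ = _ := by ring

/-- On a vertical strip the Gamma function decays exponentially away from the real axis. -/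
theorem Complex.exists_norm_Gamma_le_of_one_le_abs_im (σ₁ σ₂ : ℝ) {θ : ℝ} (hθ0 : 0 ≤ θ)
    (hθ : θ < Real.pi / 2) :
    ∃ C : ℝ, 0 ≤ C ∧ ∀ s : ℂ, σ₁ ≤ s.re → s.re ≤ σ₂ → 1 ≤ |s.im| →
      ‖Complex.Gamma s‖ ≤ C * Real.exp (-θ * |s.im|) := by
  have hcos : 0 < Real.cos θ := Real.cos_pos_of_mem_Ioo ⟨by linarith [Real.pi_pos], hθ⟩
  -- When |Im s| ≥ 1 every factor of Γ(s+n)/Γ(s) has modulus at least 1, so the strip may be moved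
  -- to Re s ≥ 1, where the preceding bound applies with uniform constants.
  have hshift : ∀ (n : ℕ) (s : ℂ), 1 ≤ |s.im| → ‖Complex.Gamma s‖ ≤ ‖Complex.Gamma (s + n)‖ := by
    intro n
    induction n with
    | zero => intro s _; simp
    | succ n ih =>
      intro s hs
      refine (ih s hs).trans ?_
      have him : 1 ≤ ‖s + n‖ := by
        refine hs.trans ?_
        simpa using Complex.abs_im_le_norm (s + n)
      have h0 : s + n ≠ 0 := by
        intro h; rw [h, norm_zero] at him; linarith
      rw [Nat.cast_succ, ← add_assoc, Complex.Gamma_add_one _ h0, norm_mul]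
      exact le_mul_of_one_le_left (norm_nonneg _) him
  obtain ⟨n, hn⟩ := exists_nat_ge (1 - σ₁)
  obtain ⟨M, hM⟩ := (isCompact_Icc (a := (1 : ℝ)) (b := σ₂ + n)).exists_bound_of_continuousOn
    (f := fun x ↦ Real.Gamma x * (1 / Real.cos θ) ^ x) (by
      intro x hx
      have hx0 : 0 < x := lt_of_lt_of_le one_pos hx.1
      refine (ContinuousAt.mul ?_ ?_).continuousWithinAt
      · refine (Real.differentiableAt_Gamma fun m ↦ ?_).continuousAt
        have : (0 : ℝ) ≤ m := m.cast_nonneg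
        linarith
      · exact (Real.continuous_const_rpow (by positivity)).continuousAt)
  refine ⟨max M 0, le_max_right _ _, fun s h1 h2 him ↦ ?_⟩
  refine (hshift n s him).trans ?_
  have hre : (s + n).re = s.re + n := by simp
  have himn : (s + n).im = s.im := by simp
  refine (Complex.norm_Gamma_le (by rw [hre]; linarith) hθ0 hθ).trans ?_
  rw [himn]
  gcongr
  refine (le_abs_self _).trans ((hM _ ⟨?_, ?_⟩).trans (le_max_left _ _)) <;> rw [hre] <;> linarith

/-- On a vertical line without poles the Gamma function decays exponentially. -/
theorem Complex.exists_norm_Gamma_le_of_re_eq (σ : ℝ) (hσ : ∀ n : ℕ, σ ≠ -n) {θ : ℝ} (hθ0 : 0 ≤ θ)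
    (hθ : θ < Real.pi / 2) :
    ∃ C : ℝ, 0 ≤ C ∧ ∀ s : ℂ, s.re = σ → ‖Complex.Gamma s‖ ≤ C * Real.exp (-θ * |s.im|) := by
  obtain ⟨C, hC0, hC⟩ := Complex.exists_norm_Gamma_le_of_one_le_abs_im σ σ hθ0 hθ
  obtain ⟨M, hM⟩ := (isCompact_Icc (a := (-1 : ℝ)) (b := 1)).exists_bound_of_continuousOn
    (f := fun t : ℝ ↦ Complex.Gamma (σ + t * Complex.I)) (by
      intro t _
      refine ContinuousAt.continuousWithinAt ?_
      refine ContinuousAt.comp (g := Complex.Gamma) (f := fun t : ℝ ↦ (σ : ℂ) + t * Complex.I)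
        (Complex.continuousAt_Gamma _ fun m h ↦ hσ m ?_) (by fun_prop)
      simpa using congrArg Complex.re h)
  refine ⟨max C (M * Real.exp θ), le_max_of_le_left hC0, fun s hs ↦ ?_⟩
  rcases le_total 1 |s.im| with him | him
  · refine (hC s hs.ge hs.le him).trans ?_
    gcongr
    exact le_max_left _ _
  · have hse : s = σ + s.im * Complex.I := by rw [← hs]; exact (Complex.re_add_im s).symm
    have h1 : ‖Complex.Gamma s‖ ≤ M := by rw [hse]; exact hM _ (abs_le.1 him)
    have hM0 : 0 ≤ M := (norm_nonneg _).trans h1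
    calc ‖Complex.Gamma s‖ ≤ M := h1
      _ ≤ M * Real.exp (θ + -θ * |s.im|) :=
          le_mul_of_one_le_right hM0 (Real.one_le_exp (by nlinarith))
      _ = M * Real.exp θ * Real.exp (-θ * |s.im|) := by rw [Real.exp_add, mul_assoc]
      _ ≤ _ := by gcongr; exact le_max_right _ _

/-! ### The growth class and the reciprocal Gamma function -/

/-- `f` decays like `1/Γ` to the right, grows at most like `1/Γ` times an exponential to the left,
and grows at most exponentially, with rate `κ`, in the vertical direction. -/
structure LauricellaB.GrowthBound (κ C A : ℝ) (f : ℂ → ℂ) : Prop where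
  right : ∀ (z : ℂ) (n : ℕ), 1 + n ≤ z.re → ‖f z‖ ≤ C / n ! * Real.exp (κ * |z.im|)
  left : ∀ (z : ℂ) (n : ℕ), 1 - n ≤ z.re → ‖f z‖ ≤ C * A ^ n * n ! * Real.exp (κ * |z.im|)

theorem Complex.norm_sin_le_exp (z : ℂ) : ‖Complex.sin z‖ ≤ Real.exp |z.im| := by
  rw [Complex.sin, norm_div, norm_mul, Complex.norm_I, mul_one]
  have h1 : ‖Complex.exp (-z * Complex.I)‖ ≤ Real.exp |z.im| := by
    rw [Complex.norm_exp]; simpa using le_abs_self z.im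
  have h2 : ‖Complex.exp (z * Complex.I)‖ ≤ Real.exp |z.im| := by
    rw [Complex.norm_exp]; simpa using neg_le_abs z.im
  have h3 := norm_sub_le (Complex.exp (-z * Complex.I)) (Complex.exp (z * Complex.I))
  have : ‖(2 : ℂ)‖ = 2 := by simp
  rw [this]
  linarith

/-- Lower bound for the sine away from the vertical lines through its zeros. -/
theorem Complex.le_norm_sin (z : ℂ) : |Real.sin z.re| * (Real.exp |z.im| / 2) ≤ ‖Complex.sin z‖ := by
  have hz : Complex.sin z = (Real.sin z.re * Real.cosh z.im : ℝ) +
      (Real.cos z.re * Real.sinh z.im : ℝ) * Complex.I := by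
    conv_lhs => rw [← Complex.re_add_im z, Complex.sin_add_mul_I]
    push_cast; ring
  have h1 : |Real.sin z.re * Real.cosh z.im| ≤ ‖Complex.sin z‖ := by
    have := Complex.abs_re_le_norm (Complex.sin z)
    have hre : (Complex.sin z).re = Real.sin z.re * Real.cosh z.im := by
      rw [hz, Complex.add_re, Complex.ofReal_re, Complex.re_ofReal_mul, Complex.I_re]; ring
    rwa [hre] at this
  refine le_trans ?_ h1
  rw [abs_mul]
  gcongr
  rw [abs_of_pos (Real.cosh_pos _), ← Real.cosh_abs, Real.cosh_eq]
  have := Real.exp_pos (-|z.im|)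
  linarith

theorem Complex.inv_Gamma_eq_mul (s : ℂ) : (Complex.Gamma s)⁻¹ = s * (Complex.Gamma (s + 1))⁻¹ :=
  Complex.one_div_Gamma_eq_self_mul_one_div_Gamma_add_one s

theorem Complex.inv_Gamma_eq_prod_mul (s : ℂ) (n : ℕ) :
    (Complex.Gamma s)⁻¹ = (∏ j ∈ Finset.range n, (s + j)) * (Complex.Gamma (s + n))⁻¹ := by
  induction n with
  | zero => simp
  | succ n ih =>
    rw [ih, Complex.inv_Gamma_eq_mul (s + n), Finset.prod_range_succ]
    push_cast
    ring_nf

/-- As Re s ≥ 1, the factors of Γ(s+n)/Γ(s) satisfy |s+j| ≥ j+1, and their product is at least n!.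
-/
theorem Complex.norm_inv_Gamma_add_nat_le {s : ℂ} (hs : 1 ≤ s.re) (n : ℕ) :
    ‖(Complex.Gamma (s + n))⁻¹‖ ≤ ‖(Complex.Gamma s)⁻¹‖ / n ! := by
  rw [Complex.inv_Gamma_eq_prod_mul s n, norm_mul, le_div_iff₀ (by positivity), mul_comm]
  gcongr
  rw [norm_prod, ← Finset.prod_range_add_one_eq_factorial, Nat.cast_prod]
  refine Finset.prod_le_prod (fun _ _ ↦ by positivity) fun j _ ↦ ?_
  refine le_trans ?_ (Complex.re_le_norm _)
  simp; linarith

open LauricellaB in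
/-- The reciprocal Gamma function on the strip `1 ≤ Re z ≤ 2`. -/
theorem Complex.exists_norm_inv_Gamma_le_strip {θ : ℝ} (hθ0 : 0 ≤ θ) (hθ : θ < Real.pi / 2) :
    ∃ C : ℝ, 0 ≤ C ∧ ∀ z : ℂ, 1 ≤ z.re → z.re ≤ 2 →
      ‖(Complex.Gamma z)⁻¹‖ ≤ C * Real.exp ((Real.pi - θ) * |z.im|) := by
  obtain ⟨C, hC0, hC⟩ := Complex.exists_norm_Gamma_le_of_one_le_abs_im 1 2 hθ0 hθ
  obtain ⟨M, hM⟩ := ((isCompact_Icc (a := (1 : ℝ)) (b := 2)).reProdIm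
    (isCompact_Icc (a := (-1 : ℝ)) (b := 1))).exists_bound_of_continuousOn
    (Complex.differentiable_one_div_Gamma.continuous.continuousOn)
  refine ⟨max C M, le_max_of_le_left hC0, fun z h1 h2 ↦ ?_⟩
  rcases le_total 1 |z.im| with him | him
  · have hz1 : 1 ≤ ‖z - 1‖ := him.trans (by simpa using Complex.abs_im_le_norm (z - 1))
    have hz2 : 1 ≤ ‖z - 2‖ := him.trans (by simpa using Complex.abs_im_le_norm (z - 2))
    -- Reflection at z-2 rather than z, because 1-(z-2) = 3-z lies again in the strip 1 ≤ Re ≤ 2.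
    -- Passing from z to z-2 can only increase |1/Γ|, since |z-1| and |z-2| are at least 1.
    have hrefl := Complex.Gamma_mul_Gamma_one_sub (z - 2)
    have hG : Complex.Gamma (1 - (z - 2)) ≠ 0 := by
      refine Complex.Gamma_ne_zero_of_re_pos ?_
      simp; linarith
    have hpi : (Real.pi : ℂ) ≠ 0 := by exact_mod_cast Real.pi_ne_zero
    have hinv : (Complex.Gamma (z - 2))⁻¹ =
        Complex.Gamma (1 - (z - 2)) * Complex.sin (Real.pi * (z - 2)) / Real.pi := by
      have : Complex.Gamma (z - 2) = Real.pi / Complex.sin (Real.pi * (z - 2)) /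
          Complex.Gamma (1 - (z - 2)) := by rw [← hrefl]; field_simp
      rw [this, inv_div, div_div_eq_mul_div]
    have hprod := Complex.inv_Gamma_eq_prod_mul (z - 2) 2
    have hzz : z - 2 + ((2 : ℕ) : ℂ) = z := by push_cast; ring
    rw [hzz, Finset.prod_range_succ, Finset.prod_range_one] at hprod
    have hle : ‖(Complex.Gamma z)⁻¹‖ ≤ ‖(Complex.Gamma (z - 2))⁻¹‖ := by
      rw [hprod, norm_mul, norm_mul]
      refine le_mul_of_one_le_left (norm_nonneg _) ?_
      have e1 : z - 2 + ((0 : ℕ) : ℂ) = z - 2 := by simp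
      have e2 : z - 2 + ((1 : ℕ) : ℂ) = z - 1 := by push_cast; ring
      rw [e1, e2]
      exact one_le_mul_of_one_le_of_one_le hz2 hz1
    refine hle.trans ?_
    rw [hinv, norm_div, norm_mul]
    have hb1 := hC (1 - (z - 2)) (by simp; linarith) (by simp; linarith) (by simpa using him)
    have hb2 := Complex.norm_sin_le_exp (Real.pi * (z - 2))
    have e3 : (1 - (z - 2)).im = -z.im := by simp
    have e4 : |((Real.pi : ℂ) * (z - 2)).im| = Real.pi * |z.im| := by
      simp [abs_mul, abs_of_pos Real.pi_pos]
    rw [e3, abs_neg] at hb1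
    rw [e4] at hb2
    have hpi1 : 1 ≤ ‖(Real.pi : ℂ)‖ := by
      rw [Complex.norm_real, Real.norm_of_nonneg Real.pi_pos.le]; linarith [Real.pi_gt_three]
    calc _ ≤ ‖Complex.Gamma (1 - (z - 2))‖ * ‖Complex.sin (Real.pi * (z - 2))‖ :=
          div_le_self (by positivity) hpi1
      _ ≤ (C * Real.exp (-θ * |z.im|)) * Real.exp (Real.pi * |z.im|) := by gcongr
      _ = C * Real.exp ((Real.pi - θ) * |z.im|) := by rw [mul_assoc, ← Real.exp_add]; ring_nf
      _ ≤ _ := by gcongr; exact le_max_left _ _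
  · have hz := hM z (by rw [Complex.mem_reProdIm]; exact ⟨⟨h1, h2⟩, abs_le.1 him⟩)
    have hM0 : 0 ≤ M := (norm_nonneg _).trans hz
    refine hz.trans ((le_max_right C M).trans ?_)
    refine le_mul_of_one_le_right (le_max_of_le_left hC0) (Real.one_le_exp ?_)
    have := Real.pi_pos
    have : 0 ≤ Real.pi - θ := by linarith
    positivity

-- The functional equation carries the strip bound to the right with a gain of 1/n! and to the left
-- with a loss of a product of j factors of size at most j+|Im z|. This product is not uniformly
-- bounded in Im z; the inequality xʲ/j! ≤ eˣ at x = ε(j+|Im z|) trades it for (e^ε/ε)ʲ j! and an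
-- extra rate ε = κ-κ', where κ' is any rate between π/2 and min(κ, π).
open LauricellaB in
theorem LauricellaB.exists_growthBound_inv_Gamma {κ : ℝ} (hκ : Real.pi / 2 < κ) :
    ∃ C A : ℝ, 0 ≤ C ∧ 1 ≤ A ∧ GrowthBound κ C A fun z ↦ (Complex.Gamma z)⁻¹ := by
  have hpi := Real.pi_pos
  obtain ⟨κ', hκ1, hκ2⟩ := exists_between (lt_min hκ (by linarith : Real.pi / 2 < Real.pi))
  obtain ⟨hκ2, hκ3⟩ := lt_min_iff.1 hκ2
  obtain ⟨C, hC0, hC⟩ := Complex.exists_norm_inv_Gamma_le_strip (θ := Real.pi - κ')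
    (by linarith) (by linarith)
  rw [sub_sub_cancel] at hC
  set ε := κ - κ' with hε
  have hε0 : 0 < ε := by linarith
  have hA : 1 ≤ Real.exp ε / ε := by
    rw [le_div_iff₀ hε0]; linarith [Real.add_one_le_exp ε]
  have hright : ∀ (z : ℂ) (n : ℕ), 1 + n ≤ z.re →
      ‖(Complex.Gamma z)⁻¹‖ ≤ C / n ! * Real.exp (κ' * |z.im|) := by
    intro z n hz
    have hz1 : 1 ≤ z.re := by linarith [n.cast_nonneg (α := ℝ)]
    set j := ⌊z.re - 1⌋₊ with hj
    have hj1 : (j : ℝ) ≤ z.re - 1 := Nat.floor_le (by linarith)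
    have hj2 : z.re - 1 < j + 1 := Nat.lt_floor_add_one _
    have hnj : n ≤ j := Nat.le_floor (by linarith)
    have h1 := Complex.norm_inv_Gamma_add_nat_le (s := z - j) (by simp; linarith) j
    rw [sub_add_cancel] at h1
    have h2 := hC (z - j) (by simp; linarith) (by simp; linarith)
    have him : (z - j).im = z.im := by simp
    rw [him] at h2
    calc _ ≤ _ := h1
      _ ≤ C * Real.exp (κ' * |z.im|) / n ! := by
        gcongr
      _ = _ := by ring
  refine ⟨C, Real.exp ε / ε, hC0, hA, ⟨fun z n hz ↦ (hright z n hz).trans (by gcongr), ?_⟩⟩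
  intro z n hz
  set j := ⌈1 - z.re⌉₊ with hj
  have hj1 : 1 - z.re ≤ j := Nat.le_ceil _
  have hjn : j ≤ n := Nat.ceil_le.2 (by linarith)
  have h1 := hright (z + j) 0 (by simp; linarith)
  have him : (z + j).im = z.im := by simp
  rw [him, Nat.factorial_zero, Nat.cast_one, div_one] at h1
  rw [Complex.inv_Gamma_eq_prod_mul z j, norm_mul, norm_prod]
  have hprod : ∏ i ∈ Finset.range j, ‖z + i‖ ≤ (j + |z.im|) ^ j := by
    rw [← Finset.card_range j, ← Finset.prod_const, Finset.card_range]
    refine Finset.prod_le_prod (fun _ _ ↦ norm_nonneg _) fun i hi ↦ ?_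
    have hij : (i : ℝ) + 1 ≤ j := by exact_mod_cast Finset.mem_range.1 hi
    have hj0 : 0 < j := by have := Finset.mem_range.1 hi; omega
    have hj2 : (j : ℝ) < 1 - z.re + 1 := Nat.ceil_lt_add_one (by
      by_contra h
      have : j = 0 := Nat.ceil_eq_zero.2 (by linarith)
      omega)
    refine (Complex.norm_le_abs_re_add_abs_im _).trans ?_
    simp only [Complex.add_re, Complex.natCast_re, Complex.add_im, Complex.natCast_im, add_zero]
    gcongr
    rw [abs_le]
    have : (0 : ℝ) ≤ i := i.cast_nonneg
    constructor <;> linarith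
  have hexp : ((j : ℝ) + |z.im|) ^ j ≤ (Real.exp ε / ε) ^ j * j ! * Real.exp (ε * |z.im|) := by
    have h := Real.pow_div_factorial_le_exp (ε * (j + |z.im|)) (by positivity) j
    rw [div_le_iff₀ (by positivity), mul_pow] at h
    rw [div_pow, ← Real.exp_nat_mul, div_mul_eq_mul_div, div_mul_eq_mul_div, le_div_iff₀ (by positivity)]
    calc _ = ε ^ j * (j + |z.im|) ^ j := by ring
      _ ≤ _ := h
      _ = _ := by
        rw [mul_add, Real.exp_add]; ring_nf
  calc _ ≤ ((Real.exp ε / ε) ^ j * j ! * Real.exp (ε * |z.im|)) * (C * Real.exp (κ' * |z.im|)) := by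
        gcongr
        exact hprod.trans hexp
    _ = C * (Real.exp ε / ε) ^ j * j ! * Real.exp (κ * |z.im|) := by
        have : κ * |z.im| = ε * |z.im| + κ' * |z.im| := by rw [hε]; ring
        rw [this, Real.exp_add]; ring
    _ ≤ _ := by gcongr

/-! ### Moving vertical contours across simple poles -/

section

open MeasureTheory Filter Topology

/-- `g` tends to zero, uniformly in the strip `σ₁ ≤ Re s ≤ σ₂`, as `|Im s| → ∞`. -/
def Complex.DecaysOnStrip (g : ℂ → ℂ) (σ₁ σ₂ : ℝ) : Prop :=
  ∀ ε : ℝ, 0 < ε → ∃ T : ℝ, ∀ s : ℂ, σ₁ ≤ s.re → s.re ≤ σ₂ → T ≤ |s.im| → ‖g s‖ ≤ ε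

/-- Shifting a vertical line of integration across a strip of holomorphy. -/
theorem Complex.integral_vertical_eq_of_differentiableOn {g : ℂ → ℂ} {σ₁ σ₂ : ℝ} (hσ : σ₁ ≤ σ₂)
    (hd : DifferentiableOn ℂ g {s | σ₁ ≤ s.re ∧ s.re ≤ σ₂}) (hdec : Complex.DecaysOnStrip g σ₁ σ₂)
    (h1 : Integrable fun t : ℝ ↦ g (σ₁ + t * Complex.I))
    (h2 : Integrable fun t : ℝ ↦ g (σ₂ + t * Complex.I)) :
    ∫ t : ℝ, g (σ₂ + t * Complex.I) = ∫ t : ℝ, g (σ₁ + t * Complex.I) := by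
  have hrect : ∀ T : ℝ, 0 ≤ T →
      Complex.I * ((∫ t in -T..T, g (σ₂ + t * Complex.I)) - ∫ t in -T..T, g (σ₁ + t * Complex.I)) =
      (∫ x in σ₁..σ₂, g (x + T * Complex.I)) - ∫ x in σ₁..σ₂, g (x - T * Complex.I) := by
    intro T hT
    have := Complex.integral_boundary_rect_eq_zero_of_differentiableOn g
      (σ₁ - T * Complex.I) (σ₂ + T * Complex.I) (hd.mono ?_)
    · simp only [Complex.sub_re, Complex.ofReal_re, Complex.mul_re, Complex.I_re, mul_zero,
        Complex.ofReal_im, Complex.I_im, mul_one, sub_self, sub_zero, Complex.add_re, add_zero,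
        Complex.sub_im, Complex.mul_im, zero_add, zero_sub, Complex.add_im, smul_eq_mul,
        Complex.ofReal_neg, neg_mul, ← sub_eq_add_neg] at this
      linear_combination this
    · intro s hs
      rw [Complex.mem_reProdIm] at hs
      simpa [Set.uIcc_of_le hσ] using hs.1
  have hlim : Tendsto (fun T : ℝ ↦ Complex.I * ((∫ t in -T..T, g (σ₂ + t * Complex.I)) -
      ∫ t in -T..T, g (σ₁ + t * Complex.I))) atTop
      (𝓝 (Complex.I * ((∫ t : ℝ, g (σ₂ + t * Complex.I)) - ∫ t : ℝ, g (σ₁ + t * Complex.I)))) := by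
    refine Tendsto.const_mul _ (Tendsto.sub ?_ ?_)
    · exact intervalIntegral_tendsto_integral h2 tendsto_neg_atTop_atBot tendsto_id
    · exact intervalIntegral_tendsto_integral h1 tendsto_neg_atTop_atBot tendsto_id
  have hzero : Tendsto (fun T : ℝ ↦ Complex.I * ((∫ t in -T..T, g (σ₂ + t * Complex.I)) -
      ∫ t in -T..T, g (σ₁ + t * Complex.I))) atTop (𝓝 0) := by
    rw [Metric.tendsto_atTop]
    intro ε hε
    -- Each horizontal side then contributes at most ε/4; the summand 1 keeps the denominator
    -- positive when the strip degenerates to a line.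
    have hε' : 0 < ε / (4 * (σ₂ - σ₁ + 1)) := div_pos hε (by linarith)
    obtain ⟨T₀, hT₀⟩ := hdec _ hε'
    refine ⟨max T₀ 0, fun T hT ↦ ?_⟩
    have hT0 : 0 ≤ T := (le_max_right _ _).trans hT
    have hTT : T₀ ≤ |T| := (le_max_left _ _).trans (hT.trans (le_abs_self T))
    rw [hrect T hT0, dist_zero_right]
    have hb : ∀ τ : ℝ, T₀ ≤ |τ| → ‖∫ x in σ₁..σ₂, g (x + τ * Complex.I)‖ ≤
        ε / (4 * (σ₂ - σ₁ + 1)) * (σ₂ - σ₁) := by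
      intro τ hτ
      have := intervalIntegral.norm_integral_le_of_norm_le_const (a := σ₁) (b := σ₂)
        (f := fun x : ℝ ↦ g (x + τ * Complex.I)) (C := ε / (4 * (σ₂ - σ₁ + 1))) (fun x hx ↦ by
          rw [Set.uIoc_of_le hσ] at hx
          exact hT₀ _ (by simpa using hx.1.le) (by simpa using hx.2) (by simpa using hτ))
      rwa [abs_of_nonneg (sub_nonneg.2 hσ)] at this
    have hb1 := hb T hTT
    have hb2 := hb (-T) (by rwa [abs_neg])
    simp only [Complex.ofReal_neg, neg_mul, ← sub_eq_add_neg] at hb2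
    have hle : ε / (4 * (σ₂ - σ₁ + 1)) * (σ₂ - σ₁) ≤ ε / 4 := by
      rw [div_mul_eq_mul_div, div_le_div_iff₀ (by linarith) (by norm_num)]
      nlinarith
    calc _ ≤ _ := norm_sub_le _ _
      _ < ε := by linarith
  have h0 := tendsto_nhds_unique hlim hzero
  have := (mul_eq_zero.1 h0).resolve_left Complex.I_ne_zero
  exact sub_eq_zero.1 this

theorem Real.integral_div_sq_add_sq {δ : ℝ} (hδ : 0 < δ) :
    Integrable (fun u : ℝ ↦ δ / (δ ^ 2 + u ^ 2)) ∧ ∫ u : ℝ, δ / (δ ^ 2 + u ^ 2) = Real.pi := by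
  have h : (fun u : ℝ ↦ δ / (δ ^ 2 + u ^ 2)) = fun u ↦ δ⁻¹ * (1 + (u / δ) ^ 2)⁻¹ := by
    funext u
    field_simp
  rw [h]
  refine ⟨(integrable_inv_one_add_sq.comp_div hδ.ne').const_mul _, ?_⟩
  rw [integral_const_mul, Measure.integral_comp_div (fun x : ℝ ↦ (1 + x ^ 2)⁻¹) δ,
    integral_univ_inv_one_add_sq, abs_of_pos hδ, smul_eq_mul]
  field_simp

/-- The integral of `1 / (s - p) - 1 / (s - p')` over a vertical line, where `p'` lies to the right
of the line and at the same height as `p`. -/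
theorem Complex.integral_kernel {δ δ' : ℝ} (hδ : δ ≠ 0) (hδ' : 0 < δ') :
    Integrable (fun u : ℝ ↦ 1 / (δ + u * Complex.I) + 1 / (δ' - u * Complex.I)) ∧
    ∫ u : ℝ, (1 / (δ + u * Complex.I) + 1 / (δ' - u * Complex.I)) =
      if 0 < δ then 2 * Real.pi else 0 := by
  have hne : ∀ δ : ℝ, δ ≠ 0 → ∀ u : ℝ, (δ : ℂ) + u * Complex.I ≠ 0 := by
    intro δ hδ u h
    exact hδ (by simpa using congrArg Complex.re h)
  have hne' : ∀ u : ℝ, (δ' : ℂ) - u * Complex.I ≠ 0 := by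
    intro u h
    exact hδ'.ne' (by simpa using congrArg Complex.re h)
  have hpos : ∀ δ : ℝ, δ ≠ 0 → ∀ u : ℝ, 0 < δ ^ 2 + u ^ 2 := fun δ hδ u ↦ by positivity
  have hsq : ∀ u : ℝ, ‖(δ : ℂ) + u * Complex.I‖ ^ 2 = δ ^ 2 + u ^ 2 := fun u ↦ by
    rw [Complex.sq_norm, Complex.normSq_add_mul_I]
  have hsq' : ∀ u : ℝ, ‖(δ' : ℂ) - u * Complex.I‖ ^ 2 = δ' ^ 2 + u ^ 2 := fun u ↦ by
    have := Complex.normSq_add_mul_I δ' (-u)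
    rw [Complex.sq_norm, sub_eq_add_neg, ← neg_mul, ← Complex.ofReal_neg, this, neg_sq]
  have hintg : Integrable (fun u : ℝ ↦ 1 / (δ + u * Complex.I) + 1 / (δ' - u * Complex.I)) := by
    have hm : 0 < min |δ| δ' := lt_min (abs_pos.2 hδ) hδ'
    refine ((Real.integral_div_sq_add_sq hm).1.const_mul
      (‖(δ : ℂ) + δ'‖ / min |δ| δ')).mono' ?_ (ae_of_all _ fun u ↦ ?_)
    · refine Continuous.aestronglyMeasurable ?_
      refine Continuous.add ?_ ?_
      · exact continuous_const.div (by fun_prop) (hne δ hδ)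
      · exact continuous_const.div (by fun_prop) hne'
    · have e : (1 : ℂ) / (δ + u * Complex.I) + 1 / (δ' - u * Complex.I) =
          (δ + δ') / ((δ + u * Complex.I) * (δ' - u * Complex.I)) := by
        have := hne δ hδ u
        have := hne' u
        field_simp
        ring
      rw [e, norm_div, norm_mul]
      have hA : (min |δ| δ') ^ 2 + u ^ 2 ≤ ‖(δ : ℂ) + u * Complex.I‖ * ‖(δ' : ℂ) - u * Complex.I‖ := by
        have a1 : (min |δ| δ') ^ 2 + u ^ 2 ≤ ‖(δ : ℂ) + u * Complex.I‖ ^ 2 := by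
          rw [hsq, ← sq_abs δ]; gcongr; exact min_le_left _ _
        have a2 : (min |δ| δ') ^ 2 + u ^ 2 ≤ ‖(δ' : ℂ) - u * Complex.I‖ ^ 2 := by
          rw [hsq']; gcongr; exact min_le_right _ _
        refine le_of_sq_le_sq ?_ (by positivity)
        rw [mul_pow, sq (min |δ| δ' ^ 2 + u ^ 2)]
        exact mul_le_mul a1 a2 (by positivity) (by positivity)
      calc _ ≤ ‖(δ : ℂ) + δ'‖ / ((min |δ| δ') ^ 2 + u ^ 2) := by gcongr
        _ = _ := by field_simp
  refine ⟨hintg, ?_⟩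
  -- Averaging with u ↦ -u leaves two Cauchy densities, with integrals ±π (the sign of δ) and π.
  have hsymm : ∫ u : ℝ, (1 / (δ + u * Complex.I) + 1 / (δ' - u * Complex.I)) =
      ((∫ u : ℝ, (δ / (δ ^ 2 + u ^ 2) + δ' / (δ' ^ 2 + u ^ 2)) : ℝ) : ℂ) := by
    have h1 : ∫ u : ℝ, (1 / ((δ : ℂ) + (-u : ℝ) * Complex.I) + 1 / (δ' - (-u : ℝ) * Complex.I)) =
        ∫ u : ℝ, (1 / ((δ : ℂ) + u * Complex.I) + 1 / (δ' - u * Complex.I)) :=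
      integral_neg_eq_self (fun u : ℝ ↦ 1 / ((δ : ℂ) + u * Complex.I) + 1 / (δ' - u * Complex.I)) _
    have h2 := integral_add hintg hintg.comp_neg
    rw [h1] at h2
    rw [← integral_complex_ofReal]
    have h3 : ∀ u : ℝ, (1 / ((δ : ℂ) + u * Complex.I) + 1 / (δ' - u * Complex.I)) +
        (1 / ((δ : ℂ) + (-u : ℝ) * Complex.I) + 1 / (δ' - (-u : ℝ) * Complex.I)) =
        2 * ((δ / (δ ^ 2 + u ^ 2) + δ' / (δ' ^ 2 + u ^ 2) : ℝ) : ℂ) := by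
      intro u
      have n1 := hne δ hδ u
      have n2 := hne' u
      have n3 := hne δ hδ (-u)
      have n4 := hne δ' hδ'.ne' u
      have n5 : (δ : ℂ) ^ 2 + u ^ 2 ≠ 0 := by exact_mod_cast (hpos δ hδ u).ne'
      have n6 : (δ' : ℂ) ^ 2 + u ^ 2 ≠ 0 := by exact_mod_cast (hpos δ' hδ'.ne' u).ne'
      have e1 : (1 : ℂ) / (δ + u * Complex.I) + 1 / (δ + (-u : ℝ) * Complex.I) =
          2 * (δ / (δ ^ 2 + u ^ 2)) := by
        rw [div_add_div _ _ n1 n3, mul_div_assoc', div_eq_div_iff (mul_ne_zero n1 n3) n5]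
        push_cast
        linear_combination (2 * δ * u ^ 2) * Complex.I_sq
      have e2 : (1 : ℂ) / (δ' - u * Complex.I) + 1 / (δ' - (-u : ℝ) * Complex.I) =
          2 * (δ' / (δ' ^ 2 + u ^ 2)) := by
        have n7 : (δ' : ℂ) - (-u : ℝ) * Complex.I ≠ 0 := by simpa using n4
        rw [div_add_div _ _ n2 n7, mul_div_assoc', div_eq_div_iff (mul_ne_zero n2 n7) n6]
        push_cast
        linear_combination (2 * δ' * u ^ 2) * Complex.I_sq
      push_cast at e1 e2 ⊢
      linear_combination e1 + e2
    simp_rw [h3] at h2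
    rw [integral_const_mul] at h2
    linear_combination -h2 / 2
  rw [hsymm]
  have hI' := Real.integral_div_sq_add_sq hδ'
  rcases lt_or_gt_of_ne hδ with hneg | hp
  · have hI := Real.integral_div_sq_add_sq (neg_pos.2 hneg)
    simp only [neg_sq, neg_div] at hI
    have hI1 : Integrable (fun u : ℝ ↦ δ / (δ ^ 2 + u ^ 2)) := by simpa using hI.1.neg
    rw [integral_neg] at hI
    rw [integral_add hI1 hI'.1, hI'.2, if_neg hneg.not_gt]
    have := hI.2
    norm_cast
    linarith
  · have hI := Real.integral_div_sq_add_sq hp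
    rw [integral_add hI.1 hI'.1, hI.2, hI'.2, if_pos hp]
    push_cast; ring

theorem Complex.DecaysOnStrip.sub {g h : ℂ → ℂ} {σ₁ σ₂ : ℝ} (hg : Complex.DecaysOnStrip g σ₁ σ₂)
    (hh : Complex.DecaysOnStrip h σ₁ σ₂) : Complex.DecaysOnStrip (fun s ↦ g s - h s) σ₁ σ₂ := by
  intro ε hε
  obtain ⟨T, hT⟩ := hg _ (half_pos hε)
  obtain ⟨T', hT'⟩ := hh _ (half_pos hε)
  refine ⟨max T T', fun s h1 h2 h3 ↦ (norm_sub_le _ _).trans ?_⟩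
  have := hT s h1 h2 ((le_max_left _ _).trans h3)
  have := hT' s h1 h2 ((le_max_right _ _).trans h3)
  linarith

theorem Complex.decaysOnStrip_kernel (r p p' : ℂ) (σ₁ σ₂ : ℝ) :
    Complex.DecaysOnStrip (fun s ↦ r * (1 / (s - p) - 1 / (s - p'))) σ₁ σ₂ := by
  intro ε hε
  have hq : ∀ q : ℂ, ∃ T : ℝ, ∀ s : ℂ, T ≤ |s.im| → ‖1 / (s - q)‖ ≤ ε / (2 * (‖r‖ + 1)) := by
    intro q
    refine ⟨|q.im| + 2 * (‖r‖ + 1) / ε, fun s hs ↦ ?_⟩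
    have h1 : 2 * (‖r‖ + 1) / ε ≤ ‖s - q‖ := by
      have h2 := Complex.abs_im_le_norm (s - q)
      have h3 := abs_sub_abs_le_abs_sub s.im q.im
      rw [Complex.sub_im] at h2
      linarith
    rw [norm_div, norm_one, ← one_div_div (2 * (‖r‖ + 1)) ε]
    exact one_div_le_one_div_of_le (by positivity) h1
  obtain ⟨T, hT⟩ := hq p
  obtain ⟨T', hT'⟩ := hq p'
  refine ⟨max T T', fun s _ _ h3 ↦ ?_⟩
  have h1 := hT s ((le_max_left _ _).trans h3)
  have h2 := hT' s ((le_max_right _ _).trans h3)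
  rw [norm_mul]
  calc ‖r‖ * ‖1 / (s - p) - 1 / (s - p')‖
      ≤ (‖r‖ + 1) * (ε / (2 * (‖r‖ + 1)) + ε / (2 * (‖r‖ + 1))) := by
        gcongr
        · linarith
        · exact (norm_sub_le _ _).trans (add_le_add h1 h2)
    _ = ε := by field_simp; norm_num

theorem Complex.integral_kernel_vertical {p : ℂ} {σ L : ℝ} (h1 : σ ≠ p.re) (h2 : σ < p.re + L) :
    Integrable (fun t : ℝ ↦ 1 / ((σ : ℂ) + t * Complex.I - p) -
      1 / ((σ : ℂ) + t * Complex.I - (p + L))) ∧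
    ∫ t : ℝ, (1 / ((σ : ℂ) + t * Complex.I - p) - 1 / ((σ : ℂ) + t * Complex.I - (p + L))) =
      if p.re < σ then 2 * Real.pi else 0 := by
  have key := Complex.integral_kernel (δ := σ - p.re) (δ' := p.re + L - σ) (sub_ne_zero.2 h1)
    (by linarith)
  have hfun : (fun t : ℝ ↦ 1 / ((σ : ℂ) + t * Complex.I - p) -
      1 / ((σ : ℂ) + t * Complex.I - (p + L))) = fun t : ℝ ↦
      (fun u : ℝ ↦ 1 / (((σ - p.re : ℝ) : ℂ) + u * Complex.I) +
        1 / (((p.re + L - σ : ℝ) : ℂ) - u * Complex.I)) (t - p.im) := by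
    funext t
    have e1 : (σ : ℂ) + t * Complex.I - p =
        ((σ - p.re : ℝ) : ℂ) + ((t - p.im : ℝ) : ℂ) * Complex.I := by
      conv_lhs => rw [← Complex.re_add_im p]
      push_cast; ring
    have e2 : (σ : ℂ) + t * Complex.I - (p + L) =
        -(((p.re + L - σ : ℝ) : ℂ) - ((t - p.im : ℝ) : ℂ) * Complex.I) := by
      conv_lhs => rw [← Complex.re_add_im p]
      push_cast; ring
    simp only [e1, e2, div_neg, sub_neg_eq_add]
  rw [hfun]
  refine ⟨key.1.comp_sub_right p.im, ?_⟩
  rw [integral_sub_right_eq_self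
    (fun u : ℝ ↦ 1 / (((σ - p.re : ℝ) : ℂ) + u * Complex.I) +
        1 / (((p.re + L - σ : ℝ) : ℂ) - u * Complex.I)) p.im, key.2]
  simp only [sub_pos]

/-- Shifting a vertical line of integration across finitely many simple poles. -/
theorem Complex.integral_vertical_sub_eq_sum_residues {σ₁ σ₂ : ℝ} (hσ : σ₁ ≤ σ₂) (r : ℂ → ℂ)
    (P : Finset ℂ) : ∀ {g : ℂ → ℂ}, (∀ p ∈ P, σ₁ < p.re ∧ p.re < σ₂) →
    DifferentiableOn ℂ g ({s | σ₁ ≤ s.re ∧ s.re ≤ σ₂} \ P) →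
    (∀ p ∈ P, Tendsto (fun s ↦ (s - p) * g s) (𝓝[≠] p) (𝓝 (r p))) →
    Complex.DecaysOnStrip g σ₁ σ₂ →
    (Integrable fun t : ℝ ↦ g (σ₁ + t * Complex.I)) →
    (Integrable fun t : ℝ ↦ g (σ₂ + t * Complex.I)) →
    (∫ t : ℝ, g (σ₂ + t * Complex.I)) - ∫ t : ℝ, g (σ₁ + t * Complex.I) =
      2 * Real.pi * ∑ p ∈ P, r p := by
  induction P using Finset.induction_on with
  | empty =>
    intro g _ hd _ hdec h1 h2
    rw [Complex.integral_vertical_eq_of_differentiableOn hσ (by simpa using hd) hdec h1 h2]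
    simp
  | insert p P hp ih =>
    intro g hmem hd hres hdec h1 h2
    have hpm := hmem p (Finset.mem_insert_self _ _)
    -- The principal part at p is subtracted together with an opposite pole at p+L. With this L that
    -- pole lies to the right of the strip, and the difference is integrable on vertical lines, with
    -- known integrals.
    set L : ℝ := σ₂ - σ₁ + 1 with hL
    set q : ℂ → ℂ := fun s ↦ r p * (1 / (s - p) - 1 / (s - (p + L))) with hq
    set g₀ : ℂ → ℂ := fun s ↦ g s - q s with hg₀
    -- After the subtraction the singularity at p is removable; filling in the limit leaves a
    -- function whose only poles are those of P.
    set g₁ : ℂ → ℂ := Function.update g₀ p (limUnder (𝓝[≠] p) g₀) with hg₁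
    have hg₁eq : ∀ s, s ≠ p → g₁ s = g₀ s := fun s hs ↦ Function.update_of_ne hs _ _
    have hqd : ∀ s : ℂ, s ≠ p → s.re ≤ σ₂ → DifferentiableAt ℂ q s := by
      intro s hs hs2
      have n1 : s - p ≠ 0 := sub_ne_zero.2 hs
      have n2 : s - (p + L) ≠ 0 := by
        intro h
        have := congrArg Complex.re h
        simp at this
        linarith [hpm.1]
      fun_prop (disch := assumption)
    have hg₀d : DifferentiableOn ℂ g₀ ({s | σ₁ ≤ s.re ∧ s.re ≤ σ₂} \ (insert p P : Finset ℂ)) := by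
      intro s hs
      refine (hd s hs).sub (hqd s ?_ hs.1.2).differentiableWithinAt
      rintro rfl
      exact hs.2 (by simp)
    have hPclosed : IsClosed (P : Set ℂ) := P.finite_toSet.isClosed
    have hnhds : {s : ℂ | σ₁ ≤ s.re ∧ s.re ≤ σ₂} \ (P : Set ℂ) ∈ 𝓝 p := by
      refine inter_mem ?_ (hPclosed.isOpen_compl.mem_nhds (by simpa using hp))
      filter_upwards [(isOpen_lt continuous_const Complex.continuous_re).mem_nhds hpm.1,
        (isOpen_lt Complex.continuous_re continuous_const).mem_nhds hpm.2] with s a b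
        using ⟨le_of_lt a, le_of_lt b⟩
    have hqres : Tendsto (fun s ↦ (s - p) * q s) (𝓝[≠] p) (𝓝 (r p)) := by
      have hL0 : (L : ℂ) ≠ 0 := by
        have : L ≠ 0 := by rw [hL]; linarith
        exact_mod_cast this
      have hc : ContinuousAt (fun s : ℂ ↦ r p * (1 - (s - p) / (s - (p + L)))) p := by
        refine continuousAt_const.mul (continuousAt_const.sub (ContinuousAt.div (by fun_prop)
          (by fun_prop) ?_))
        simpa using hL0
      have := hc.tendsto.mono_left (nhdsWithin_le_nhds (s := {p}ᶜ))
      simp only [sub_self, zero_div, sub_zero, mul_one] at this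
      refine this.congr' ?_
      filter_upwards [self_mem_nhdsWithin] with s hs
      have : s - p ≠ 0 := sub_ne_zero.2 hs
      rw [hq]
      field_simp
    have hg₀res : Tendsto (fun s ↦ (s - p) * g₀ s) (𝓝[≠] p) (𝓝 0) := by
      have := (hres p (Finset.mem_insert_self _ _)).sub hqres
      rw [sub_self] at this
      refine this.congr fun s ↦ ?_
      rw [hg₀]; ring
    have hg₁d : DifferentiableOn ℂ g₁ ({s | σ₁ ≤ s.re ∧ s.re ≤ σ₂} \ P) := by
      refine Complex.differentiableOn_update_limUnder_of_isLittleO hnhds (hg₀d.mono ?_) ?_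
      · intro s hs
        refine ⟨hs.1.1, ?_⟩
        simp only [Finset.coe_insert, Set.mem_insert_iff, not_or]
        exact ⟨hs.2, hs.1.2⟩
      · rw [Asymptotics.isLittleO_iff_tendsto']
        · have hc : Tendsto (fun s : ℂ ↦ (s - p) * g₀ p) (𝓝[≠] p) (𝓝 0) := by
            have : ContinuousAt (fun s : ℂ ↦ (s - p) * g₀ p) p := by fun_prop
            simpa using this.tendsto.mono_left (nhdsWithin_le_nhds (s := {p}ᶜ))
          have := hg₀res.sub hc
          rw [sub_zero] at this
          refine this.congr fun s ↦ ?_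
          rw [div_inv_eq_mul]; ring
        · filter_upwards [self_mem_nhdsWithin] with s hs h
          exact absurd (inv_eq_zero.1 h) (sub_ne_zero.2 hs)
    have hline : ∀ σ : ℝ, σ ≠ p.re → ∀ t : ℝ,
        g₁ (σ + t * Complex.I) = g (σ + t * Complex.I) - q (σ + t * Complex.I) := by
      intro σ hσp t
      refine hg₁eq _ fun h ↦ hσp ?_
      simpa using congrArg Complex.re h
    have k1 := Complex.integral_kernel_vertical (p := p) (σ := σ₁) (L := L) hpm.1.ne
      (by rw [hL]; linarith [hpm.1])
    have k2 := Complex.integral_kernel_vertical (p := p) (σ := σ₂) (L := L) hpm.2.ne'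
      (by rw [hL]; linarith [hpm.1])
    have q1 : Integrable fun t : ℝ ↦ q (σ₁ + t * Complex.I) := k1.1.const_mul _
    have q2 : Integrable fun t : ℝ ↦ q (σ₂ + t * Complex.I) := k2.1.const_mul _
    have iq1 : ∫ t : ℝ, q (σ₁ + t * Complex.I) = 0 := by
      rw [hq, integral_const_mul, k1.2, if_neg hpm.1.not_gt, Complex.ofReal_zero, mul_zero]
    have iq2 : ∫ t : ℝ, q (σ₂ + t * Complex.I) = r p * (2 * Real.pi) := by
      rw [hq, integral_const_mul, k2.2, if_pos hpm.2]
      push_cast; rfl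
    have key := @ih g₁ (fun p' hp' ↦ hmem p' (Finset.mem_insert_of_mem hp')) hg₁d ?_ ?_ ?_ ?_
    · simp_rw [hline σ₁ hpm.1.ne, hline σ₂ hpm.2.ne'] at key
      rw [integral_sub h1 q1, integral_sub h2 q2, iq1, iq2] at key
      rw [Finset.sum_insert hp]
      linear_combination key
    · intro p' hp'
      have hne : p' ≠ p := by rintro rfl; exact hp hp'
      have hqc : Tendsto (fun s ↦ (s - p') * q s) (𝓝[≠] p') (𝓝 0) := by
        have hqd' := (hqd p' hne (hmem p' (Finset.mem_insert_of_mem hp')).2.le).continuousAt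
        have : ContinuousAt (fun s ↦ (s - p') * q s) p' :=
          ContinuousAt.mul (by fun_prop) hqd'
        simpa using this.tendsto.mono_left (nhdsWithin_le_nhds (s := {p'}ᶜ))
      have := (hres p' (Finset.mem_insert_of_mem hp')).sub hqc
      rw [sub_zero] at this
      refine this.congr' ?_
      filter_upwards [nhdsWithin_le_nhds (isOpen_ne.mem_nhds hne)] with s hs
      rw [hg₁eq s hs, hg₀]; ring
    · have hdec' := hdec.sub (Complex.decaysOnStrip_kernel (r p) p (p + L) σ₁ σ₂)
      intro ε hε
      obtain ⟨T, hT⟩ := hdec' ε hε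
      refine ⟨max T (|p.im| + 1), fun s a b c ↦ ?_⟩
      rw [hg₁eq s]
      · exact hT s a b ((le_max_left _ _).trans c)
      · rintro rfl
        have := (le_max_right _ _).trans c
        linarith
    · simp_rw [hline σ₁ hpm.1.ne]; exact h1.sub q1
    · simp_rw [hline σ₂ hpm.2.ne']; exact h2.sub q2

/-! ### Growth of the coefficients -/

namespace LauricellaB

/-- The ratio test as a global bound: beyond some index the ratios are below q, and the finitely
many earlier terms are absorbed into C. It serves for every Pochhammer and factorial quotient below.
-/
theorem exists_le_mul_pow_of_ratio {u ρ : ℕ → ℝ} (hu : ∀ n, 0 ≤ u n)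
    (h : ∀ n, u (n + 1) ≤ ρ n * u n) (hρ : Tendsto ρ atTop (𝓝 1)) {q : ℝ} (hq : 1 < q) :
    ∃ C : ℝ, 0 ≤ C ∧ ∀ n, u n ≤ C * q ^ n := by
  obtain ⟨N, hN⟩ := eventually_atTop.1 (hρ.eventually (gt_mem_nhds hq))
  have hC : 0 ≤ ∑ i ∈ Finset.range (N + 1), u i := Finset.sum_nonneg fun i _ ↦ hu i
  refine ⟨_, hC, fun n ↦ ?_⟩
  induction n with
  | zero =>
    simpa using Finset.single_le_sum (f := u) (fun i _ ↦ hu i) (Finset.mem_range.2 (Nat.succ_pos N))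
  | succ n ih =>
    rcases lt_or_ge n N with hn | hn
    · refine (Finset.single_le_sum (f := u) (fun i _ ↦ hu i)
        (Finset.mem_range.2 (by omega : n + 1 < N + 1))).trans ?_
      exact le_mul_of_one_le_right hC (one_le_pow₀ hq.le)
    · calc u (n + 1) ≤ ρ n * u n := h n
        _ ≤ q * u n := mul_le_mul_of_nonneg_right (hN n hn).le (hu n)
        _ ≤ q * ((∑ i ∈ Finset.range (N + 1), u i) * q ^ n) := by gcongr
        _ = _ := by ring

theorem tendsto_add_div_add_atTop (x y : ℝ) :
    Tendsto (fun n : ℕ ↦ (x + n) / (y + n)) atTop (𝓝 1) := by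
  have h : Tendsto (fun n : ℕ ↦ 1 + (x - y) / (y + n)) atTop (𝓝 (1 + 0)) := by
    refine tendsto_const_nhds.add ?_
    refine tendsto_const_nhds.div_atTop (tendsto_atTop_add_const_left _ _ tendsto_natCast_atTop_atTop)
  rw [add_zero] at h
  refine h.congr' ?_
  filter_upwards [(tendsto_atTop_add_const_left _ y
    (tendsto_natCast_atTop_atTop (R := ℝ))).eventually_gt_atTop 0] with n hn
  field_simp
  ring

theorem exists_norm_ascPochhammer_le (x : ℂ) {q : ℝ} (hq : 1 < q) :
    ∃ C : ℝ, 0 ≤ C ∧ ∀ k : ℕ, ‖(ascPochhammer ℂ k).eval x‖ ≤ C * q ^ k * k ! := by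
  have hratio : ∀ n : ℕ, ‖(ascPochhammer ℂ (n + 1)).eval x‖ / (n + 1)! ≤
      (‖x‖ + n) / (1 + n) * (‖(ascPochhammer ℂ n).eval x‖ / n !) := by
    intro n
    have : ‖x + n‖ ≤ ‖x‖ + n := (norm_add_le _ _).trans (by simp)
    rw [ascPochhammer_succ_eval, norm_mul, Nat.factorial_succ, div_mul_div_comm]
    push_cast
    rw [add_comm (n : ℝ) 1, mul_comm (‖x‖ + n)]
    gcongr
  obtain ⟨C, hC0, hC⟩ := exists_le_mul_pow_of_ratio
    (u := fun k ↦ ‖(ascPochhammer ℂ k).eval x‖ / k !) (fun n ↦ by positivity) hratio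
    (tendsto_add_div_add_atTop _ _) hq
  exact ⟨C, hC0, fun k ↦ (div_le_iff₀ (by positivity)).1 (hC k)⟩

/-- The coefficients `(a)_k (b)_k / k!`. -/
noncomputable def coeff (a b : ℂ) (k : ℕ) : ℂ :=
  (ascPochhammer ℂ k).eval a * (ascPochhammer ℂ k).eval b / k !

theorem exists_norm_coeff_le (a b : ℂ) {q : ℝ} (hq : 1 < q) :
    ∃ C : ℝ, 0 ≤ C ∧ ∀ k : ℕ, ‖coeff a b k‖ ≤ C * q ^ k * k ! := by
  -- The rate q is split evenly between the two Pochhammer symbols.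
  have hq' : 1 < √q := Real.lt_sqrt_of_sq_lt (by simpa using hq)
  obtain ⟨C, hC0, hC⟩ := exists_norm_ascPochhammer_le a hq'
  obtain ⟨C', hC0', hC'⟩ := exists_norm_ascPochhammer_le b hq'
  refine ⟨C * C', by positivity, fun k ↦ ?_⟩
  rw [coeff, norm_div, norm_mul, Complex.norm_natCast, div_le_iff₀ (by positivity)]
  calc _ ≤ (C * √q ^ k * k !) * (C' * √q ^ k * k !) := by gcongr <;> simp [hC, hC']
    _ = C * C' * (√q * √q) ^ k * k ! * k ! := by rw [mul_pow]; ring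
    _ = _ := by rw [Real.mul_self_sqrt (by linarith)]

theorem summable_norm_coeff_div (a b : ℂ) {r : ℝ} (hr0 : 0 ≤ r) (hr : r < 1) :
    Summable fun k : ℕ ↦ ‖coeff a b k‖ / k ! * r ^ k := by
  obtain ⟨q, hq1, hq2⟩ : ∃ q : ℝ, 1 < q ∧ q * r < 1 := by
    refine ⟨2 / (1 + r), ?_, ?_⟩
    · rw [lt_div_iff₀ (by linarith)]; linarith
    · rw [div_mul_eq_mul_div, div_lt_one (by linarith)]; linarith
  obtain ⟨C, hC0, hC⟩ := exists_norm_coeff_le a b hq1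
  refine Summable.of_nonneg_of_le (fun k ↦ by positivity) (fun k ↦ ?_)
    ((summable_geometric_of_lt_one (by positivity) hq2).mul_left C)
  rw [mul_pow, ← mul_assoc]
  gcongr
  rw [div_le_iff₀ (by positivity)]
  exact hC k

/-! ### The Mellin–Barnes operator: kernel and majorants -/

/-- The Mellin–Barnes kernel. -/
noncomputable def barnesKernel (a b s : ℂ) : ℂ :=
  Complex.Gamma (-s) * Complex.Gamma (a + s) * Complex.Gamma (b + s)

/-- The operator `∑ₖ (a)ₖ (b)ₖ / k! · yᵏ · f (z + k)`. -/
noncomputable def seriesShift (a b y : ℂ) (f : ℂ → ℂ) (z : ℂ) : ℂ :=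
  ∑' k : ℕ, coeff a b k * y ^ k * f (z + k)

/-- The number of poles of `Γ(-s)` to the left of the line of integration. -/
noncomputable def barnesIndex (a b : ℂ) : ℕ := ⌈‖a‖ + ‖b‖⌉₊ + 1

/-- The abscissa of the line of integration. -/
noncomputable def barnesAbscissa (a b : ℂ) : ℝ := barnesIndex a b - 1 / 2

/-- The operator `seriesShift`, written as a Mellin–Barnes integral: this makes sense for all
`y ∉ [0, ∞)`. -/
noncomputable def barnesShift (a b y : ℂ) (f : ℂ → ℂ) (z : ℂ) : ℂ :=
  ∑ k ∈ Finset.range (barnesIndex a b), coeff a b k * y ^ k * f (z + k) +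
  (2 * Real.pi * (Complex.Gamma a * Complex.Gamma b))⁻¹ *
    ∫ t : ℝ, barnesKernel a b (barnesAbscissa a b + t * Complex.I) *
      (-y) ^ (barnesAbscissa a b + t * Complex.I : ℂ) *
      f (z + (barnesAbscissa a b + t * Complex.I))

theorem le_barnesIndex (a b : ℂ) : ‖a‖ + ‖b‖ + 1 ≤ barnesIndex a b := by
  rw [barnesIndex]; push_cast
  have := Nat.le_ceil (‖a‖ + ‖b‖)
  linarith

theorem barnesAbscissa_pos (a b : ℂ) : 0 < barnesAbscissa a b := by
  have := le_barnesIndex a b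
  have := norm_nonneg a
  have := norm_nonneg b
  rw [barnesAbscissa]; linarith

/-- This puts all poles of Γ(a+s) and Γ(b+s) to the left of the line. A straight line may then leave
some poles of Γ(-s) on the wrong side; the finite sum in `barnesShift` accounts for exactly these.
-/
theorem re_add_barnesAbscissa_pos (a b : ℂ) :
    0 < a.re + barnesAbscissa a b ∧ 0 < b.re + barnesAbscissa a b := by
  have := le_barnesIndex a b
  have := norm_nonneg a
  have := norm_nonneg b
  have := (abs_le.1 (Complex.abs_re_le_norm a)).1
  have := (abs_le.1 (Complex.abs_re_le_norm b)).1
  rw [barnesAbscissa]; constructor <;> linarith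

theorem exp_neg_mul_abs_im_add_le {θ : ℝ} (hθ : 0 ≤ θ) (a s : ℂ) :
    Real.exp (-θ * |(a + s).im|) ≤ Real.exp (θ * |a.im|) * Real.exp (-θ * |s.im|) := by
  rw [← Real.exp_add]
  gcongr
  have : |s.im| ≤ |(a + s).im| + |a.im| := by
    have := abs_sub (a.im + s.im) a.im
    rw [add_sub_cancel_left] at this
    rwa [Complex.add_im]
  nlinarith

/-- Each of the three Gamma factors decays at any rate θ < π/2, so the kernel decays at any rate
below 3π/2; the imaginary parts of a and b affect only the constant. -/
theorem exists_norm_barnesKernel_le_of_re_eq (a b : ℂ) (σ : ℝ) (h0 : ∀ n : ℕ, σ ≠ n)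
    (ha : ∀ n : ℕ, a.re + σ ≠ -n) (hb : ∀ n : ℕ, b.re + σ ≠ -n) {θ : ℝ} (hθ0 : 0 ≤ θ)
    (hθ : θ < Real.pi / 2) :
    ∃ C : ℝ, 0 ≤ C ∧ ∀ s : ℂ, s.re = σ → ‖barnesKernel a b s‖ ≤ C * Real.exp (-(3 * θ) * |s.im|) := by
  obtain ⟨C₁, hC₁, h₁⟩ := Complex.exists_norm_Gamma_le_of_re_eq (-σ)
    (fun n h ↦ h0 n (neg_injective h)) hθ0 hθ
  obtain ⟨C₂, hC₂, h₂⟩ := Complex.exists_norm_Gamma_le_of_re_eq (a.re + σ) ha hθ0 hθ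
  obtain ⟨C₃, hC₃, h₃⟩ := Complex.exists_norm_Gamma_le_of_re_eq (b.re + σ) hb hθ0 hθ
  refine ⟨C₁ * (C₂ * Real.exp (θ * |a.im|)) * (C₃ * Real.exp (θ * |b.im|)), by positivity,
    fun s hs ↦ ?_⟩
  have b₁ := h₁ (-s) (by simp [hs])
  have b₂ := (h₂ (a + s) (by simp [hs])).trans
    (mul_le_mul_of_nonneg_left (exp_neg_mul_abs_im_add_le hθ0 a s) hC₂)
  have b₃ := (h₃ (b + s) (by simp [hs])).trans
    (mul_le_mul_of_nonneg_left (exp_neg_mul_abs_im_add_le hθ0 b s) hC₃)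
  rw [Complex.neg_im, abs_neg] at b₁
  rw [barnesKernel, norm_mul, norm_mul]
  calc _ ≤ (C₁ * Real.exp (-θ * |s.im|)) *
        (C₂ * (Real.exp (θ * |a.im|) * Real.exp (-θ * |s.im|))) *
        (C₃ * (Real.exp (θ * |b.im|) * Real.exp (-θ * |s.im|))) := by gcongr
    _ = _ := by
      have : -(3 * θ) * |s.im| = -θ * |s.im| + -θ * |s.im| + -θ * |s.im| := by ring
      rw [this, Real.exp_add, Real.exp_add]; ring

theorem exists_norm_barnesKernel_le_strip (a b : ℂ) (σ₁ σ₂ : ℝ) {θ : ℝ} (hθ0 : 0 ≤ θ)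
    (hθ : θ < Real.pi / 2) :
    ∃ C T : ℝ, 0 ≤ C ∧ ∀ s : ℂ, σ₁ ≤ s.re → s.re ≤ σ₂ → T ≤ |s.im| →
      ‖barnesKernel a b s‖ ≤ C * Real.exp (-(3 * θ) * |s.im|) := by
  obtain ⟨C₁, hC₁, h₁⟩ := Complex.exists_norm_Gamma_le_of_one_le_abs_im (-σ₂) (-σ₁) hθ0 hθ
  obtain ⟨C₂, hC₂, h₂⟩ := Complex.exists_norm_Gamma_le_of_one_le_abs_im (a.re + σ₁) (a.re + σ₂) hθ0 hθ
  obtain ⟨C₃, hC₃, h₃⟩ := Complex.exists_norm_Gamma_le_of_one_le_abs_im (b.re + σ₁) (b.re + σ₂) hθ0 hθ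
  refine ⟨C₁ * (C₂ * Real.exp (θ * |a.im|)) * (C₃ * Real.exp (θ * |b.im|)),
    1 + |a.im| + |b.im|, by positivity, fun s hs1 hs2 hT ↦ ?_⟩
  have hsub : ∀ c : ℂ, |s.im| - |c.im| ≤ |(c + s).im| := by
    intro c
    have := abs_sub (c.im + s.im) c.im
    rw [add_sub_cancel_left] at this
    rw [Complex.add_im]; linarith
  have b₁ := h₁ (-s) (by simp [hs2]) (by simp [hs1]) (by
    rw [Complex.neg_im, abs_neg]; linarith [abs_nonneg a.im, abs_nonneg b.im])
  have b₂ := (h₂ (a + s) (by simp [hs1]) (by simp [hs2]) (by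
    linarith [hsub a, abs_nonneg b.im])).trans
    (mul_le_mul_of_nonneg_left (exp_neg_mul_abs_im_add_le hθ0 a s) hC₂)
  have b₃ := (h₃ (b + s) (by simp [hs1]) (by simp [hs2]) (by
    linarith [hsub b, abs_nonneg a.im])).trans
    (mul_le_mul_of_nonneg_left (exp_neg_mul_abs_im_add_le hθ0 b s) hC₃)
  rw [Complex.neg_im, abs_neg] at b₁
  rw [barnesKernel, norm_mul, norm_mul]
  calc _ ≤ (C₁ * Real.exp (-θ * |s.im|)) *
        (C₂ * (Real.exp (θ * |a.im|) * Real.exp (-θ * |s.im|))) *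
        (C₃ * (Real.exp (θ * |b.im|) * Real.exp (-θ * |s.im|))) := by gcongr
    _ = _ := by
      have : -(3 * θ) * |s.im| = -θ * |s.im| + -θ * |s.im| + -θ * |s.im| := by ring
      rw [this, Real.exp_add, Real.exp_add]; ring

theorem integrable_exp_neg_mul_abs {c : ℝ} (hc : 0 < c) :
    Integrable fun t : ℝ ↦ Real.exp (-c * |t|) := by
  have h : ∀ s : Set ℝ, s = Set.Iic 0 ∨ s = Set.Ioi 0 →
      IntegrableOn (fun t : ℝ ↦ Real.exp (-c * |t|)) s := by
    rintro s (rfl | rfl)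
    · refine (integrableOn_exp_mul_Iic hc 0).congr_fun (fun t ht ↦ ?_) measurableSet_Iic
      simp only [abs_of_nonpos (Set.mem_Iic.1 ht)]; ring_nf
    · refine (integrableOn_exp_mul_Ioi (neg_lt_zero.2 hc) 0).congr_fun (fun t ht ↦ ?_)
        measurableSet_Ioi
      simp only [abs_of_pos (Set.mem_Ioi.1 ht)]
  rw [← integrableOn_univ, ← Set.Iic_union_Ioi (a := (0 : ℝ))]
  exact (h _ (Or.inl rfl)).union (h _ (Or.inr rfl))

theorem continuous_barnesKernel_line {a b : ℂ} {σ : ℝ} (h0 : ∀ n : ℕ, σ ≠ n)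
    (ha : ∀ n : ℕ, a.re + σ ≠ -n) (hb : ∀ n : ℕ, b.re + σ ≠ -n) :
    Continuous fun t : ℝ ↦ barnesKernel a b (σ + t * Complex.I) := by
  have hG : ∀ (g : ℝ → ℂ) (x : ℝ), Continuous g → (∀ t, (g t).re = x) → (∀ n : ℕ, x ≠ -n) →
      Continuous fun t ↦ Complex.Gamma (g t) := by
    intro g x hg hx hn
    rw [continuous_iff_continuousAt]
    intro t
    refine ContinuousAt.comp (g := Complex.Gamma) (Complex.continuousAt_Gamma _ fun m h ↦ hn m ?_)
      hg.continuousAt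
    rw [← hx t, h]; simp
  unfold barnesKernel
  refine ((hG _ (-σ) (by fun_prop) (by simp) fun n h ↦ h0 n (neg_injective h)).mul
    (hG _ (a.re + σ) (by fun_prop) (by simp) ha)).mul (hG _ (b.re + σ) (by fun_prop) (by simp) hb)

theorem barnesAbscissa_ne_nat (a b : ℂ) (n : ℕ) : barnesAbscissa a b ≠ n := by
  intro h
  rw [barnesAbscissa] at h
  have h2 : (2 * barnesIndex a b : ℝ) = 2 * n + 1 := by linarith
  have h3 : 2 * barnesIndex a b = 2 * n + 1 := by exact_mod_cast h2
  omega

theorem re_add_barnesAbscissa_ne (a b : ℂ) (n : ℕ) :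
    a.re + barnesAbscissa a b ≠ -n ∧ b.re + barnesAbscissa a b ≠ -n := by
  have h := re_add_barnesAbscissa_pos a b
  have : (0 : ℝ) ≤ n := n.cast_nonneg
  constructor <;> intro h' <;> linarith [h.1, h.2]

/-- Near any point off the positive real axis the Mellin–Barnes integrand, without the factor
`f (z + s)`, decays at an exponential rate larger than `π / 2`. -/
theorem exists_barnes_majorant (a b : ℂ) {y₀ : ℂ} (hy₀ : -y₀ ∈ Complex.slitPlane) :
    ∃ κ₀ C : ℝ, ∃ V ∈ 𝓝 y₀, Real.pi / 2 < κ₀ ∧ 0 ≤ C ∧ ∀ y ∈ V, -y ∈ Complex.slitPlane ∧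
      ∀ t : ℝ, ‖barnesKernel a b (barnesAbscissa a b + t * Complex.I) *
        (-y) ^ (barnesAbscissa a b + t * Complex.I : ℂ)‖ ≤ C * Real.exp (-κ₀ * |t|) := by
  have harg : |Complex.arg (-y₀)| < Real.pi := by
    rw [abs_lt]
    exact ⟨Complex.neg_pi_lt_arg _, lt_of_le_of_ne (Complex.arg_le_pi _)
      (Complex.mem_slitPlane_iff_arg.1 hy₀).1⟩
  obtain ⟨α, hα1, hα2⟩ := exists_between harg
  -- The rate 3θ-α left after (-y)ˢ must exceed π/2, that is θ > (α+π/2)/3; there is room below π/2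
  -- because α < π.
  obtain ⟨θ, hθ1, hθ2⟩ := exists_between (show max 0 ((α + Real.pi / 2) / 3) < Real.pi / 2 from
    max_lt (by linarith [Real.pi_pos]) (by linarith))
  obtain ⟨hθ0, hθ1⟩ := max_lt_iff.1 hθ1
  set σ := barnesAbscissa a b with hσ
  obtain ⟨C, hC0, hC⟩ := exists_norm_barnesKernel_le_of_re_eq a b σ
    (barnesAbscissa_ne_nat a b) (fun n ↦ (re_add_barnesAbscissa_ne a b n).1)
    (fun n ↦ (re_add_barnesAbscissa_ne a b n).2) hθ0.le hθ2
  have hσ0 : 0 < σ := barnesAbscissa_pos a b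
  have hneg : Tendsto (fun y : ℂ ↦ -y) (𝓝 y₀) (𝓝 (-y₀)) := (continuous_neg.tendsto y₀)
  have hV1 : ∀ᶠ y in 𝓝 y₀, |Complex.arg (-y)| < α := by
    have : Tendsto (fun y : ℂ ↦ |Complex.arg (-y)|) (𝓝 y₀) (𝓝 |Complex.arg (-y₀)|) :=
      ((Complex.continuousAt_arg hy₀).tendsto.comp hneg).abs
    exact this.eventually (gt_mem_nhds hα1)
  have hV2 : ∀ᶠ y in 𝓝 y₀, -y ∈ Complex.slitPlane :=
    hneg.eventually (Complex.isOpen_slitPlane.mem_nhds hy₀)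
  have hV3 : ∀ᶠ y in 𝓝 y₀, ‖y‖ < ‖y₀‖ + 1 :=
    (continuous_norm.tendsto y₀).eventually (gt_mem_nhds (by linarith))
  refine ⟨3 * θ - α, C * (‖y₀‖ + 1) ^ σ, _, hV1.and (hV2.and hV3), by linarith, by positivity, ?_⟩
  rintro y ⟨h1, h2, h3⟩
  refine ⟨h2, fun t ↦ ?_⟩
  have hy0 : -y ≠ 0 := Complex.slitPlane_ne_zero h2
  have hre : ((σ : ℂ) + t * Complex.I).re = σ := by simp
  have him : ((σ : ℂ) + t * Complex.I).im = t := by simp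
  have hk := hC (σ + t * Complex.I) hre
  rw [him] at hk
  rw [norm_mul, Complex.norm_cpow_of_ne_zero hy0, hre, him, norm_neg, div_eq_mul_inv, ← Real.exp_neg]
  have he : -((-y).arg * t) ≤ α * |t| := by
    calc _ ≤ |(-y).arg * t| := neg_le_abs _
      _ = |(-y).arg| * |t| := abs_mul _ _
      _ ≤ _ := by gcongr
  calc _ ≤ (C * Real.exp (-(3 * θ) * |t|)) * ((‖y₀‖ + 1) ^ σ * Real.exp (α * |t|)) := by gcongr
    _ = _ := by
      have : -(3 * θ - α) * |t| = -(3 * θ) * |t| + α * |t| := by ring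
      rw [this, Real.exp_add]; ring

theorem GrowthBound.norm_add_le {κ C A : ℝ} {f : ℂ → ℂ} (hf : GrowthBound κ C A f) (hC : 0 ≤ C)
    (hA : 0 ≤ A) (hκ : 0 ≤ κ) {z s : ℂ} {n : ℕ} (hz : 1 - n ≤ z.re) (hs : 0 ≤ s.re) :
    ‖f (z + s)‖ ≤ C * A ^ n * n ! * Real.exp (κ * |z.im|) * Real.exp (κ * |s.im|) := by
  refine (hf.left (z + s) n (by simp; linarith)).trans ?_
  rw [mul_assoc (C * A ^ n * n !), ← Real.exp_add, ← mul_add]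
  gcongr
  simpa using abs_add_le z.im s.im

theorem GrowthBound.norm_add_le' {κ C A : ℝ} {f : ℂ → ℂ} (hf : GrowthBound κ C A f) (hC : 0 ≤ C)
    (hκ : 0 ≤ κ) {z s : ℂ} {n : ℕ} (hz : 1 + n ≤ z.re) (hs : 0 ≤ s.re) :
    ‖f (z + s)‖ ≤ C / n ! * Real.exp (κ * |z.im|) * Real.exp (κ * |s.im|) := by
  refine (hf.right (z + s) n (by simp; linarith)).trans ?_
  rw [mul_assoc (C / n !), ← Real.exp_add, ← mul_add]
  gcongr
  simpa using abs_add_le z.im s.im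

/-! ### Stability of the growth class under the integral operator -/

/-- `barnesShift` preserves growth bounds, locally uniformly in `y`. -/
theorem exists_growthBound_barnesShift (a b : ℂ) {y₀ : ℂ} (hy₀ : -y₀ ∈ Complex.slitPlane) :
    ∃ κ₀ : ℝ, ∃ V ∈ 𝓝 y₀, Real.pi / 2 < κ₀ ∧ ∀ κ, Real.pi / 2 < κ → κ < κ₀ → ∃ D : ℝ, 0 ≤ D ∧
      ∀ y ∈ V, ∀ (f : ℂ → ℂ) (C A : ℝ), 0 ≤ C → 0 ≤ A → GrowthBound κ C A f →
        GrowthBound κ (D * C) A (barnesShift a b y f) := by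
  obtain ⟨κ₀, C₀, V, hV, hκ₀, hC₀, hmaj⟩ := exists_barnes_majorant a b hy₀
  refine ⟨κ₀, V ∩ {y | ‖y‖ < ‖y₀‖ + 1}, inter_mem hV ((continuous_norm.tendsto y₀).eventually
    (gt_mem_nhds (by linarith))), hκ₀, fun κ hκ1 hκ2 ↦ ?_⟩
  have hκ0 : 0 ≤ κ := by linarith [Real.pi_pos]
  set σ := barnesAbscissa a b with hσ
  have hσ0 : 0 < σ := barnesAbscissa_pos a b
  set S : ℝ := ∑ k ∈ Finset.range (barnesIndex a b), ‖coeff a b k‖ * (‖y₀‖ + 1) ^ k with hS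
  set J : ℝ := ‖(2 * Real.pi * (Complex.Gamma a * Complex.Gamma b))⁻¹‖ *
    ∫ t : ℝ, C₀ * Real.exp (-(κ₀ - κ) * |t|) with hJ
  have hintg : Integrable fun t : ℝ ↦ C₀ * Real.exp (-(κ₀ - κ) * |t|) :=
    (integrable_exp_neg_mul_abs (sub_pos.2 hκ2)).const_mul _
  have hS0 : 0 ≤ S := Finset.sum_nonneg fun k _ ↦ by positivity
  have hJ0 : 0 ≤ J := mul_nonneg (norm_nonneg _) (integral_nonneg fun t ↦ by positivity)
  -- The operator evaluates f only at z+s with Re s ≥ 0, where a growth bound at level n still holds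
  -- at the same level. Hence A is unchanged and only C is multiplied, by S+J.
  have key : ∀ y ∈ V ∩ {y | ‖y‖ < ‖y₀‖ + 1}, ∀ (f : ℂ → ℂ) (z : ℂ) (B : ℝ), 0 ≤ B →
      (∀ s : ℂ, 0 ≤ s.re → ‖f (z + s)‖ ≤ B * Real.exp (κ * |s.im|)) →
      ‖barnesShift a b y f z‖ ≤ (S + J) * B := by
    intro y hy f z B hB hf
    rw [barnesShift, add_mul]
    refine (norm_add_le _ _).trans (add_le_add ?_ ?_)
    · refine (norm_sum_le _ _).trans ?_
      rw [hS, Finset.sum_mul]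
      refine Finset.sum_le_sum fun k _ ↦ ?_
      rw [norm_mul, norm_mul, norm_pow]
      have := hf k (by simp)
      simp only [Complex.natCast_im, abs_zero, mul_zero, Real.exp_zero, mul_one] at this
      have hy2 : ‖y‖ ≤ ‖y₀‖ + 1 := le_of_lt hy.2
      gcongr
    · rw [norm_mul, hJ, mul_assoc ‖_‖]
      refine mul_le_mul_of_nonneg_left ?_ (norm_nonneg _)
      rw [← integral_mul_const]
      refine norm_integral_le_of_norm_le (hintg.mul_const B) (ae_of_all _ fun t ↦ ?_)
      rw [norm_mul]
      have h1 := (hmaj y hy.1).2 t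
      have h2 := hf (σ + t * Complex.I) (by simp [hσ0.le])
      simp only [Complex.add_im, Complex.ofReal_im, Complex.mul_im, Complex.ofReal_re,
        Complex.I_im, mul_one, Complex.I_re, mul_zero, add_zero, zero_add] at h2
      calc _ ≤ (C₀ * Real.exp (-κ₀ * |t|)) * (B * Real.exp (κ * |t|)) := by gcongr
        _ = _ := by
          have : -(κ₀ - κ) * |t| = -κ₀ * |t| + κ * |t| := by ring
          rw [this, Real.exp_add]; ring
  refine ⟨S + J, add_nonneg hS0 hJ0, fun y hy f C A hC hA hf ↦ ⟨fun z n hz ↦ ?_, fun z n hz ↦ ?_⟩⟩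
  · have h := key y hy f z (C / n ! * Real.exp (κ * |z.im|)) (by positivity)
      fun s hs ↦ hf.norm_add_le' hC hκ0 hz hs
    calc _ ≤ _ := h
      _ = _ := by ring
  · have h := key y hy f z (C * A ^ n * n ! * Real.exp (κ * |z.im|)) (by positivity)
      fun s hs ↦ hf.norm_add_le hC hA hκ0 hz hs
    calc _ ≤ _ := h
      _ = _ := by ring

/-- `barnesShift` preserves joint holomorphy. -/
theorem differentiableAt_barnesShift {E : Type*} [NormedAddCommGroup E] [NormedSpace ℂ E]
    [FiniteDimensional ℂ E] (a b : ℂ) {y₀ : ℂ} (hy₀ : -y₀ ∈ Complex.slitPlane) {f : E → ℂ → ℂ}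
    {w₀ : E} (hd : ∀ᶠ w in 𝓝 w₀, ∀ z, DifferentiableAt ℂ (fun p : E × ℂ ↦ f p.1 p.2) (w, z))
    (hg : ∀ κ, Real.pi / 2 < κ → ∃ C A : ℝ, 0 ≤ C ∧ 1 ≤ A ∧ ∀ᶠ w in 𝓝 w₀, GrowthBound κ C A (f w))
    (z₀ : ℂ) :
    DifferentiableAt ℂ (fun p : ℂ × E × ℂ ↦ barnesShift a b p.1 (f p.2.1) p.2.2) (y₀, w₀, z₀) := by
  obtain ⟨κ₀, C₀, V, hV, hκ₀, hC₀, hmaj⟩ := exists_barnes_majorant a b hy₀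
  obtain ⟨κ, hκ1, hκ2⟩ := exists_between hκ₀
  obtain ⟨C, A, hC, hA, hgr⟩ := hg κ hκ1
  have hκ0 : 0 ≤ κ := by linarith [Real.pi_pos]
  have hA0 : 0 ≤ A := by linarith
  have hcomp : ∀ (s : ℂ) (p : ℂ × E × ℂ),
      (∀ z, DifferentiableAt ℂ (fun p : E × ℂ ↦ f p.1 p.2) (p.2.1, z)) →
      DifferentiableAt ℂ (fun p : ℂ × E × ℂ ↦ f p.2.1 (p.2.2 + s)) p := by
    intro s p hp
    exact DifferentiableAt.comp (g := fun p : E × ℂ ↦ f p.1 p.2)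
      (f := fun p : ℂ × E × ℂ ↦ (p.2.1, p.2.2 + s)) p (hp _) (by fun_prop)
  set σ := barnesAbscissa a b with hσ
  have hσ0 : 0 < σ := barnesAbscissa_pos a b
  unfold barnesShift
  refine DifferentiableAt.add ?_ (DifferentiableAt.const_mul ?_ _)
  · refine DifferentiableAt.fun_sum fun k _ ↦ ?_
    exact DifferentiableAt.mul (by fun_prop) (hcomp k _ hd.self_of_nhds)
  · obtain ⟨n, hn⟩ := exists_nat_ge (2 - z₀.re)
    have hz : ∀ᶠ z in 𝓝 z₀, 1 - (n : ℝ) ≤ z.re ∧ |z.im| ≤ |z₀.im| + 1 := by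
      refine Filter.Eventually.and ?_ ?_
      · exact (Complex.continuous_re.tendsto z₀).eventually (le_mem_nhds (by linarith))
      · exact ((Complex.continuous_im.tendsto z₀).abs).eventually (ge_mem_nhds (by linarith))
    have hs : ∀ᶠ p : ℂ × E × ℂ in 𝓝 (y₀, w₀, z₀), p.1 ∈ V ∧
        ((∀ z, DifferentiableAt ℂ (fun p : E × ℂ ↦ f p.1 p.2) (p.2.1, z)) ∧
          GrowthBound κ C A (f p.2.1)) ∧ (1 - (n : ℝ) ≤ p.2.2.re ∧ |p.2.2.im| ≤ |z₀.im| + 1) := by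
      rw [nhds_prod_eq, nhds_prod_eq]
      exact Filter.Eventually.prod_mk hV ((hd.and hgr).prod_mk hz)
    refine differentiableAt_integral_of_dominated hs
      (bound := fun t ↦ (C₀ * (C * A ^ n * n ! * Real.exp (κ * (|z₀.im| + 1)))) *
        Real.exp (-(κ₀ - κ) * |t|)) ?_ ?_ ?_ ?_
    · rintro ⟨y, w, z⟩ ⟨h1, ⟨h2, -⟩, -⟩
      refine Continuous.aestronglyMeasurable ?_
      refine ((continuous_barnesKernel_line (barnesAbscissa_ne_nat a b)
        (fun n ↦ (re_add_barnesAbscissa_ne a b n).1)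
        (fun n ↦ (re_add_barnesAbscissa_ne a b n).2)).mul ?_).mul ?_
      · exact Continuous.const_cpow (by fun_prop)
          (Or.inl (Complex.slitPlane_ne_zero (hmaj y h1).1))
      · have hf : Continuous (f w) := by
          rw [continuous_iff_continuousAt]
          intro z
          exact ContinuousAt.comp (g := fun p : E × ℂ ↦ f p.1 p.2) (f := fun z ↦ (w, z))
            (h2 z).continuousAt (by fun_prop)
        exact hf.comp (by fun_prop)
    · refine ae_of_all _ fun t ↦ ?_
      rintro ⟨y, w, z⟩ ⟨h1, ⟨-, h2⟩, h3, h4⟩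
      rw [norm_mul]
      have b1 := (hmaj y h1).2 t
      have b2 := h2.norm_add_le hC hA0 hκ0 h3 (s := σ + t * Complex.I) (by simp [hσ0.le])
      have him : ((σ : ℂ) + t * Complex.I).im = t := by simp
      rw [him] at b2
      calc _ ≤ (C₀ * Real.exp (-κ₀ * |t|)) *
            (C * A ^ n * n ! * Real.exp (κ * |z.im|) * Real.exp (κ * |t|)) := by gcongr
        _ ≤ (C₀ * Real.exp (-κ₀ * |t|)) *
            (C * A ^ n * n ! * Real.exp (κ * (|z₀.im| + 1)) * Real.exp (κ * |t|)) := by gcongr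
        _ = _ := by
          have : -(κ₀ - κ) * |t| = -κ₀ * |t| + κ * |t| := by ring
          rw [this, Real.exp_add]; ring
    · exact (integrable_exp_neg_mul_abs (sub_pos.2 hκ2)).const_mul _
    · rintro t ⟨y, w, z⟩ ⟨h1, ⟨h2, -⟩, -⟩
      refine DifferentiableAt.mul (DifferentiableAt.const_mul ?_ _) (hcomp _ _ h2)
      exact DifferentiableAt.cpow_const (by fun_prop) (hmaj y h1).1

/-! ### Stability of the growth class under the series operator -/

theorem choose_mul_pow_le {x : ℝ} (hx : 0 ≤ x) (k n : ℕ) : (k.choose n : ℝ) * x ^ n ≤ (1 + x) ^ k := by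
  rcases le_or_gt n k with h | h
  · rw [add_comm 1 x, add_pow]
    refine le_trans (le_of_eq ?_) (Finset.single_le_sum
      (f := fun m ↦ x ^ m * 1 ^ (k - m) * (k.choose m : ℝ)) (fun i _ ↦ by positivity)
      (Finset.mem_range.2 (by omega : n < k + 1)))
    simp [mul_comm]
  · rw [Nat.choose_eq_zero_of_lt h]; simp; positivity

/-- Moving k steps to the right gains 1/k! up to the factor (1+x)ᵏ. If k ≤ n this follows from
(n-k)! k! ≤ n!. If k > n, write 1/(k-n)! as n! times `k.choose n` over k! and use the binomial
theorem, which costs x⁻ⁿ, absorbed by B. As x may be arbitrarily small, the factor does not shrink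
the disc |y| < 1. -/
theorem GrowthBound.norm_add_nat_le {κ C A B x : ℝ} {f : ℂ → ℂ} (hf : GrowthBound κ C A f)
    (hC : 0 ≤ C) (hA : 1 ≤ A) (hx : 0 < x) (hAB : A ≤ B) (hxB : 1 / x ≤ B) {z : ℂ} {n : ℕ}
    (hz : 1 - n ≤ z.re) (k : ℕ) :
    ‖f (z + k)‖ ≤ C * B ^ n * n ! * Real.exp (κ * |z.im|) * ((1 + x) ^ k / k !) := by
  have hB1 : 1 ≤ B := hA.trans hAB
  have hB0 : 0 ≤ B := by linarith
  have him : (z + k).im = z.im := by simp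
  rcases le_or_gt k n with h | h
  · have h1 := hf.left (z + k) (n - k) (by rw [Nat.cast_sub h]; simp; linarith)
    rw [him] at h1
    have h2 : A ^ (n - k) ≤ B ^ n :=
      (pow_le_pow_left₀ (by linarith) hAB _).trans (pow_le_pow_right₀ hB1 (Nat.sub_le n k))
    have h3 : ((n - k)! : ℝ) ≤ n ! * ((1 + x) ^ k / k !) := by
      rw [mul_div_assoc', le_div_iff₀ (by positivity)]
      have h4 : ((n - k)! * k ! : ℝ) ≤ n ! := by
        have := Nat.le_of_dvd (Nat.factorial_pos n) (Nat.factorial_mul_factorial_dvd_factorial h)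
        rw [mul_comm]
        exact_mod_cast this
      refine h4.trans (le_mul_of_one_le_right (by positivity) (one_le_pow₀ (by linarith)))
    calc _ ≤ _ := h1
      _ ≤ C * B ^ n * (n ! * ((1 + x) ^ k / k !)) * Real.exp (κ * |z.im|) := by gcongr
      _ = _ := by ring
  · have h1 := hf.right (z + k) (k - n) (by rw [Nat.cast_sub h.le]; simp; linarith)
    rw [him] at h1
    have h3 : (1 : ℝ) / (k - n)! ≤ B ^ n * n ! * ((1 + x) ^ k / k !) := by
      have e : (1 : ℝ) / (k - n)! = (1 / x) ^ n * n ! * ((k.choose n * x ^ n) / k !) := by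
        rw [← Nat.choose_mul_factorial_mul_factorial h.le]
        have : (k.choose n : ℝ) ≠ 0 := by exact_mod_cast (Nat.choose_pos h.le).ne'
        push_cast
        rw [one_div_pow]
        field_simp
      rw [e]
      gcongr
      exact choose_mul_pow_le hx.le k n
    calc _ ≤ _ := h1
      _ = C * (1 / (k - n)!) * Real.exp (κ * |z.im|) := by ring
      _ ≤ C * (B ^ n * n ! * ((1 + x) ^ k / k !)) * Real.exp (κ * |z.im|) := by gcongr
      _ = _ := by ring

theorem exists_radii {y₀ : ℂ} (hy₀ : ‖y₀‖ < 1) :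
    ∃ r x : ℝ, 0 ≤ r ∧ 0 < x ∧ ‖y₀‖ < r ∧ r * (1 + x) < 1 := by
  refine ⟨(1 + ‖y₀‖) / 2, (1 - ‖y₀‖) / 4, by positivity, by linarith, by linarith, ?_⟩
  nlinarith [norm_nonneg y₀]

/-- `seriesShift` preserves growth bounds, locally uniformly in `y`. -/
theorem exists_growthBound_seriesShift (a b : ℂ) {y₀ : ℂ} (hy₀ : ‖y₀‖ < 1) {A : ℝ} (hA : 1 ≤ A) :
    ∃ V ∈ 𝓝 y₀, ∃ D A' : ℝ, 0 ≤ D ∧ 1 ≤ A' ∧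
      ∀ y ∈ V, ∀ (f : ℂ → ℂ) (κ C : ℝ), 0 ≤ C → GrowthBound κ C A f →
        GrowthBound κ (D * C) A' (seriesShift a b y f) := by
  obtain ⟨r, x, hr0, hx, hr, hrx⟩ := exists_radii hy₀
  have hsum := summable_norm_coeff_div a b (r := r * (1 + x)) (by positivity) hrx
  -- Unlike the integral operator, the series enlarges A, to max(A, 1/x): near the unit circle x is
  -- forced to be small.
  refine ⟨{y | ‖y‖ < r}, (continuous_norm.tendsto y₀).eventually (gt_mem_nhds hr),
    ∑' k : ℕ, ‖coeff a b k‖ / k ! * (r * (1 + x)) ^ k, max A (1 / x),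
    tsum_nonneg fun k ↦ by positivity, hA.trans (le_max_left _ _), ?_⟩
  intro y hy f κ C hC hf
  have key : ∀ (z : ℂ) (B : ℝ), 0 ≤ B → (∀ k : ℕ, ‖f (z + k)‖ ≤ B * ((1 + x) ^ k / k !)) →
      ‖seriesShift a b y f z‖ ≤ (∑' k : ℕ, ‖coeff a b k‖ / k ! * (r * (1 + x)) ^ k) * B := by
    intro z B hB hfB
    refine tsum_of_norm_bounded (hsum.hasSum.mul_right B) fun k ↦ ?_
    rw [norm_mul, norm_mul, norm_pow]
    have hy' : ‖y‖ ≤ r := le_of_lt hy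
    calc _ ≤ ‖coeff a b k‖ * r ^ k * (B * ((1 + x) ^ k / k !)) := by gcongr; exact hfB k
      _ = _ := by rw [mul_pow]; ring
  refine ⟨fun z n hz ↦ ?_, fun z n hz ↦ ?_⟩
  · have h := key z (C / n ! * Real.exp (κ * |z.im|)) (by positivity) fun k ↦ ?_
    · calc _ ≤ _ := h
        _ = _ := by ring
    · have h1 := hf.right (z + k) (n + k) (by push_cast; simp; linarith)
      have him : (z + k).im = z.im := by simp
      rw [him] at h1
      have h2 : (n ! * k ! : ℝ) ≤ (n + k)! := by
        exact_mod_cast Nat.le_of_dvd (Nat.factorial_pos _) (Nat.factorial_mul_factorial_dvd_factorial_add n k)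
      calc _ ≤ _ := h1
        _ ≤ C / (n ! * k !) * Real.exp (κ * |z.im|) * 1 := by rw [mul_one]; gcongr
        _ ≤ C / (n ! * k !) * Real.exp (κ * |z.im|) * (1 + x) ^ k := by
          gcongr; exact one_le_pow₀ (by linarith)
        _ = _ := by field_simp
  · have h := key z (C * max A (1 / x) ^ n * n ! * Real.exp (κ * |z.im|)) (by positivity)
      fun k ↦ hf.norm_add_nat_le hC hA hx (le_max_left _ _) (le_max_right _ _) hz k
    calc _ ≤ _ := h
      _ = _ := by ring

theorem GrowthBound.summable_seriesShift {κ C A : ℝ} {f : ℂ → ℂ} (hf : GrowthBound κ C A f)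
    (hC : 0 ≤ C) (hA : 1 ≤ A) (a b : ℂ) {y : ℂ} (hy : ‖y‖ < 1) (z : ℂ) :
    Summable fun k : ℕ ↦ coeff a b k * y ^ k * f (z + k) := by
  obtain ⟨r, x, hr0, hx, hr, hrx⟩ := exists_radii hy
  obtain ⟨n, hn⟩ := exists_nat_ge (1 - z.re)
  refine Summable.of_norm_bounded ((summable_norm_coeff_div a b (by positivity) hrx).mul_right
    (C * max A (1 / x) ^ n * n ! * Real.exp (κ * |z.im|))) fun k ↦ ?_
  rw [norm_mul, norm_mul, norm_pow]
  have h := hf.norm_add_nat_le hC hA hx (le_max_left A (1 / x)) (le_max_right _ _)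
    (n := n) (by linarith) k
  calc _ ≤ ‖coeff a b k‖ * r ^ k * (C * max A (1 / x) ^ n * n ! * Real.exp (κ * |z.im|) *
        ((1 + x) ^ k / k !)) := by gcongr
    _ = _ := by rw [mul_pow]; ring

/-- `seriesShift` preserves joint holomorphy. -/
theorem differentiableAt_seriesShift {E : Type*} [NormedAddCommGroup E] [NormedSpace ℂ E]
    [FiniteDimensional ℂ E] (a b : ℂ) {y₀ : ℂ} (hy₀ : ‖y₀‖ < 1) {f : E → ℂ → ℂ}
    {w₀ : E} (hd : ∀ᶠ w in 𝓝 w₀, ∀ z, DifferentiableAt ℂ (fun p : E × ℂ ↦ f p.1 p.2) (w, z))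
    {κ C A : ℝ} (hκ : 0 ≤ κ) (hC : 0 ≤ C) (hA : 1 ≤ A)
    (hgr : ∀ᶠ w in 𝓝 w₀, GrowthBound κ C A (f w)) (z₀ : ℂ) :
    DifferentiableAt ℂ (fun p : ℂ × E × ℂ ↦ seriesShift a b p.1 (f p.2.1) p.2.2) (y₀, w₀, z₀) := by
  obtain ⟨r, x, hr0, hx, hr, hrx⟩ := exists_radii hy₀
  obtain ⟨n, hn⟩ := exists_nat_ge (2 - z₀.re)
  have hz : ∀ᶠ z in 𝓝 z₀, 1 - (n : ℝ) ≤ z.re ∧ |z.im| ≤ |z₀.im| + 1 := by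
    refine Filter.Eventually.and ?_ ?_
    · exact (Complex.continuous_re.tendsto z₀).eventually (le_mem_nhds (by linarith))
    · exact ((Complex.continuous_im.tendsto z₀).abs).eventually (ge_mem_nhds (by linarith))
  have hV : ∀ᶠ y in 𝓝 y₀, ‖y‖ ≤ r := (continuous_norm.tendsto y₀).eventually (ge_mem_nhds hr)
  have hs : ∀ᶠ p : ℂ × E × ℂ in 𝓝 (y₀, w₀, z₀), ‖p.1‖ ≤ r ∧
      ((∀ z, DifferentiableAt ℂ (fun p : E × ℂ ↦ f p.1 p.2) (p.2.1, z)) ∧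
        GrowthBound κ C A (f p.2.1)) ∧ (1 - (n : ℝ) ≤ p.2.2.re ∧ |p.2.2.im| ≤ |z₀.im| + 1) := by
    rw [nhds_prod_eq, nhds_prod_eq]
    exact Filter.Eventually.prod_mk hV ((hd.and hgr).prod_mk hz)
  refine differentiableAt_tsum_of_dominated hs
    (bound := fun k ↦ ‖coeff a b k‖ / k ! * (r * (1 + x)) ^ k *
      (C * max A (1 / x) ^ n * n ! * Real.exp (κ * (|z₀.im| + 1)))) ?_
    ((summable_norm_coeff_div a b (by positivity) hrx).mul_right _) ?_
  · rintro ⟨y, w, z⟩ ⟨h1, ⟨-, h2⟩, h3, h4⟩ k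
    rw [norm_mul, norm_mul, norm_pow]
    have h := h2.norm_add_nat_le hC hA hx (le_max_left A (1 / x)) (le_max_right _ _) h3 k
    calc _ ≤ ‖coeff a b k‖ * r ^ k * (C * max A (1 / x) ^ n * n ! * Real.exp (κ * |z.im|) *
          ((1 + x) ^ k / k !)) := by gcongr
      _ ≤ ‖coeff a b k‖ * r ^ k * (C * max A (1 / x) ^ n * n ! * Real.exp (κ * (|z₀.im| + 1)) *
          ((1 + x) ^ k / k !)) := by gcongr
      _ = _ := by rw [mul_pow]; ring
  · rintro k ⟨y, w, z⟩ ⟨-, ⟨h2, -⟩, -⟩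
    refine DifferentiableAt.mul (by fun_prop) ?_
    exact DifferentiableAt.comp (g := fun p : E × ℂ ↦ f p.1 p.2)
      (f := fun p : ℂ × E × ℂ ↦ (p.2.1, p.2.2 + (k : ℂ))) _ (h2 _) (by fun_prop)

end LauricellaB

/-! ### Residues indexed by pole families -/

/-- Shifting a vertical line of integration across finitely many indexed simple poles. -/
theorem Complex.integral_vertical_sub_eq_sum_residues_of_injOn {ι : Type*} {σ₁ σ₂ : ℝ}
    (hσ : σ₁ ≤ σ₂) {g : ℂ → ℂ} (P : Finset ι) (p r : ι → ℂ) (hinj : Set.InjOn p P)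
    (hmem : ∀ i ∈ P, σ₁ < (p i).re ∧ (p i).re < σ₂)
    (hd : ∀ s : ℂ, σ₁ ≤ s.re → s.re ≤ σ₂ → (∀ i ∈ P, s ≠ p i) → DifferentiableAt ℂ g s)
    (hres : ∀ i ∈ P, Tendsto (fun s ↦ (s - p i) * g s) (𝓝[≠] p i) (𝓝 (r i)))
    (hdec : Complex.DecaysOnStrip g σ₁ σ₂)
    (h1 : Integrable fun t : ℝ ↦ g (σ₁ + t * Complex.I))
    (h2 : Integrable fun t : ℝ ↦ g (σ₂ + t * Complex.I)) :
    (∫ t : ℝ, g (σ₂ + t * Complex.I)) - ∫ t : ℝ, g (σ₁ + t * Complex.I) =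
      2 * Real.pi * ∑ i ∈ P, r i := by
  classical
  rw [Complex.integral_vertical_sub_eq_sum_residues hσ
    (fun q ↦ limUnder (𝓝[≠] q) fun s ↦ (s - q) * g s) (P.image p) ?_ ?_ ?_ hdec h1 h2,
    Finset.sum_image hinj]
  · congr 1
    exact Finset.sum_congr rfl fun i hi ↦ (hres i hi).limUnder_eq
  · simpa using hmem
  · rintro s ⟨⟨hs1, hs2⟩, hs3⟩
    refine (hd s hs1 hs2 fun i hi h ↦ hs3 ?_).differentiableWithinAt
    simpa using ⟨i, hi, h.symm⟩
  · intro q hq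
    obtain ⟨i, hi, rfl⟩ := Finset.mem_image.1 hq
    rw [(hres i hi).limUnder_eq]
    exact hres i hi

/-- The residues of the Gamma function. -/
theorem Complex.tendsto_add_nat_mul_Gamma (n : ℕ) :
    Tendsto (fun w : ℂ ↦ (w + n) * Complex.Gamma w) (𝓝[≠] (-n : ℂ)) (𝓝 ((-1) ^ n / n !)) := by
  -- By the functional equation (w+n)Γ(w) equals this reciprocal away from -n, and the reciprocal is
  -- continuous at -n.
  have hc : ContinuousAt (fun w : ℂ ↦ ((∏ j ∈ Finset.range n, (w + j)) *
      (Complex.Gamma (w + n + 1))⁻¹)⁻¹) (-n : ℂ) := by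
    refine ContinuousAt.inv₀ (ContinuousAt.mul (by fun_prop) ?_) ?_
    · exact ContinuousAt.comp (g := fun s : ℂ ↦ (Complex.Gamma s)⁻¹)
        Complex.differentiable_one_div_Gamma.continuous.continuousAt (by fun_prop)
    · simp only [neg_add_cancel, zero_add, Complex.Gamma_one, inv_one, mul_one]
      refine Finset.prod_ne_zero_iff.2 fun j hj h ↦ ?_
      have : (j : ℂ) = n := by linear_combination h
      have : j = n := by exact_mod_cast this
      have := Finset.mem_range.1 hj
      omega
  have hval : ((∏ j ∈ Finset.range n, ((-n : ℂ) + j)) *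
      (Complex.Gamma ((-n : ℂ) + n + 1))⁻¹)⁻¹ = (-1) ^ n / n ! := by
    have hprod : ∏ j ∈ Finset.range n, ((-n : ℂ) + j) = (-1) ^ n * n ! := by
      rw [← Finset.prod_range_add_one_eq_factorial, Nat.cast_prod, ← Finset.prod_range_reflect,
        ← Finset.card_range n, ← Finset.prod_const, Finset.card_range, ← Finset.prod_mul_distrib]
      refine Finset.prod_congr rfl fun j hj ↦ ?_
      have hj' := Finset.mem_range.1 hj
      rw [Nat.cast_sub (by omega), Nat.cast_sub (by omega)]
      push_cast; ring
    rw [hprod]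
    simp only [neg_add_cancel, zero_add, Complex.Gamma_one, inv_one, mul_one, mul_inv]
    rw [← inv_pow, inv_neg, inv_one, div_eq_mul_inv]
  have := hc.tendsto.mono_left (nhdsWithin_le_nhds (s := {(-n : ℂ)}ᶜ))
  rw [hval] at this
  refine this.congr' ?_
  filter_upwards [self_mem_nhdsWithin] with w hw
  have hw' : w + n ≠ 0 := fun h ↦ hw (by simp; linear_combination h)
  have h := Complex.inv_Gamma_eq_prod_mul w (n + 1)
  rw [Finset.prod_range_succ] at h
  push_cast at h
  rw [← add_assoc] at h
  rw [← inv_inv (Complex.Gamma w), h, mul_inv, mul_inv, mul_inv]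
  field_simp

/-! ### The Gamma function on lines receding to either side -/

namespace LauricellaB

theorem tendsto_complex_add_div_add_atTop (x y : ℂ) :
    Tendsto (fun n : ℕ ↦ ‖x + n‖ / ‖y + n‖) atTop (𝓝 1) := by
  have hinf : Tendsto (fun n : ℕ ↦ y + (n : ℂ)) atTop (Bornology.cobounded ℂ) := by
    rw [← tendsto_norm_atTop_iff_cobounded]
    refine tendsto_atTop_mono (f := fun n : ℕ ↦ -‖y‖ + (n : ℝ)) (fun n ↦ ?_)
      (tendsto_atTop_add_const_left _ _ tendsto_natCast_atTop_atTop)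
    have := norm_sub_le (y + (n : ℂ)) y
    rw [add_sub_cancel_left, Complex.norm_natCast] at this
    linarith
  have h : Tendsto (fun n : ℕ ↦ 1 + (x - y) * (y + n)⁻¹) atTop (𝓝 (1 + (x - y) * 0)) :=
    tendsto_const_nhds.add ((tendsto_inv₀_cobounded.comp hinf).const_mul _)
  rw [mul_zero, add_zero] at h
  have h' := h.norm
  rw [norm_one] at h'
  refine h'.congr' ?_
  filter_upwards [hinf.eventually (Bornology.eventually_ne_cobounded 0)] with n hn
  rw [← norm_div]
  congr 1
  field_simp
  ring

theorem exists_factorial_add_le (M : ℕ) : ∃ C : ℝ, 0 ≤ C ∧ ∀ n : ℕ, ((n + M)! : ℝ) ≤ C * 2 ^ n * n ! := by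
  have hratio : ∀ n : ℕ, ((n + 1 + M)! : ℝ) / (n + 1)! ≤
      ((M + 1 : ℝ) + n) / (1 + n) * (((n + M)! : ℝ) / n !) := by
    intro n
    rw [show n + 1 + M = (n + M) + 1 by ring, Nat.factorial_succ, Nat.factorial_succ]
    push_cast
    refine le_of_eq ?_
    field_simp
    ring
  obtain ⟨C, hC0, hC⟩ := exists_le_mul_pow_of_ratio
    (u := fun n ↦ ((n + M)! : ℝ) / n !) (fun n ↦ by positivity) hratio
    (tendsto_add_div_add_atTop _ _) one_lt_two
  exact ⟨C, hC0, fun k ↦ (div_le_iff₀ (by positivity)).1 (hC k)⟩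

/-- The Gamma function on vertical lines tending to the right. -/
theorem exists_norm_Gamma_le_right {σ : ℝ} (hσ : 0 < σ) :
    ∃ C : ℝ, 0 ≤ C ∧ ∀ (n : ℕ) (s : ℂ), s.re = σ + n →
      ‖Complex.Gamma s‖ ≤ C * 4 ^ n * n ! * Real.exp (-(Real.pi / 3) * |s.im|) := by
  have hratio : ∀ n : ℕ, Real.Gamma (σ + (n + 1 : ℕ)) / (n + 1)! ≤
      (σ + n) / (1 + n) * (Real.Gamma (σ + n) / n !) := by
    intro n
    have : Real.Gamma (σ + (n + 1 : ℕ)) = (σ + n) * Real.Gamma (σ + n) := by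
      push_cast
      rw [← add_assoc, Real.Gamma_add_one (by positivity)]
    rw [this, Nat.factorial_succ]
    push_cast
    refine le_of_eq ?_
    field_simp
    ring
  obtain ⟨C, hC0, hC⟩ := exists_le_mul_pow_of_ratio
    (u := fun n : ℕ ↦ Real.Gamma (σ + n) / n !)
    (fun n ↦ div_nonneg (Real.Gamma_pos_of_pos (by positivity)).le (by positivity)) hratio
    (tendsto_add_div_add_atTop _ _) one_lt_two
  refine ⟨C * 2 ^ σ, by positivity, fun n s hs ↦ ?_⟩
  -- With θ = π/3 the factor (1/cos θ)^{Re s} is 2^{σ+n}; together with the 2ⁿ for Γ(σ+n)/n! it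
  -- makes 4ⁿ.
  have h := Complex.norm_Gamma_le (s := s) (by rw [hs]; positivity) (θ := Real.pi / 3)
    (by positivity) (by linarith [Real.pi_pos])
  rw [Real.cos_pi_div_three, one_div_one_div, hs, Real.rpow_add two_pos, Real.rpow_natCast] at h
  have h2 := (div_le_iff₀ (by positivity)).1 (hC n)
  calc _ ≤ _ := h
    _ ≤ (C * 2 ^ n * n !) * (2 ^ σ * 2 ^ n) * Real.exp (-(Real.pi / 3) * |s.im|) := by gcongr
    _ = _ := by
      have : (4 : ℝ) ^ n = 2 ^ n * 2 ^ n := by rw [← mul_pow]; norm_num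
      rw [this]; ring

/-- The Gamma function on vertical lines tending to the left. -/
theorem exists_norm_Gamma_le_left {σ : ℝ} (hσ : σ ≤ 0) (hintg : ∀ n : ℤ, σ ≠ n) :
    ∃ C : ℝ, 0 ≤ C ∧ ∀ (n : ℕ) (s : ℂ), s.re = σ - n →
      ‖Complex.Gamma s‖ ≤ C / n ! * Real.exp (-(Real.pi / 3) * |s.im|) := by
  have hpi := Real.pi_pos
  -- Reflection: 1/Γ(1-s) supplies 1/n! at rate 2π/3, the sine in the denominator decay at rate π,
  -- and the net decay is π/3. Shifting by n leaves the modulus of the sine unchanged, so the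
  -- constant is the same for all n.
  obtain ⟨C, A, hC0, hA, hG⟩ := exists_growthBound_inv_Gamma (κ := 2 * Real.pi / 3) (by linarith)
  have hsin : 0 < |Real.sin (Real.pi * σ)| := by
    rw [abs_pos]
    intro h
    obtain ⟨n, hn⟩ := Real.sin_eq_zero_iff.1 h
    refine hintg n ?_
    rw [mul_comm] at hn
    exact (mul_left_cancel₀ hpi.ne' hn).symm
  refine ⟨2 * Real.pi / |Real.sin (Real.pi * σ)| * C, by positivity, fun n s hs ↦ ?_⟩
  have h1 := hG.right (1 - s) n (by simp [hs]; linarith)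
  have h1im : |(1 - s).im| = |s.im| := by simp
  rw [h1im] at h1
  have h2 := Complex.le_norm_sin (Real.pi * s)
  have hre : ((Real.pi : ℂ) * s).re = Real.pi * σ - n * Real.pi := by simp [hs]; ring
  have him : |((Real.pi : ℂ) * s).im| = Real.pi * |s.im| := by simp [abs_mul, abs_of_pos hpi]
  have hsn : |Real.sin (Real.pi * σ - n * Real.pi)| = |Real.sin (Real.pi * σ)| := by
    rw [Real.sin_sub_nat_mul_pi, abs_mul]; simp
  rw [hre, him, hsn] at h2
  have hpos : 0 < |Real.sin (Real.pi * σ)| * (Real.exp (Real.pi * |s.im|) / 2) := by positivity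
  have hne : Complex.Gamma (1 - s) ≠ 0 := by
    refine Complex.Gamma_ne_zero_of_re_pos ?_
    simp [hs]
    have : (0 : ℝ) ≤ n := n.cast_nonneg
    linarith
  have hrefl := Complex.Gamma_mul_Gamma_one_sub s
  have hG : Complex.Gamma s = Real.pi / Complex.sin (Real.pi * s) * (Complex.Gamma (1 - s))⁻¹ := by
    rw [← hrefl]; field_simp
  have hpin : ‖(Real.pi : ℂ)‖ = Real.pi := by simp [abs_of_pos hpi]
  rw [hG, norm_mul, norm_div, hpin]
  calc _ ≤ Real.pi / (|Real.sin (Real.pi * σ)| * (Real.exp (Real.pi * |s.im|) / 2)) *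
        (C / n ! * Real.exp (2 * Real.pi / 3 * |s.im|)) := by gcongr
    _ = 2 * Real.pi / |Real.sin (Real.pi * σ)| * C / n ! *
        (Real.exp (2 * Real.pi / 3 * |s.im|) / Real.exp (Real.pi * |s.im|)) := by field_simp
    _ = _ := by rw [← Real.exp_sub]; ring_nf

/-! ### One variable on the negative axis: residues and estimates -/

/-- The Mellin–Barnes integrand at `y = -x`. -/
noncomputable def barnesIntegrand (a b : ℂ) (x : ℝ) (f : ℂ → ℂ) (z s : ℂ) : ℂ :=
  barnesKernel a b s * (x : ℂ) ^ s * f (z + s)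

/-- The terms of the expansion of `barnesShift` at infinity. -/
noncomputable def infinityShiftTerm (a b y : ℂ) (f : ℂ → ℂ) (z : ℂ) (k : ℕ) : ℂ :=
  Complex.Gamma (b - a - k) * Complex.Gamma (a + k) / (k ! * y ^ k) * f (z - (a + k))

theorem barnesKernel_comm (a b s : ℂ) : barnesKernel a b s = barnesKernel b a s := by
  rw [barnesKernel, barnesKernel]; ring

theorem barnesIntegrand_comm (a b : ℂ) (x : ℝ) (f : ℂ → ℂ) (z s : ℂ) :
    barnesIntegrand a b x f z s = barnesIntegrand b a x f z s := by
  rw [barnesIntegrand, barnesIntegrand, barnesKernel_comm]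

theorem Gamma_add_nat_eq {a : ℂ} (ha : ∀ n : ℕ, a ≠ -n) (k : ℕ) :
    Complex.Gamma (a + k) = (ascPochhammer ℂ k).eval a * Complex.Gamma a := by
  induction k with
  | zero => simp
  | succ k ih =>
    have h0 : a + k ≠ 0 := fun h ↦ ha k (by linear_combination h)
    push_cast
    rw [← add_assoc, Complex.Gamma_add_one _ h0, ih, ascPochhammer_succ_eval]; ring

section OneVariable

variable {a b : ℂ} {x : ℝ} {f : ℂ → ℂ}

theorem differentiableAt_barnesIntegrand (hx : 0 < x) (hf : Differentiable ℂ f) (z : ℂ) {s : ℂ}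
    (h0 : ∀ n : ℕ, s ≠ n) (ha : ∀ n : ℕ, a + s ≠ -n) (hb : ∀ n : ℕ, b + s ≠ -n) :
    DifferentiableAt ℂ (barnesIntegrand a b x f z) s := by
  have hx' : (x : ℂ) ≠ 0 := by exact_mod_cast hx.ne'
  unfold barnesIntegrand barnesKernel
  refine DifferentiableAt.mul (DifferentiableAt.mul (DifferentiableAt.mul
    (DifferentiableAt.mul ?_ ?_) ?_) ?_) ?_
  · exact DifferentiableAt.comp (g := Complex.Gamma) s
      (Complex.differentiableAt_Gamma _ fun n h ↦ h0 n (neg_injective h)) (by fun_prop)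
  · exact DifferentiableAt.comp (g := Complex.Gamma) s
      (Complex.differentiableAt_Gamma _ ha) (by fun_prop)
  · exact DifferentiableAt.comp (g := Complex.Gamma) s
      (Complex.differentiableAt_Gamma _ hb) (by fun_prop)
  · exact DifferentiableAt.const_cpow (by fun_prop) (Or.inl hx')
  · exact DifferentiableAt.comp (g := f) s (hf _) (by fun_prop)

/-- The pole comes from Γ(-s) alone; the minus sign is due to s ↦ -s, and (-1)ⁿ combines with xⁿ to
(-x)ⁿ. -/
theorem tendsto_residue_barnesIntegrand_nat (hx : 0 < x) (hf : Differentiable ℂ f) (z : ℂ)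
    (ha : ∀ n : ℕ, a ≠ -n) (hb : ∀ n : ℕ, b ≠ -n) (n : ℕ) :
    Tendsto (fun s ↦ (s - n) * barnesIntegrand a b x f z s) (𝓝[≠] (n : ℂ))
      (𝓝 (-(Complex.Gamma a * Complex.Gamma b * (coeff a b n * (-x : ℂ) ^ n * f (z + n))))) := by
  have hx' : (x : ℂ) ≠ 0 := by exact_mod_cast hx.ne'
  have hneg : Tendsto (fun s : ℂ ↦ -s) (𝓝[≠] (n : ℂ)) (𝓝[≠] (-n : ℂ)) := by
    refine tendsto_nhdsWithin_iff.2
      ⟨(continuous_neg.tendsto _).mono_left nhdsWithin_le_nhds, ?_⟩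
    filter_upwards [self_mem_nhdsWithin] with s hs
    simpa using hs
  have h1 := ((Complex.tendsto_add_nat_mul_Gamma n).comp hneg).neg
  have hc : ContinuousAt (fun s ↦ Complex.Gamma (a + s) * Complex.Gamma (b + s) * (x : ℂ) ^ s *
      f (z + s)) n := by
    refine ((ContinuousAt.mul ?_ ?_).mul ?_).mul ?_
    · exact ContinuousAt.comp (g := Complex.Gamma) (Complex.continuousAt_Gamma _ fun m h ↦
        ha (m + n) (by push_cast; linear_combination h)) (by fun_prop)
    · exact ContinuousAt.comp (g := Complex.Gamma) (Complex.continuousAt_Gamma _ fun m h ↦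
        hb (m + n) (by push_cast; linear_combination h)) (by fun_prop)
    · exact (continuous_id.const_cpow (Or.inl hx')).continuousAt
    · exact ContinuousAt.comp (g := f) hf.continuous.continuousAt (by fun_prop)
  have h2 := h1.mul (hc.tendsto.mono_left (nhdsWithin_le_nhds (s := {(n : ℂ)}ᶜ)))
  have hval : -((-1 : ℂ) ^ n / n !) * (Complex.Gamma (a + n) * Complex.Gamma (b + n) *
      (x : ℂ) ^ (n : ℂ) * f (z + n)) =
      -(Complex.Gamma a * Complex.Gamma b * (coeff a b n * (-x : ℂ) ^ n * f (z + n))) := by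
    rw [Gamma_add_nat_eq ha, Gamma_add_nat_eq hb, coeff, neg_pow (x : ℂ), Complex.cpow_natCast]
    ring
  rw [hval] at h2
  refine h2.congr fun s ↦ ?_
  simp only [Function.comp_apply, barnesIntegrand, barnesKernel]
  ring

/-- At s = -a-k only Γ(a+s) is singular: a is not a pole of Γ and a-b is not an integer, so Γ(-s)
and Γ(b+s) are regular there. -/
theorem tendsto_residue_barnesIntegrand_left (hx : 0 < x) (hf : Differentiable ℂ f) (z : ℂ)
    (ha : ∀ n : ℕ, a ≠ -n) (hab : ∀ n : ℤ, a - b ≠ n) (k : ℕ) :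
    Tendsto (fun s ↦ (s - (-a - k)) * barnesIntegrand a b x f z s) (𝓝[≠] (-a - k : ℂ))
      (𝓝 ((x : ℂ) ^ (-a) * infinityShiftTerm a b (-x) f z k)) := by
  have hx' : (x : ℂ) ≠ 0 := by exact_mod_cast hx.ne'
  have hneg : Tendsto (fun s : ℂ ↦ a + s) (𝓝[≠] (-a - k : ℂ)) (𝓝[≠] (-k : ℂ)) := by
    refine tendsto_nhdsWithin_iff.2 ⟨?_, ?_⟩
    · have : Tendsto (fun s : ℂ ↦ a + s) (𝓝 (-a - k : ℂ)) (𝓝 (a + (-a - k))) :=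
        (continuous_const.add continuous_id).tendsto _
      rw [show a + (-a - k) = -(k : ℂ) by ring] at this
      exact this.mono_left nhdsWithin_le_nhds
    · filter_upwards [self_mem_nhdsWithin] with s hs h
      exact hs (by simp at h ⊢; linear_combination h)
  have h1 := ((Complex.tendsto_add_nat_mul_Gamma k).comp hneg)
  have hc : ContinuousAt (fun s ↦ Complex.Gamma (-s) * Complex.Gamma (b + s) * (x : ℂ) ^ s *
      f (z + s)) (-a - k) := by
    refine ((ContinuousAt.mul ?_ ?_).mul ?_).mul ?_
    · exact ContinuousAt.comp (g := Complex.Gamma) (Complex.continuousAt_Gamma _ fun m h ↦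
        ha (m + k) (by push_cast; linear_combination h)) (by fun_prop)
    · exact ContinuousAt.comp (g := Complex.Gamma) (Complex.continuousAt_Gamma _ fun m h ↦
        hab (m - k) (by push_cast; linear_combination -h)) (by fun_prop)
    · exact (continuous_id.const_cpow (Or.inl hx')).continuousAt
    · exact ContinuousAt.comp (g := f) hf.continuous.continuousAt (by fun_prop)
  have h2 := h1.mul (hc.tendsto.mono_left (nhdsWithin_le_nhds (s := {(-a - k : ℂ)}ᶜ)))
  have hval : ((-1 : ℂ) ^ k / k !) * (Complex.Gamma (-(-a - k)) * Complex.Gamma (b + (-a - k)) *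
      (x : ℂ) ^ (-a - k) * f (z + (-a - k))) =
      (x : ℂ) ^ (-a) * infinityShiftTerm a b (-x) f z k := by
    have e1 : -(-a - (k : ℂ)) = a + k := by ring
    have e2 : b + (-a - (k : ℂ)) = b - a - k := by ring
    have e3 : z + (-a - (k : ℂ)) = z - (a + k) := by ring
    have e4 : ((-x : ℂ) ^ k)⁻¹ = (-1) ^ k * ((x : ℂ) ^ k)⁻¹ := by
      rw [neg_pow, mul_inv, ← inv_pow, inv_neg, inv_one]
    rw [e1, e2, e3, infinityShiftTerm, Complex.cpow_sub _ _ hx', Complex.cpow_natCast,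
      div_eq_mul_inv (_ * _) (_ * _), mul_inv, e4]
    ring
  rw [hval] at h2
  refine h2.congr fun s ↦ ?_
  simp only [Function.comp_apply, barnesIntegrand, barnesKernel]
  ring

theorem norm_ofReal_cpow {x : ℝ} (hx : 0 < x) (s : ℂ) : ‖(x : ℂ) ^ s‖ = x ^ s.re :=
  Complex.norm_cpow_eq_rpow_re_of_pos hx s

/-- For y = -x one has arg(-y) = 0, so crude rates suffice: with θ = π/3 the kernel decays at rate
π, f grows at rate at most 2π/3, and π/3 remains. The same rates are used on all lines below. -/
theorem decaysOnStrip_barnesIntegrand (hx : 0 < x) {C A : ℝ} (hC : 0 ≤ C) (hA : 1 ≤ A)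
    (hg : GrowthBound (2 * Real.pi / 3) C A f) (z : ℂ) (σ₁ σ₂ : ℝ) :
    Complex.DecaysOnStrip (barnesIntegrand a b x f z) σ₁ σ₂ := by
  have hpi := Real.pi_pos
  obtain ⟨K, T, hK, hKT⟩ := exists_norm_barnesKernel_le_strip a b σ₁ σ₂ (θ := Real.pi / 3)
    (by positivity) (by linarith)
  obtain ⟨n, hn⟩ := exists_nat_ge (1 - z.re - σ₁)
  set B : ℝ := K * (x ^ σ₁ + x ^ σ₂) * (C * A ^ n * n ! * Real.exp (2 * Real.pi / 3 * |z.im|)) with hB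
  have hA0 : 0 ≤ A := by linarith
  have hB0 : 0 ≤ B := by positivity
  have hbound : ∀ s : ℂ, σ₁ ≤ s.re → s.re ≤ σ₂ → T ≤ |s.im| →
      ‖barnesIntegrand a b x f z s‖ ≤ B * Real.exp (-(Real.pi / 3) * |s.im|) := by
    intro s h1 h2 h3
    have b1 := hKT s h1 h2 h3
    have b2 : ‖(x : ℂ) ^ s‖ ≤ x ^ σ₁ + x ^ σ₂ := by
      rw [norm_ofReal_cpow hx]
      rcases le_total 1 x with h | h
      · have := Real.rpow_le_rpow_of_exponent_le h h2
        have : 0 ≤ x ^ σ₁ := by positivity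
        linarith
      · have := Real.rpow_le_rpow_of_exponent_ge hx h h1
        have : 0 ≤ x ^ σ₂ := by positivity
        linarith
    have b3 := hg.left (z + s) n (by simp; linarith)
    have b4 : Real.exp (2 * Real.pi / 3 * |(z + s).im|) ≤
        Real.exp (2 * Real.pi / 3 * |z.im|) * Real.exp (2 * Real.pi / 3 * |s.im|) := by
      rw [← Real.exp_add, ← mul_add]
      gcongr
      simpa using abs_add_le z.im s.im
    rw [barnesIntegrand, norm_mul, norm_mul]
    calc _ ≤ (K * Real.exp (-(3 * (Real.pi / 3)) * |s.im|)) * (x ^ σ₁ + x ^ σ₂) *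
          (C * A ^ n * n ! * (Real.exp (2 * Real.pi / 3 * |z.im|) *
            Real.exp (2 * Real.pi / 3 * |s.im|))) := by
            gcongr
            exact b3.trans (by gcongr)
      _ = B * (Real.exp (-(3 * (Real.pi / 3)) * |s.im|) * Real.exp (2 * Real.pi / 3 * |s.im|)) := by
        rw [hB]; ring
      _ = _ := by rw [← Real.exp_add]; ring_nf
  intro ε hε
  have hlim : Tendsto (fun t : ℝ ↦ B * Real.exp (-(Real.pi / 3) * t)) atTop (𝓝 (B * 0)) := by
    refine Tendsto.const_mul _ (Real.tendsto_exp_atBot.comp ?_)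
    exact tendsto_id.const_mul_atTop_of_neg (by linarith)
  rw [mul_zero] at hlim
  obtain ⟨T', hT'⟩ := eventually_atTop.1 (hlim.eventually (ge_mem_nhds hε))
  refine ⟨max T T', fun s h1 h2 h3 ↦ ?_⟩
  exact (hbound s h1 h2 ((le_max_left _ _).trans h3)).trans (hT' _ ((le_max_right _ _).trans h3))

theorem continuous_barnesIntegrand_line (hx : 0 < x) (hf : Continuous f) (z : ℂ) {σ : ℝ}
    (h0 : ∀ n : ℕ, σ ≠ n) (ha : ∀ n : ℕ, a.re + σ ≠ -n) (hb : ∀ n : ℕ, b.re + σ ≠ -n) :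
    Continuous fun t : ℝ ↦ barnesIntegrand a b x f z (σ + t * Complex.I) := by
  have hx' : (x : ℂ) ≠ 0 := by exact_mod_cast hx.ne'
  refine ((continuous_barnesKernel_line h0 ha hb).mul ?_).mul ?_
  · exact Continuous.const_cpow (by fun_prop) (Or.inl hx')
  · exact hf.comp (by fun_prop)

/-- The Mellin–Barnes integrand on vertical lines tending to the right. -/
theorem exists_norm_barnesIntegrand_le_right (a b : ℂ) {C A : ℝ} (hC : 0 ≤ C) (hA : 1 ≤ A)
    (hg : GrowthBound (2 * Real.pi / 3) C A f) (z : ℂ) :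
    ∃ D : ℝ, 0 ≤ D ∧ ∀ (x : ℝ) (n : ℕ) (t : ℝ), 0 < x →
      ‖barnesIntegrand a b x f z ((barnesAbscissa a b + n : ℝ) + t * Complex.I)‖ ≤
        D * x ^ barnesAbscissa a b * (32 * x) ^ n * Real.exp (-(Real.pi / 3) * |t|) := by
  have hpi := Real.pi_pos
  set σ := barnesAbscissa a b with hσ
  have hσ0 : 0 < σ := barnesAbscissa_pos a b
  have hσint : ∀ n : ℤ, -σ ≠ n := by
    intro n h
    rw [hσ, barnesAbscissa] at h
    have h2 : (2 * barnesIndex a b : ℝ) = 1 - 2 * n := by linarith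
    have h3 : (2 * barnesIndex a b : ℤ) = 1 - 2 * n := by exact_mod_cast h2
    omega
  obtain ⟨C₁, hC₁, h₁⟩ := exists_norm_Gamma_le_left (σ := -σ) (by linarith) hσint
  obtain ⟨C₂, hC₂, h₂⟩ := exists_norm_Gamma_le_right (re_add_barnesAbscissa_pos a b).1
  obtain ⟨C₃, hC₃, h₃⟩ := exists_norm_Gamma_le_right (re_add_barnesAbscissa_pos a b).2
  obtain ⟨M, hM⟩ := exists_nat_ge (1 - z.re)
  have hA0 : 0 ≤ A := by linarith
  refine ⟨C₁ * (C₂ * Real.exp (Real.pi / 3 * |a.im|)) * (C₃ * Real.exp (Real.pi / 3 * |b.im|)) *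
    (C * A ^ M * M ! * Real.exp (2 * Real.pi / 3 * |z.im|)), by positivity, fun x n t hx ↦ ?_⟩
  set s : ℂ := (σ + n : ℝ) + t * Complex.I with hs
  have hsre : s.re = σ + n := by simp [hs]
  have hsim : s.im = t := by simp [hs]
  have b₁ := h₁ n (-s) (by rw [Complex.neg_re, hsre]; ring)
  have b₂ := (h₂ n (a + s) (by rw [Complex.add_re, hsre]; ring)).trans
    (mul_le_mul_of_nonneg_left (exp_neg_mul_abs_im_add_le (by positivity) a s) (by positivity))
  have b₃ := (h₃ n (b + s) (by rw [Complex.add_re, hsre]; ring)).trans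
    (mul_le_mul_of_nonneg_left (exp_neg_mul_abs_im_add_le (by positivity) b s) (by positivity))
  have b₄ : ‖f (z + s)‖ ≤ C * A ^ M * M ! * (Real.exp (2 * Real.pi / 3 * |z.im|) *
      Real.exp (2 * Real.pi / 3 * |t|)) * (2 ^ n / n !) := by
    have e : z + s = (z + (σ + t * Complex.I)) + n := by rw [hs]; push_cast; ring
    -- Taking the free parameter equal to 1 gives 2ⁿ/n! and lets A itself play the role of B.
    have h := hg.norm_add_nat_le hC hA one_pos le_rfl (by simpa using hA)
      (z := z + (σ + t * Complex.I)) (n := M) (by simp; linarith) n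
    rw [e]
    refine h.trans ?_
    rw [one_add_one_eq_two, ← Real.exp_add, ← mul_add]
    gcongr
    simpa using abs_add_le z.im t
  rw [Complex.neg_im, abs_neg, hsim] at b₁
  rw [hsim] at b₂ b₃
  have b₅ : ‖(x : ℂ) ^ s‖ = x ^ σ * x ^ n := by
    rw [norm_ofReal_cpow hx, hsre, Real.rpow_add hx, Real.rpow_natCast]
  rw [barnesIntegrand, barnesKernel, norm_mul, norm_mul, norm_mul, norm_mul, b₅]
  -- The factorials cancel: 1/n! from Γ(-s), n! from each other Gamma factor, 1/n! from f. What
  -- remains is (4·4·2·x)ⁿ.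
  calc _ ≤ (C₁ / n ! * Real.exp (-(Real.pi / 3) * |t|)) *
        (C₂ * 4 ^ n * n ! * (Real.exp (Real.pi / 3 * |a.im|) * Real.exp (-(Real.pi / 3) * |t|))) *
        (C₃ * 4 ^ n * n ! * (Real.exp (Real.pi / 3 * |b.im|) * Real.exp (-(Real.pi / 3) * |t|))) *
        (x ^ σ * x ^ n) * (C * A ^ M * M ! * (Real.exp (2 * Real.pi / 3 * |z.im|) *
          Real.exp (2 * Real.pi / 3 * |t|)) * (2 ^ n / n !)) := by gcongr
    _ = C₁ * (C₂ * Real.exp (Real.pi / 3 * |a.im|)) * (C₃ * Real.exp (Real.pi / 3 * |b.im|)) *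
        (C * A ^ M * M ! * Real.exp (2 * Real.pi / 3 * |z.im|)) * x ^ σ *
        (4 ^ n * 4 ^ n * 2 ^ n * x ^ n) *
        (Real.exp (-(Real.pi / 3) * |t|) * Real.exp (-(Real.pi / 3) * |t|) *
          Real.exp (-(Real.pi / 3) * |t|) * Real.exp (2 * Real.pi / 3 * |t|)) := by
      field_simp
    _ = _ := by
      rw [← mul_pow, ← mul_pow, ← mul_pow, ← Real.exp_add, ← Real.exp_add, ← Real.exp_add]
      ring_nf

/-- The Mellin–Barnes integrand on vertical lines tending to the left. -/
theorem exists_norm_barnesIntegrand_le_left {C A : ℝ} (hC : 0 ≤ C) (hA : 1 ≤ A)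
    (hg : GrowthBound (2 * Real.pi / 3) C A f) (z : ℂ) {δ : ℝ} (hδ0 : 0 < δ) (hδa : a.re ≤ δ)
    (hδb : b.re ≤ δ) (ha : ∀ n : ℤ, a.re - δ ≠ n) (hb : ∀ n : ℤ, b.re - δ ≠ n) :
    ∃ D Q : ℝ, 0 ≤ D ∧ 0 < Q ∧ ∀ (x : ℝ) (n : ℕ) (t : ℝ), 0 < x →
      ‖barnesIntegrand a b x f z ((-δ - n : ℝ) + t * Complex.I)‖ ≤
        D * x ^ (-δ) * (Q / x) ^ n * Real.exp (-(Real.pi / 3) * |t|) := by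
  have hpi := Real.pi_pos
  obtain ⟨C₁, hC₁, h₁⟩ := exists_norm_Gamma_le_right hδ0
  obtain ⟨C₂, hC₂, h₂⟩ := exists_norm_Gamma_le_left (σ := a.re - δ) (by linarith) ha
  obtain ⟨C₃, hC₃, h₃⟩ := exists_norm_Gamma_le_left (σ := b.re - δ) (by linarith) hb
  obtain ⟨M, hM⟩ := exists_nat_ge (1 - z.re + δ)
  obtain ⟨C₄, hC₄, h₄⟩ := exists_factorial_add_le M
  have hA0 : 0 < A := by linarith
  refine ⟨C₁ * (C₂ * Real.exp (Real.pi / 3 * |a.im|)) * (C₃ * Real.exp (Real.pi / 3 * |b.im|)) *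
    (C * A ^ M * C₄ * Real.exp (2 * Real.pi / 3 * |z.im|)), 8 * A, by positivity, by positivity,
    fun x n t hx ↦ ?_⟩
  set s : ℂ := (-δ - n : ℝ) + t * Complex.I with hs
  have hsre : s.re = -δ - n := by simp [hs]
  have hsim : s.im = t := by simp [hs]
  have b₁ := h₁ n (-s) (by rw [Complex.neg_re, hsre]; ring)
  have b₂ := (h₂ n (a + s) (by rw [Complex.add_re, hsre]; ring)).trans
    (mul_le_mul_of_nonneg_left (exp_neg_mul_abs_im_add_le (by positivity) a s) (by positivity))
  have b₃ := (h₃ n (b + s) (by rw [Complex.add_re, hsre]; ring)).trans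
    (mul_le_mul_of_nonneg_left (exp_neg_mul_abs_im_add_le (by positivity) b s) (by positivity))
  have b₄ : ‖f (z + s)‖ ≤ C * A ^ (n + M) * (C₄ * 2 ^ n * n !) *
      (Real.exp (2 * Real.pi / 3 * |z.im|) * Real.exp (2 * Real.pi / 3 * |t|)) := by
    have h := hg.left (z + s) (n + M) (by rw [Complex.add_re, hsre]; push_cast; linarith)
    refine h.trans ?_
    rw [← Real.exp_add, ← mul_add]
    gcongr
    · exact h₄ n
    · rw [Complex.add_im, hsim]; exact abs_add_le z.im t
  rw [Complex.neg_im, abs_neg, hsim] at b₁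
  rw [hsim] at b₂ b₃
  have b₅ : ‖(x : ℂ) ^ s‖ = x ^ (-δ) / x ^ n := by
    rw [norm_ofReal_cpow hx, hsre, Real.rpow_sub hx, Real.rpow_natCast]
  rw [barnesIntegrand, barnesKernel, norm_mul, norm_mul, norm_mul, norm_mul, b₅]
  -- To the left the roles are reversed: n! from Γ(-s) and from f, 1/n! from the other two. What
  -- remains is (4·2·A/x)ⁿ.
  calc _ ≤ (C₁ * 4 ^ n * n ! * Real.exp (-(Real.pi / 3) * |t|)) *
        (C₂ / n ! * (Real.exp (Real.pi / 3 * |a.im|) * Real.exp (-(Real.pi / 3) * |t|))) *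
        (C₃ / n ! * (Real.exp (Real.pi / 3 * |b.im|) * Real.exp (-(Real.pi / 3) * |t|))) *
        (x ^ (-δ) / x ^ n) * (C * A ^ (n + M) * (C₄ * 2 ^ n * n !) *
          (Real.exp (2 * Real.pi / 3 * |z.im|) * Real.exp (2 * Real.pi / 3 * |t|))) := by gcongr
    _ = C₁ * (C₂ * Real.exp (Real.pi / 3 * |a.im|)) * (C₃ * Real.exp (Real.pi / 3 * |b.im|)) *
        (C * A ^ M * C₄ * Real.exp (2 * Real.pi / 3 * |z.im|)) * x ^ (-δ) *
        (4 ^ n * 2 ^ n * A ^ n / x ^ n) *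
        (Real.exp (-(Real.pi / 3) * |t|) * Real.exp (-(Real.pi / 3) * |t|) *
          Real.exp (-(Real.pi / 3) * |t|) * Real.exp (2 * Real.pi / 3 * |t|)) := by
      rw [pow_add]; field_simp
    _ = _ := by
      rw [← mul_pow, ← mul_pow, ← div_pow, ← Real.exp_add, ← Real.exp_add, ← Real.exp_add]
      ring_nf

theorem tendsto_integral_zero_of_geometric {g : ℕ → ℝ → ℂ} {D q : ℝ} (hq0 : 0 ≤ q) (hq : q < 1)
    (h : ∀ n t, ‖g n t‖ ≤ D * q ^ n * Real.exp (-(Real.pi / 3) * |t|)) :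
    Tendsto (fun n ↦ ∫ t : ℝ, g n t) atTop (𝓝 0) := by
  have hintg := integrable_exp_neg_mul_abs (c := Real.pi / 3) (by positivity)
  refine squeeze_zero_norm (a := fun n ↦ D * q ^ n * ∫ t : ℝ, Real.exp (-(Real.pi / 3) * |t|))
    (fun n ↦ ?_) ?_
  · rw [← integral_const_mul]
    exact norm_integral_le_of_norm_le (hintg.const_mul _) (ae_of_all _ (h n))
  · have := ((tendsto_pow_atTop_nhds_zero_of_lt_one hq0 hq).const_mul D).mul_const
      (∫ t : ℝ, Real.exp (-(Real.pi / 3) * |t|))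
    simpa using this

theorem integrable_of_norm_le_exp {g : ℝ → ℂ} (hg : Continuous g) {D : ℝ}
    (h : ∀ t, ‖g t‖ ≤ D * Real.exp (-(Real.pi / 3) * |t|)) : Integrable g :=
  ((integrable_exp_neg_mul_abs (c := Real.pi / 3) (by positivity)).const_mul D).mono'
    hg.aestronglyMeasurable (ae_of_all _ h)

/-! ### One variable: closing the contour on either side -/

theorem barnesShift_neg_ofReal (a b : ℂ) (x : ℝ) (f : ℂ → ℂ) (z : ℂ) :
    barnesShift a b (-x) f z =
      ∑ k ∈ Finset.range (barnesIndex a b), coeff a b k * (-x : ℂ) ^ k * f (z + k) +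
      (2 * Real.pi * (Complex.Gamma a * Complex.Gamma b))⁻¹ *
        ∫ t : ℝ, barnesIntegrand a b x f z (barnesAbscissa a b + t * Complex.I) := by
  rw [barnesShift, neg_neg]; rfl

theorem integrable_barnesIntegrand_abscissa (hx : 0 < x) (hf : Differentiable ℂ f) {C A : ℝ}
    (hC : 0 ≤ C) (hA : 1 ≤ A) (hg : GrowthBound (2 * Real.pi / 3) C A f) (z : ℂ) (n : ℕ) :
    Integrable fun t : ℝ ↦ barnesIntegrand a b x f z ((barnesAbscissa a b + n : ℝ) + t * Complex.I) := by
  obtain ⟨D, hD, hbd⟩ := exists_norm_barnesIntegrand_le_right a b hC hA hg z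
  have hpos := re_add_barnesAbscissa_pos a b
  have hn : (0 : ℝ) ≤ n := n.cast_nonneg
  refine integrable_of_norm_le_exp (continuous_barnesIntegrand_line hx hf.continuous z ?_ ?_ ?_)
    (fun t ↦ hbd x n t hx)
  · intro m h
    rw [barnesAbscissa] at h
    have h2 : (2 * barnesIndex a b + 2 * n : ℝ) = 2 * m + 1 := by linarith
    have h3 : 2 * barnesIndex a b + 2 * n = 2 * m + 1 := by exact_mod_cast h2
    omega
  · intro m h
    have : (0 : ℝ) ≤ m := m.cast_nonneg
    linarith [hpos.1]
  · intro m h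
    have : (0 : ℝ) ≤ m := m.cast_nonneg
    linarith [hpos.2]

/-- Moving the line n steps to the right crosses s = N, …, N+n-1, whose residues are the terms of
the series missing from the finite sum; the remaining integral is O((32x)ⁿ). -/
theorem barnesShift_neg_eq_seriesShift (hx : 0 < x) (hx32 : 32 * x < 1) (ha : ∀ n : ℕ, a ≠ -n)
    (hb : ∀ n : ℕ, b ≠ -n) (hf : Differentiable ℂ f) {C A : ℝ} (hC : 0 ≤ C) (hA : 1 ≤ A)
    (hg : GrowthBound (2 * Real.pi / 3) C A f) (z : ℂ) :
    barnesShift a b (-x) f z = seriesShift a b (-x) f z := by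
  have hpos := re_add_barnesAbscissa_pos a b
  set N := barnesIndex a b with hN
  set σ := barnesAbscissa a b with hσ
  have hσN : σ = N - 1 / 2 := rfl
  have hGG : Complex.Gamma a * Complex.Gamma b ≠ 0 :=
    mul_ne_zero (Complex.Gamma_ne_zero ha) (Complex.Gamma_ne_zero hb)
  have hpi : (Real.pi : ℂ) ≠ 0 := by exact_mod_cast Real.pi_ne_zero
  have hsum : Summable fun k : ℕ ↦ coeff a b k * (-x : ℂ) ^ k * f (z + k) :=
    hg.summable_seriesShift hC hA a b (by simp [abs_of_pos hx]; linarith) z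
  have hshift : ∀ n : ℕ,
      (∫ t : ℝ, barnesIntegrand a b x f z ((σ + n : ℝ) + t * Complex.I)) -
      ∫ t : ℝ, barnesIntegrand a b x f z (σ + t * Complex.I) =
      2 * Real.pi * ∑ k ∈ Finset.range n, -(Complex.Gamma a * Complex.Gamma b *
        (coeff a b (k + N) * (-x : ℂ) ^ (k + N) * f (z + (k + N : ℕ)))) := by
    intro n
    refine Complex.integral_vertical_sub_eq_sum_residues_of_injOn
      (by linarith [n.cast_nonneg (α := ℝ)]) (Finset.range n) (fun k ↦ ((k + N : ℕ) : ℂ)) _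
      ?_ ?_ ?_ (fun k _ ↦ tendsto_residue_barnesIntegrand_nat hx hf z ha hb (k + N))
      (decaysOnStrip_barnesIntegrand hx hC hA hg z _ _) ?_
      (integrable_barnesIntegrand_abscissa hx hf hC hA hg z n)
    · intro i _ j _ h
      have h' : ((i + N : ℕ) : ℂ) = ((j + N : ℕ) : ℂ) := h
      have : i + N = j + N := by exact_mod_cast h'
      omega
    · intro k hk
      have hk' : (k : ℝ) + 1 ≤ n := by exact_mod_cast Finset.mem_range.1 hk
      have : (0 : ℝ) ≤ k := k.cast_nonneg
      rw [Complex.natCast_re, hσN]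
      push_cast
      constructor <;> linarith
    · intro s hs1 hs2 hs3
      refine differentiableAt_barnesIntegrand hx hf z ?_ ?_ ?_
      · rintro m rfl
        rw [Complex.natCast_re, hσN] at hs1 hs2
        have h1 : N ≤ m := by
          by_contra h
          have : (m : ℝ) + 1 ≤ N := by exact_mod_cast not_le.1 h
          linarith
        have h2 : m < n + N := by
          by_contra h
          have : (n : ℝ) + N ≤ m := by exact_mod_cast not_lt.1 h
          linarith
        exact hs3 (m - N) (Finset.mem_range.2 (by omega)) (by congr 1; omega)
      · intro m h
        have := congrArg Complex.re h
        simp at this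
        have : (0 : ℝ) ≤ m := m.cast_nonneg
        linarith [hpos.1]
      · intro m h
        have := congrArg Complex.re h
        simp at this
        have : (0 : ℝ) ≤ m := m.cast_nonneg
        linarith [hpos.2]
    · simpa using integrable_barnesIntegrand_abscissa (a := a) (b := b) hx hf hC hA hg z 0
  obtain ⟨D, hD, hbd⟩ := exists_norm_barnesIntegrand_le_right a b hC hA hg z
  have hlim := tendsto_integral_zero_of_geometric (by positivity) hx32 (fun n t ↦ hbd x n t hx)
  have hlim2 : Tendsto (fun n : ℕ ↦ ∑ k ∈ Finset.range n,
      coeff a b (k + N) * (-x : ℂ) ^ (k + N) * f (z + (k + N : ℕ))) atTop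
      (𝓝 ((2 * Real.pi * (Complex.Gamma a * Complex.Gamma b))⁻¹ *
        ∫ t : ℝ, barnesIntegrand a b x f z (σ + t * Complex.I))) := by
    have h := ((tendsto_const_nhds (x := ∫ t : ℝ, barnesIntegrand a b x f z
      (σ + t * Complex.I))).sub hlim).const_mul
      ((2 * Real.pi * (Complex.Gamma a * Complex.Gamma b))⁻¹)
    rw [sub_zero] at h
    refine h.congr fun n ↦ ?_
    have hs := hshift n
    rw [Finset.sum_neg_distrib, ← Finset.mul_sum] at hs
    rw [inv_mul_eq_iff_eq_mul₀ (mul_ne_zero (mul_ne_zero two_ne_zero hpi) hGG)]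
    linear_combination -hs
  have htail := tendsto_nhds_unique hlim2
    ((summable_nat_add_iff N).2 hsum).hasSum.tendsto_sum_nat
  rw [barnesShift_neg_ofReal, htail, seriesShift]
  exact hsum.sum_add_tsum_nat_add N

/-- The quotient of consecutive products is (a+k)/(b-a-k-1), of modulus tending to 1, so any
geometric rate above 1 would do. -/
theorem exists_norm_Gamma_mul_Gamma_le (ha : ∀ n : ℕ, a ≠ -n) (hab : ∀ n : ℤ, a - b ≠ n) :
    ∃ C : ℝ, 0 ≤ C ∧ ∀ k : ℕ,
      ‖Complex.Gamma (b - a - k) * Complex.Gamma (a + k)‖ ≤ C * 2 ^ k := by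
  refine exists_le_mul_pow_of_ratio (ρ := fun k : ℕ ↦ ‖a + k‖ / ‖(1 + a - b) + k‖)
    (fun k ↦ norm_nonneg _) (fun k ↦ le_of_eq ?_) (tendsto_complex_add_div_add_atTop _ _) one_lt_two
  have h1 : a + k ≠ 0 := fun h ↦ ha k (by linear_combination h)
  have h2 : b - a - (k + 1 : ℕ) ≠ 0 := fun h ↦ hab (-(k + 1)) (by push_cast at h ⊢; linear_combination -h)
  have e1 : Complex.Gamma (a + (k + 1 : ℕ)) = (a + k) * Complex.Gamma (a + k) := by
    push_cast; rw [← add_assoc, Complex.Gamma_add_one _ h1]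
  have e2 : Complex.Gamma (b - a - k) =
      (b - a - (k + 1 : ℕ)) * Complex.Gamma (b - a - (k + 1 : ℕ)) := by
    rw [← Complex.Gamma_add_one _ h2]; push_cast; ring_nf
  have e3 : ‖(1 + a - b) + k‖ = ‖b - a - (k + 1 : ℕ)‖ := by
    rw [← norm_neg]; push_cast; ring_nf
  have h3 : ‖b - a - (k + 1 : ℕ)‖ ≠ 0 := norm_ne_zero_iff.2 h2
  rw [e1, e2, e3, norm_mul, norm_mul, norm_mul, norm_mul]
  field_simp

/-- The Gamma product contributes 2ᵏ and f contributes Aᵏ 2ᵏ k!; the denominator cancels k!, leaving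
a geometric series of ratio 4A/x. -/
theorem exists_summable_infinityShiftTerm (ha : ∀ n : ℕ, a ≠ -n) (hab : ∀ n : ℤ, a - b ≠ n)
    {C A : ℝ} (hC : 0 ≤ C) (hA : 1 ≤ A)
    (hg : GrowthBound (2 * Real.pi / 3) C A f) (z : ℂ) {x : ℝ} (hx : 4 * A < x) :
    Summable (infinityShiftTerm a b (-x) f z) := by
  obtain ⟨C₁, hC₁, h₁⟩ := exists_norm_Gamma_mul_Gamma_le ha hab
  obtain ⟨M, hM⟩ := exists_nat_ge (1 - (z - a).re)
  obtain ⟨C₂, hC₂, h₂⟩ := exists_factorial_add_le M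
  have hA0 : 0 < A := by linarith
  have hx0 : 0 < x := by linarith
  refine Summable.of_norm_bounded (((summable_geometric_of_lt_one (r := 4 * A / x) (by positivity)
    ((div_lt_one hx0).2 hx))).mul_left
    (C₁ * (C * A ^ M * C₂ * Real.exp (2 * Real.pi / 3 * |(z - a).im|)))) fun k ↦ ?_
  have h3 := hg.left (z - (a + k)) (k + M) (by
    push_cast; simp only [Complex.sub_re, Complex.add_re, Complex.natCast_re] at hM ⊢; linarith)
  have him : (z - (a + k)).im = (z - a).im := by simp
  rw [him] at h3
  have hxn : ‖(-x : ℂ)‖ = x := by simp [abs_of_pos hx0]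
  rw [infinityShiftTerm, norm_mul, norm_div, norm_mul (k ! : ℂ), Complex.norm_natCast, norm_pow, hxn]
  calc _ ≤ C₁ * 2 ^ k / (k ! * x ^ k) *
        (C * A ^ (k + M) * (C₂ * 2 ^ k * k !) * Real.exp (2 * Real.pi / 3 * |(z - a).im|)) := by
        gcongr
        · exact h₁ k
        · refine h3.trans ?_
          gcongr
          exact h₂ k
    _ = C₁ * (C * A ^ M * C₂ * Real.exp (2 * Real.pi / 3 * |(z - a).im|)) *
        (2 ^ k * 2 ^ k * A ^ k / x ^ k) := by rw [pow_add]; field_simp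
    _ = _ := by rw [← mul_pow, ← mul_pow, ← div_pow]; norm_num

/-- A vertical line to the left of a given bound that avoids the poles of both Gamma factors. -/
theorem exists_line_avoiding_poles (u v M : ℝ) :
    ∃ δ, M < δ ∧ (∀ n : ℤ, u - δ ≠ n) ∧ ∀ n : ℤ, v - δ ≠ n := by
  have hc : (Set.range (fun n : ℤ ↦ u - n) ∪ Set.range (fun n : ℤ ↦ v - n)).Countable :=
    (Set.countable_range _).union (Set.countable_range _)
  obtain ⟨δ, hδ, hM⟩ := (hc.dense_compl ℝ).exists_gt M
  simp only [Set.mem_compl_iff, Set.mem_union, Set.mem_range, not_or, not_exists] at hδ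
  exact ⟨δ, hM, fun n h ↦ hδ.1 n (by linarith), fun n h ↦ hδ.2 n (by linarith)⟩

/-- With u = δ - Re a this counts the poles -a-k to the right of Re s = -δ-K: they form an initial
segment of ℕ, and since u is not an integer none lies on the line. -/
theorem lt_add_ceil_iff {K k : ℕ} {u : ℝ} (hu : 0 < u) (hintg : ∀ n : ℤ, u ≠ n) :
    k < K + ⌈u⌉₊ ↔ (k : ℝ) ≤ K + u := by
  constructor
  · intro h
    rcases le_or_gt K k with hK | hK
    · have : ((k - K : ℕ) : ℝ) < u := Nat.lt_ceil.1 (by omega)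
      rw [Nat.cast_sub hK] at this
      linarith
    · have : (k : ℝ) < K := by exact_mod_cast hK
      linarith
  · intro h
    by_contra h'
    have h1 : ((K + ⌈u⌉₊ : ℕ) : ℝ) ≤ k := by exact_mod_cast not_lt.1 h'
    push_cast at h1
    have h2 := Nat.le_ceil u
    refine hintg (k - K) ?_
    push_cast
    linarith

/-- The expansion of `barnesShift` at infinity. -/
theorem exists_barnesShift_neg_eq_infinity (ha : ∀ n : ℕ, a ≠ -n) (hb : ∀ n : ℕ, b ≠ -n)
    (hab : ∀ n : ℤ, a - b ≠ n) (hf : Differentiable ℂ f) {C A : ℝ} (hC : 0 ≤ C) (hA : 1 ≤ A)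
    (hg : GrowthBound (2 * Real.pi / 3) C A f) (z : ℂ) :
    ∃ X : ℝ, 0 < X ∧ ∀ x : ℝ, X < x → Summable (infinityShiftTerm a b (-x) f z) ∧
      Summable (infinityShiftTerm b a (-x) f z) ∧
      barnesShift a b (-x) f z = (Complex.Gamma a * Complex.Gamma b)⁻¹ *
        ((x : ℂ) ^ (-a) * ∑' k, infinityShiftTerm a b (-x) f z k +
          (x : ℂ) ^ (-b) * ∑' k, infinityShiftTerm b a (-x) f z k) := by
  have hba : ∀ n : ℤ, b - a ≠ n := fun n h ↦ hab (-n) (by push_cast; linear_combination -h)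
  have hpos := re_add_barnesAbscissa_pos a b
  obtain ⟨δ, hδ, hδa, hδb⟩ := exists_line_avoiding_poles a.re b.re (max 0 (max a.re b.re))
  obtain ⟨hδ0, hδ'⟩ := max_lt_iff.1 hδ
  obtain ⟨hδ1, hδ2⟩ := max_lt_iff.1 hδ'
  have hδa' : ∀ n : ℤ, δ - a.re ≠ n := fun n h ↦ hδa (-n) (by push_cast; linarith)
  have hδb' : ∀ n : ℤ, δ - b.re ≠ n := fun n h ↦ hδb (-n) (by push_cast; linarith)
  obtain ⟨D, Q, hD, hQ, hbd⟩ := exists_norm_barnesIntegrand_le_left (a := a) (b := b) hC hA hg z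
    hδ0 hδ1.le hδ2.le hδa hδb
  set N := barnesIndex a b with hN
  set σ := barnesAbscissa a b with hσ
  have hσ0 : 0 < σ := barnesAbscissa_pos a b
  have hσN : σ = N - 1 / 2 := rfl
  have hGG : Complex.Gamma a * Complex.Gamma b ≠ 0 :=
    mul_ne_zero (Complex.Gamma_ne_zero ha) (Complex.Gamma_ne_zero hb)
  have hpi : (Real.pi : ℂ) ≠ 0 := by exact_mod_cast Real.pi_ne_zero
  refine ⟨max (4 * A) Q, by positivity, fun x hx ↦ ?_⟩
  obtain ⟨hx4, hxQ⟩ := max_lt_iff.1 hx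
  have hx0 : 0 < x := hQ.trans hxQ
  have hsa := exists_summable_infinityShiftTerm ha hab hC hA hg z hx4
  have hsb := exists_summable_infinityShiftTerm hb hba hC hA hg z hx4
  refine ⟨hsa, hsb, ?_⟩
  -- The three families of poles are handled as one disjoint sum. Injectivity of `pole`, which is
  -- where all the arithmetic hypotheses on a and b enter, says that the poles are distinct and
  -- hence simple.
  set pole : ℕ ⊕ ℕ ⊕ ℕ → ℂ :=
    Sum.elim (fun k ↦ (k : ℂ)) (Sum.elim (fun k ↦ -a - k) (fun k ↦ -b - k)) with hpole
  set res : ℕ ⊕ ℕ ⊕ ℕ → ℂ :=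
    Sum.elim (fun k ↦ -(Complex.Gamma a * Complex.Gamma b * (coeff a b k * (-x : ℂ) ^ k * f (z + k))))
      (Sum.elim (fun k ↦ (x : ℂ) ^ (-a) * infinityShiftTerm a b (-x) f z k)
        (fun k ↦ (x : ℂ) ^ (-b) * infinityShiftTerm b a (-x) f z k)) with hres
  have hpinj : Function.Injective pole := by
    have ab : ∀ j k : ℕ, -a - (j : ℂ) ≠ -b - k := fun j k h ↦
      hab (k - j) (by push_cast; linear_combination -h)
    have na : ∀ j k : ℕ, (j : ℂ) ≠ -a - k := fun j k h ↦
      ha (j + k) (by push_cast; linear_combination h)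
    have nb : ∀ j k : ℕ, (j : ℂ) ≠ -b - k := fun j k h ↦
      hb (j + k) (by push_cast; linear_combination h)
    rintro (j | j | j) (k | k | k) h <;> simp only [hpole, Sum.elim_inl, Sum.elim_inr] at h
    · rw [Nat.cast_injective h]
    · exact absurd h (na j k)
    · exact absurd h (nb j k)
    · exact absurd h.symm (na k j)
    · rw [Nat.cast_injective (sub_right_injective h)]
    · exact absurd h (ab j k)
    · exact absurd h.symm (nb k j)
    · exact absurd h.symm (ab k j)
    · rw [Nat.cast_injective (sub_right_injective h)]
  have hshift : ∀ K : ℕ, (∫ t : ℝ, barnesIntegrand a b x f z (σ + t * Complex.I)) -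
      ∫ t : ℝ, barnesIntegrand a b x f z ((-δ - K : ℝ) + t * Complex.I) =
      2 * Real.pi * ∑ i ∈ (Finset.range N).disjSum ((Finset.range (K + ⌈δ - a.re⌉₊)).disjSum
        (Finset.range (K + ⌈δ - b.re⌉₊))), res i := by
    intro K
    have hK : (0 : ℝ) ≤ K := K.cast_nonneg
    refine Complex.integral_vertical_sub_eq_sum_residues_of_injOn
      (by linarith) _ pole res hpinj.injOn ?_ ?_ ?_
      (decaysOnStrip_barnesIntegrand hx0 hC hA hg z _ _) ?_ ?_
    · rintro (k | k | k) hk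
      · have hk' : (k : ℝ) + 1 ≤ N := by
          have := Finset.mem_range.1 (Finset.inl_mem_disjSum.1 hk)
          exact_mod_cast this
        have : (0 : ℝ) ≤ k := k.cast_nonneg
        simp only [hpole, Sum.elim_inl, Complex.natCast_re]
        constructor <;> linarith
      · have hk' := Finset.mem_range.1 (Finset.inl_mem_disjSum.1 (Finset.inr_mem_disjSum.1 hk))
        have h1 := (lt_add_ceil_iff (by linarith) hδa').1 hk'
        have : (0 : ℝ) ≤ k := k.cast_nonneg
        simp only [hpole, Sum.elim_inl, Sum.elim_inr, Complex.sub_re, Complex.neg_re,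
          Complex.natCast_re]
        refine ⟨lt_of_le_of_ne (by linarith) fun h ↦ hδa' (k - K) (by push_cast; linarith), ?_⟩
        linarith [hpos.1]
      · have hk' := Finset.mem_range.1 (Finset.inr_mem_disjSum.1 (Finset.inr_mem_disjSum.1 hk))
        have h1 := (lt_add_ceil_iff (by linarith) hδb').1 hk'
        have : (0 : ℝ) ≤ k := k.cast_nonneg
        simp only [hpole, Sum.elim_inr, Complex.sub_re, Complex.neg_re, Complex.natCast_re]
        refine ⟨lt_of_le_of_ne (by linarith) fun h ↦ hδb' (k - K) (by push_cast; linarith), ?_⟩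
        linarith [hpos.2]
    · intro s hs1 hs2 hs3
      refine differentiableAt_barnesIntegrand hx0 hf z ?_ ?_ ?_
      · rintro m rfl
        refine hs3 (Sum.inl m) (Finset.inl_mem_disjSum.2 (Finset.mem_range.2 ?_)) rfl
        by_contra h
        have : (N : ℝ) ≤ m := by exact_mod_cast not_lt.1 h
        rw [Complex.natCast_re] at hs2
        linarith
      · intro m h
        have hs : s = -a - m := by linear_combination h
        refine hs3 (Sum.inr (Sum.inl m)) (Finset.inr_mem_disjSum.2 (Finset.inl_mem_disjSum.2
          (Finset.mem_range.2 ((lt_add_ceil_iff (by linarith) hδa').2 ?_)))) hs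
        rw [hs] at hs1
        simp at hs1
        linarith
      · intro m h
        have hs : s = -b - m := by linear_combination h
        refine hs3 (Sum.inr (Sum.inr m)) (Finset.inr_mem_disjSum.2 (Finset.inr_mem_disjSum.2
          (Finset.mem_range.2 ((lt_add_ceil_iff (by linarith) hδb').2 ?_)))) hs
        rw [hs] at hs1
        simp at hs1
        linarith
    · rintro (k | k | k) _
      · exact tendsto_residue_barnesIntegrand_nat hx0 hf z ha hb k
      · exact tendsto_residue_barnesIntegrand_left hx0 hf z ha hab k
      · have h := tendsto_residue_barnesIntegrand_left hx0 hf z hb hba k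
        simp_rw [barnesIntegrand_comm b a] at h
        exact h
    · refine integrable_of_norm_le_exp (continuous_barnesIntegrand_line hx0 hf.continuous z ?_ ?_ ?_)
        (fun t ↦ hbd x K t hx0)
      · intro m h
        have : (0 : ℝ) ≤ m := m.cast_nonneg
        linarith
      · intro m h
        exact hδa (K - m) (by push_cast; linarith)
      · intro m h
        exact hδb (K - m) (by push_cast; linarith)
    · simpa using integrable_barnesIntegrand_abscissa (a := a) (b := b) hx0 hf hC hA hg z 0
  have hlim := tendsto_integral_zero_of_geometric (by positivity) ((div_lt_one hx0).2 hxQ)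
    (fun n t ↦ hbd x n t hx0)
  have hpart : ∀ (u : ℕ → ℂ) (c : ℂ) (p : ℕ), Summable u →
      Tendsto (fun K : ℕ ↦ ∑ k ∈ Finset.range (K + p), c * u k) atTop (𝓝 (c * ∑' k, u k)) := by
    intro u c p hu
    exact (hu.hasSum.mul_left c).tendsto_sum_nat.comp (tendsto_add_atTop_nat p)
  have hright := ((hlim.const_mul ((2 * Real.pi * (Complex.Gamma a * Complex.Gamma b))⁻¹)).add
    (((hpart _ ((x : ℂ) ^ (-a)) ⌈δ - a.re⌉₊ hsa).add
      (hpart _ ((x : ℂ) ^ (-b)) ⌈δ - b.re⌉₊ hsb)).const_mul (Complex.Gamma a * Complex.Gamma b)⁻¹))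
  rw [mul_zero, zero_add] at hright
  -- The value of `barnesShift` does not depend on K. By `hshift` it is the term of index K of the
  -- right-hand sequence, since the residues at 0, …, N-1 cancel the finite sum in `barnesShift`.
  refine tendsto_nhds_unique (tendsto_const_nhds.congr fun K ↦ ?_) hright
  have hs := hshift K
  rw [Finset.sum_disjSum, Finset.sum_disjSum] at hs
  simp only [hres, Sum.elim_inl, Sum.elim_inr, Finset.sum_neg_distrib] at hs
  rw [← Finset.mul_sum (Finset.range N)] at hs
  rw [barnesShift_neg_ofReal, mul_inv, mul_inv]
  have hpi2 : (2 : ℂ)⁻¹ * (Real.pi : ℂ)⁻¹ * (2 * Real.pi) = 1 := by field_simp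
  have hGG2 : (Complex.Gamma a * Complex.Gamma b)⁻¹ * (Complex.Gamma a * Complex.Gamma b) = 1 :=
    inv_mul_cancel₀ hGG
  set G := Complex.Gamma a * Complex.Gamma b
  set S0 := ∑ k ∈ Finset.range N, coeff a b k * (-x : ℂ) ^ k * f (z + k)
  linear_combination ((2 : ℂ)⁻¹ * (Real.pi : ℂ)⁻¹ * G⁻¹) * hs +
    (-G⁻¹ * G * S0 + G⁻¹ * (∑ k ∈ Finset.range (K + ⌈δ - a.re⌉₊), (x : ℂ) ^ (-a) * infinityShiftTerm a b (-x) f z k) +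
     G⁻¹ * (∑ k ∈ Finset.range (K + ⌈δ - b.re⌉₊), (x : ℂ) ^ (-b) * infinityShiftTerm b a (-x) f z k)) * hpi2 - S0 * hGG2

end OneVariable

/-! ### Gluing the series and the integral -/

/-- Entire functions with the growth of `1/Γ`, with vertical exponential rate at most `π / 2`. -/
structure Admissible (f : ℂ → ℂ) : Prop where
  differentiable : Differentiable ℂ f
  growth : ∀ κ, Real.pi / 2 < κ → ∃ C A : ℝ, 0 ≤ C ∧ 1 ≤ A ∧ GrowthBound κ C A f

theorem GrowthBound.mono {κ κ' C A : ℝ} {f : ℂ → ℂ} (hf : GrowthBound κ C A f) (hC : 0 ≤ C)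
    (hA : 0 ≤ A) (h : κ ≤ κ') : GrowthBound κ' C A f :=
  ⟨fun z n hz ↦ (hf.right z n hz).trans (by gcongr), fun z n hz ↦ (hf.left z n hz).trans (by gcongr)⟩

theorem Admissible.differentiableAt_barnesShift {f : ℂ → ℂ} (hf : Admissible f) (a b z : ℂ) {y : ℂ}
    (hy : -y ∈ Complex.slitPlane) : DifferentiableAt ℂ (fun y ↦ barnesShift a b y f z) y := by
  have h := LauricellaB.differentiableAt_barnesShift (E := ℂ) a b hy (f := fun _ ↦ f) (w₀ := 0)
    (Eventually.of_forall fun w z ↦ DifferentiableAt.comp (g := f) (w, z) (hf.differentiable z)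
      differentiableAt_snd)
    (fun κ hκ ↦ by
      obtain ⟨C, A, h1, h2, h3⟩ := hf.growth κ hκ
      exact ⟨C, A, h1, h2, Eventually.of_forall fun _ ↦ h3⟩) z
  exact DifferentiableAt.comp (f := fun y : ℂ ↦ (y, (0 : ℂ), z))
    (g := fun p : ℂ × ℂ × ℂ ↦ barnesShift a b p.1 f p.2.2) y h (by fun_prop)

theorem Admissible.differentiableAt_seriesShift {f : ℂ → ℂ} (hf : Admissible f) (a b z : ℂ) {y : ℂ}
    (hy : ‖y‖ < 1) : DifferentiableAt ℂ (fun y ↦ seriesShift a b y f z) y := by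
  obtain ⟨C, A, h1, h2, h3⟩ := hf.growth Real.pi (by linarith [Real.pi_pos])
  have h := LauricellaB.differentiableAt_seriesShift (E := ℂ) a b hy (f := fun _ ↦ f) (w₀ := 0)
    (Eventually.of_forall fun w z ↦ DifferentiableAt.comp (g := f) (w, z) (hf.differentiable z)
      differentiableAt_snd) Real.pi_pos.le h1 h2 (Eventually.of_forall fun _ ↦ h3) z
  exact DifferentiableAt.comp (f := fun y : ℂ ↦ (y, (0 : ℂ), z))
    (g := fun p : ℂ × ℂ × ℂ ↦ seriesShift a b p.1 f p.2.2) y h (by fun_prop)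

/-- The Mellin–Barnes integral sums the series in the unit disc. -/
theorem Admissible.barnesShift_eq_seriesShift {f : ℂ → ℂ} (hf : Admissible f) {a b : ℂ}
    (ha : ∀ n : ℕ, a ≠ -n) (hb : ∀ n : ℕ, b ≠ -n) (z : ℂ) {y : ℂ} (hy : ‖y‖ < 1)
    (hy' : -y ∈ Complex.slitPlane) : barnesShift a b y f z = seriesShift a b y f z := by
  obtain ⟨C, A, hC, hA, hg⟩ := hf.growth (2 * Real.pi / 3) (by linarith [Real.pi_pos])
  have hconn : IsPreconnected (Metric.ball (0 : ℂ) 1 ∩ Complex.slitPlane) := by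
    -- In the variable w = -y the overlap is the slit unit disc, star-shaped about each of its
    -- positive points; 1/64 is one inside (0, 1/32), where the contour can be closed to the right.
    have hstar : StarConvex ℝ ((1 / 64 : ℝ) : ℂ) (Metric.ball (0 : ℂ) 1 ∩ Complex.slitPlane) := by
      refine StarConvex.inter ((convex_ball _ _).starConvex ?_)
        (Complex.starConvex_ofReal_slitPlane (by norm_num))
      rw [mem_ball_zero_iff, Complex.norm_real]; norm_num
    exact (hstar.isPathConnected ⟨by rw [mem_ball_zero_iff, Complex.norm_real]; norm_num,
      by rw [Complex.ofReal_mem_slitPlane]; norm_num⟩).isConnected.isPreconnected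
  have key := Complex.eqOn_of_eventually_real_eq
    (f := fun w ↦ barnesShift a b (-w) f z) (g := fun w ↦ seriesShift a b (-w) f z)
    (U := Metric.ball (0 : ℂ) 1 ∩ Complex.slitPlane) (Metric.isOpen_ball.inter
      Complex.isOpen_slitPlane) hconn ?_ ?_ (x₀ := 1 / 64) ?_ ?_
  · have := key (x := -y) ⟨by simpa using hy, hy'⟩
    simpa using this
  · rintro w ⟨-, hw⟩
    exact (DifferentiableAt.comp (g := fun y ↦ barnesShift a b y f z) (f := fun w ↦ -w) w
      (hf.differentiableAt_barnesShift a b z (by simpa using hw))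
      (by fun_prop)).differentiableWithinAt
  · rintro w ⟨hw, -⟩
    exact (DifferentiableAt.comp (g := fun y ↦ seriesShift a b y f z) (f := fun w ↦ -w) w
      (hf.differentiableAt_seriesShift a b z (by simpa using hw))
      (by fun_prop)).differentiableWithinAt
  · exact ⟨by rw [mem_ball_zero_iff, Complex.norm_real]; norm_num,
      by rw [Complex.ofReal_mem_slitPlane]; norm_num⟩
  · filter_upwards [Ioo_mem_nhds (show (0 : ℝ) < 1 / 64 by norm_num)
      (show (1 / 64 : ℝ) < 1 / 32 by norm_num)] with x hx
    exact barnesShift_neg_eq_seriesShift hx.1 (by linarith [hx.2]) ha hb hf.differentiable hC hA hg z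

open Classical in
/-- The operator `∑ₖ (a)ₖ (b)ₖ / k! · yᵏ · f (z + k)`, continued to `y ∉ [1, ∞)`. -/
noncomputable def shiftOp (a b y : ℂ) (f : ℂ → ℂ) (z : ℂ) : ℂ :=
  if ‖y‖ < 1 then seriesShift a b y f z else barnesShift a b y f z

theorem shiftOp_of_norm_lt_one {y : ℂ} (hy : ‖y‖ < 1) (a b : ℂ) (f : ℂ → ℂ) (z : ℂ) :
    shiftOp a b y f z = seriesShift a b y f z := if_pos hy

theorem Admissible.shiftOp_eq_barnesShift {f : ℂ → ℂ} (hf : Admissible f) {a b : ℂ}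
    (ha : ∀ n : ℕ, a ≠ -n) (hb : ∀ n : ℕ, b ≠ -n) (z : ℂ) {y : ℂ}
    (hy' : -y ∈ Complex.slitPlane) : shiftOp a b y f z = barnesShift a b y f z := by
  rw [shiftOp]
  split_ifs with h
  · exact (hf.barnesShift_eq_seriesShift ha hb z h hy').symm
  · rfl

/-! ### The continued function of several variables -/

/-- The function `F_B^{[m]}(a, b; z | y) / Γ(z)` on the product of cut planes. -/
noncomputable def regularized : {m : ℕ} → (a b y : Fin m → ℂ) → ℂ → ℂ
  | 0, _, _, _ => fun z ↦ (Complex.Gamma z)⁻¹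
  | _ + 1, a, b, y => fun z ↦
      shiftOp (a 0) (b 0) (y 0) (regularized (Fin.tail a) (Fin.tail b) (Fin.tail y)) z

theorem isOpen_cutDomain (m : ℕ) : IsOpen (cutDomain m) := by
  have : cutDomain m = ⋂ i : Fin m, {y | ¬ ((y i).im = 0 ∧ 1 ≤ (y i).re)} := by
    ext y; simp [cutDomain]
  rw [this]
  refine isOpen_iInter_of_finite fun i ↦ ?_
  rw [← isClosed_compl_iff]
  simp only [Set.compl_ofPred, not_not]
  have h1 : IsClosed {y : Fin m → ℂ | (y i).im = 0} := isClosed_eq (by fun_prop) (by fun_prop)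
  have h2 : IsClosed {y : Fin m → ℂ | 1 ≤ (y i).re} := isClosed_le (by fun_prop) (by fun_prop)
  exact h1.inter h2

theorem neg_mem_slitPlane_of_one_le_norm {y : ℂ} (hy : ¬ (y.im = 0 ∧ 1 ≤ y.re)) (h : 1 ≤ ‖y‖) :
    -y ∈ Complex.slitPlane := by
  rw [Complex.mem_slitPlane_iff]
  by_cases him : y.im = 0
  · left
    have hre : ‖y‖ = |y.re| := by
      conv_lhs => rw [← Complex.re_add_im y, him]
      simp
    rw [hre] at h
    have h1 : ¬ 1 ≤ y.re := fun h' ↦ hy ⟨him, h'⟩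
    rcases le_abs.1 h with h2 | h2
    · exact absurd h2 h1
    · rw [Complex.neg_re]; linarith
  · right
    simpa using him

/-- `regularized` is holomorphic in all variables and has the growth of `1/Γ` in the last one. -/
theorem regularized_spec {m : ℕ} {a b : Fin m → ℂ}
    (hab : ∀ (i : Fin m) (n : ℕ), a i ≠ -(n : ℂ) ∧ b i ≠ -(n : ℂ)) {y₀ : Fin m → ℂ}
    (hy₀ : y₀ ∈ cutDomain m) :
    (∀ z, DifferentiableAt ℂ (fun p : (Fin m → ℂ) × ℂ ↦ regularized a b p.1 p.2) (y₀, z)) ∧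
    ∀ κ, Real.pi / 2 < κ → ∃ C A : ℝ, 0 ≤ C ∧ 1 ≤ A ∧
      ∀ᶠ y in 𝓝 y₀, GrowthBound κ C A (regularized a b y) := by
  induction m with
  | zero =>
    refine ⟨fun z ↦ ?_, fun κ hκ ↦ ?_⟩
    · exact DifferentiableAt.comp (g := fun z ↦ (Complex.Gamma z)⁻¹)
        (f := fun p : (Fin 0 → ℂ) × ℂ ↦ p.2) (y₀, z)
        (Complex.differentiable_one_div_Gamma z) differentiableAt_snd
    · obtain ⟨C, A, h1, h2, h3⟩ := exists_growthBound_inv_Gamma hκ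
      exact ⟨C, A, h1, h2, Eventually.of_forall fun _ ↦ h3⟩
  | succ m ih =>
    have hab' : ∀ (i : Fin m) (n : ℕ), Fin.tail a i ≠ -(n : ℂ) ∧ Fin.tail b i ≠ -(n : ℂ) :=
      fun i ↦ hab i.succ
    have ih' := fun {y : Fin m → ℂ} (hy : y ∈ cutDomain m) ↦ ih hab' hy
    have hadm : ∀ {y : Fin m → ℂ}, y ∈ cutDomain m →
        Admissible (regularized (Fin.tail a) (Fin.tail b) y) := by
      intro y hy
      refine ⟨fun z ↦ ?_, fun κ hκ ↦ ?_⟩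
      · exact DifferentiableAt.comp
          (g := fun p : (Fin m → ℂ) × ℂ ↦ regularized (Fin.tail a) (Fin.tail b) p.1 p.2)
          (f := fun z : ℂ ↦ (y, z)) z ((ih' hy).1 z) (by fun_prop)
      · obtain ⟨C, A, h1, h2, h3⟩ := (ih' hy).2 κ hκ
        exact ⟨C, A, h1, h2, h3.self_of_nhds⟩
    have htail : Fin.tail y₀ ∈ cutDomain m := fun i ↦ hy₀ i.succ
    have hcont : Continuous (fun y : Fin (m + 1) → ℂ ↦ (Fin.tail y : Fin m → ℂ)) := by
      unfold Fin.tail; fun_prop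
    have htend : Tendsto (fun y : Fin (m + 1) → ℂ ↦ (Fin.tail y : Fin m → ℂ)) (𝓝 y₀)
        (𝓝 (Fin.tail y₀)) := hcont.tendsto y₀
    have htend0 : Tendsto (fun y : Fin (m + 1) → ℂ ↦ y 0) (𝓝 y₀) (𝓝 (y₀ 0)) :=
      (continuous_apply 0).tendsto y₀
    have hd : ∀ᶠ w in 𝓝 (Fin.tail y₀ : Fin m → ℂ), ∀ z, DifferentiableAt ℂ
        (fun p : (Fin m → ℂ) × ℂ ↦ regularized (Fin.tail a) (Fin.tail b) p.1 p.2) (w, z) := by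
      filter_upwards [(isOpen_cutDomain m).mem_nhds htail] with w hw using (ih' hw).1
    have hlin : ∀ z, DifferentiableAt ℂ (fun p : (Fin (m + 1) → ℂ) × ℂ ↦
        (p.1 0, (Fin.tail p.1 : Fin m → ℂ), p.2)) (y₀, z) := by
      intro z
      refine DifferentiableAt.prodMk (by fun_prop) (DifferentiableAt.prodMk ?_ (by fun_prop))
      unfold Fin.tail
      fun_prop
    by_cases hnorm : ‖y₀ 0‖ < 1
    · have hev : ∀ᶠ y : Fin (m + 1) → ℂ in 𝓝 y₀, ‖y 0‖ < 1 :=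
        htend0.norm.eventually (gt_mem_nhds hnorm)
      refine ⟨fun z ↦ ?_, fun κ hκ ↦ ?_⟩
      · obtain ⟨C, A, h1, h2, h3⟩ := (ih' htail).2 Real.pi (by linarith [Real.pi_pos])
        have h := differentiableAt_seriesShift (a 0) (b 0) hnorm hd Real.pi_pos.le h1 h2 h3 z
        refine (DifferentiableAt.comp (y₀, z) h (hlin z)).congr_of_eventuallyEq ?_
        filter_upwards [(continuous_fst.tendsto (y₀, z)).eventually hev] with p hp
        exact shiftOp_of_norm_lt_one hp _ _ _ _
      · obtain ⟨C, A, h1, h2, h3⟩ := (ih' htail).2 κ hκ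
        obtain ⟨V, hV, D, A', hD, hA', hgr⟩ := exists_growthBound_seriesShift (a 0) (b 0) hnorm h2
        refine ⟨D * C, A', by positivity, hA', ?_⟩
        filter_upwards [hev, htend0 hV, htend.eventually h3] with y k1 k2 k3
        have := hgr (y 0) k2 _ κ C h1 k3
        convert this using 1
        funext z
        exact shiftOp_of_norm_lt_one k1 _ _ _ _
    · have hslit := neg_mem_slitPlane_of_one_le_norm (hy₀ 0) (not_lt.1 hnorm)
      -- A neighbourhood of y₀ may meet |y 0| < 1, where the definition switches to the series; the
      -- agreement of the two forms makes the integral valid throughout it.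
      have hev : ∀ᶠ y : Fin (m + 1) → ℂ in 𝓝 y₀, regularized a b y =
          barnesShift (a 0) (b 0) (y 0) (regularized (Fin.tail a) (Fin.tail b) (Fin.tail y)) := by
        filter_upwards [htend0.neg.eventually (Complex.isOpen_slitPlane.mem_nhds hslit),
          htend.eventually ((isOpen_cutDomain m).mem_nhds htail)] with y k1 k2
        funext z
        exact (hadm k2).shiftOp_eq_barnesShift (fun n ↦ (hab 0 n).1) (fun n ↦ (hab 0 n).2) z k1
      refine ⟨fun z ↦ ?_, fun κ hκ ↦ ?_⟩
      · have h := differentiableAt_barnesShift (a 0) (b 0) hslit hd (ih' htail).2 z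
        refine (DifferentiableAt.comp (y₀, z) h (hlin z)).congr_of_eventuallyEq ?_
        filter_upwards [(continuous_fst.tendsto (y₀, z)).eventually hev] with p hp
        exact congrFun hp _
      · obtain ⟨κ₀, V, hV, hκ₀, hgr⟩ := exists_growthBound_barnesShift (a 0) (b 0) hslit
        -- The integral operator handles only rates below κ₀, so the bound is proved at a smaller
        -- rate κ' and then weakened to κ.
        obtain ⟨κ', hκ'1, hκ'2⟩ := exists_between (lt_min hκ hκ₀)
        obtain ⟨hκ'2, hκ'3⟩ := lt_min_iff.1 hκ'2
        obtain ⟨D, hD, hgr⟩ := hgr κ' hκ'1 hκ'3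
        obtain ⟨C, A, h1, h2, h3⟩ := (ih' htail).2 κ' hκ'1
        refine ⟨D * C, A, by positivity, h2, ?_⟩
        filter_upwards [hev, htend0 hV, htend.eventually h3] with y k1 k2 k3
        rw [k1]
        exact (hgr (y 0) k2 _ C A h1 (by linarith) k3).mono (by positivity) (by linarith) hκ'2.le

theorem admissible_regularized {m : ℕ} {a b : Fin m → ℂ}
    (hab : ∀ (i : Fin m) (n : ℕ), a i ≠ -(n : ℂ) ∧ b i ≠ -(n : ℂ)) {y : Fin m → ℂ}
    (hy : y ∈ cutDomain m) : Admissible (regularized a b y) := by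
  have h := regularized_spec hab hy
  refine ⟨fun z ↦ ?_, fun κ hκ ↦ ?_⟩
  · exact DifferentiableAt.comp (g := fun p : (Fin m → ℂ) × ℂ ↦ regularized a b p.1 p.2)
      (f := fun z : ℂ ↦ (y, z)) z (h.1 z) (by fun_prop)
  · obtain ⟨C, A, h1, h2, h3⟩ := h.2 κ hκ
    exact ⟨C, A, h1, h2, h3.self_of_nhds⟩

theorem differentiableAt_regularized {m : ℕ} {a b : Fin m → ℂ}
    (hab : ∀ (i : Fin m) (n : ℕ), a i ≠ -(n : ℂ) ∧ b i ≠ -(n : ℂ)) {y : Fin m → ℂ}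
    (hy : y ∈ cutDomain m) (z : ℂ) : DifferentiableAt ℂ (fun y ↦ regularized a b y z) y :=
  DifferentiableAt.comp (g := fun p : (Fin m → ℂ) × ℂ ↦ regularized a b p.1 p.2)
    (f := fun y : Fin m → ℂ ↦ (y, z)) y ((regularized_spec hab hy).1 z) (by fun_prop)

/-! ### The power series in the polydisc -/

theorem summable_prod_pow {m : ℕ} {r : Fin m → ℝ} (hr0 : ∀ i, 0 ≤ r i) (hr : ∀ i, r i < 1) :
    Summable fun k : Fin m → ℕ ↦ ∏ i, r i ^ k i := by
  induction m with
  | zero => exact Summable.of_finite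
  | succ m ih =>
    rw [← (Fin.consEquiv fun _ : Fin (m + 1) ↦ ℕ).summable_iff]
    refine ((summable_geometric_of_lt_one (hr0 0) (hr 0)).mul_of_nonneg
      (ih (fun i ↦ hr0 i.succ) (fun i ↦ hr i.succ)) (fun k ↦ pow_nonneg (hr0 0) k)
      (fun k ↦ Finset.prod_nonneg fun i _ ↦ pow_nonneg (hr0 _) _)).congr fun p ↦ ?_
    rw [Function.comp_apply, Fin.prod_univ_succ]
    simp [Fin.consEquiv]

/-- The general term of the series of type B, divided by `Γ(z)`. -/
noncomputable def regularizedTerm {m : ℕ} (a b y : Fin m → ℂ) (z : ℂ) (k : Fin m → ℕ) : ℂ :=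
  (∏ i, coeff (a i) (b i) (k i) * y i ^ k i) * (Complex.Gamma (z + (∑ i, k i : ℕ)))⁻¹

/-- The coefficients are O(q^{kᵢ} kᵢ!) and 1/Γ(z+n) is O(qⁿ/n!) for n = ∑ kᵢ. Since ∏ kᵢ! ≤ n!, the
terms are dominated by ∏ (q²|yᵢ|)^{kᵢ} for any q > 1, and q is taken close enough to 1. -/
theorem summable_regularizedTerm {m : ℕ} (a b : Fin m → ℂ) {y : Fin m → ℂ} (hy : ∀ i, ‖y i‖ < 1)
    (z : ℂ) : Summable (regularizedTerm a b y z) := by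
  obtain ⟨q, hq1, hq⟩ : ∃ q : ℝ, 1 < q ∧ ∀ i, q * q * ‖y i‖ < 1 := by
    have h : ∀ i, ∀ᶠ q : ℝ in 𝓝[>] 1, q * q * ‖y i‖ < 1 := by
      intro i
      have hc : Tendsto (fun q : ℝ ↦ q * q * ‖y i‖) (𝓝 1) (𝓝 (1 * 1 * ‖y i‖)) :=
        (Continuous.tendsto (by fun_prop) 1)
      exact (hc.mono_left nhdsWithin_le_nhds).eventually (gt_mem_nhds (by simpa using hy i))
    obtain ⟨q, h1, h2⟩ := ((eventually_all.2 h).and self_mem_nhdsWithin).exists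
    exact ⟨q, h2, h1⟩
  choose C hC0 hC using fun i ↦ exists_norm_coeff_le (a i) (b i) hq1
  obtain ⟨D, A, hD, hA, hG⟩ := exists_growthBound_inv_Gamma (κ := Real.pi) (by linarith [Real.pi_pos])
  obtain ⟨M, hM⟩ := exists_nat_ge (1 - z.re)
  have hx : 0 < q - 1 := by linarith
  set B : ℝ := D * max A (1 / (q - 1)) ^ M * M ! * Real.exp (Real.pi * |z.im|) with hB
  have hB0 : 0 ≤ B := by positivity
  have hGn : ∀ n : ℕ, ‖(Complex.Gamma (z + n))⁻¹‖ ≤ B * (q ^ n / n !) := by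
    intro n
    have := hG.norm_add_nat_le hD hA hx (le_max_left A (1 / (q - 1))) (le_max_right _ _)
      (n := M) (z := z) (by linarith) n
    rwa [add_sub_cancel] at this
  refine Summable.of_norm_bounded ((summable_prod_pow (r := fun i ↦ q * q * ‖y i‖)
    (fun i ↦ by positivity) hq).mul_left ((∏ i, C i) * B)) fun k ↦ ?_
  rw [regularizedTerm, norm_mul, norm_prod]
  have h1 : ∏ i, ‖coeff (a i) (b i) (k i) * y i ^ k i‖ ≤
      ∏ i, (C i * (q * ‖y i‖) ^ k i * ((k i)! : ℝ)) := by
    refine Finset.prod_le_prod (fun i _ ↦ norm_nonneg _) fun i _ ↦ ?_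
    rw [norm_mul, norm_pow, mul_pow]
    calc _ ≤ (C i * q ^ k i * (k i)!) * ‖y i‖ ^ k i := by gcongr; exact hC i (k i)
      _ = _ := by ring
  have h2 : (∏ i, ((k i)! : ℝ)) ≤ ((∑ i, k i)! : ℕ) := by
    rw [← Nat.cast_prod]
    exact_mod_cast Nat.le_of_dvd (Nat.factorial_pos _)
      (Nat.prod_factorial_dvd_factorial_sum Finset.univ k)
  have hC' : 0 ≤ ∏ i, C i := Finset.prod_nonneg fun i _ ↦ hC0 i
  have hP : 0 ≤ ∏ i, (q * ‖y i‖) ^ k i := Finset.prod_nonneg fun i _ ↦ by positivity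
  have hq0 : 0 < q := by linarith
  calc _ ≤ (∏ i, (C i * (q * ‖y i‖) ^ k i * ((k i)! : ℝ))) *
        (B * (q ^ (∑ i, k i) / ((∑ i, k i)! : ℕ))) := by
        gcongr
        · exact Finset.prod_nonneg fun i _ ↦ by have := hC0 i; positivity
        · exact hGn _
    _ = (∏ i, C i) * (∏ i, (q * ‖y i‖) ^ k i) * B * (q ^ (∑ i, k i)) *
        ((∏ i, ((k i)! : ℝ)) / ((∑ i, k i)! : ℕ)) := by
        rw [Finset.prod_mul_distrib, Finset.prod_mul_distrib]; ring
    _ ≤ (∏ i, C i) * (∏ i, (q * ‖y i‖) ^ k i) * B * (q ^ (∑ i, k i)) * 1 := by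
        gcongr
        exact (div_le_one (by positivity)).2 h2
    _ = (∏ i, C i) * B * ((∏ i, (q * ‖y i‖) ^ k i) * ∏ i, q ^ k i) := by
        rw [Finset.prod_pow_eq_pow_sum]; ring
    _ = _ := by
        rw [← Finset.prod_mul_distrib]
        congr 1
        refine Finset.prod_congr rfl fun i _ ↦ ?_
        rw [← mul_pow]; ring

theorem regularizedTerm_cons {m : ℕ} (a b y : Fin (m + 1) → ℂ) (z : ℂ) (k : ℕ) (k' : Fin m → ℕ) :
    regularizedTerm a b y z (Fin.cons k k' : Fin (m + 1) → ℕ) = coeff (a 0) (b 0) k * y 0 ^ k *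
      regularizedTerm (Fin.tail a) (Fin.tail b) (Fin.tail y) (z + k) k' := by
  simp only [regularizedTerm, Fin.prod_univ_succ, Fin.sum_univ_succ, Fin.cons_zero, Fin.cons_succ,
    Fin.tail]
  rw [Nat.cast_add, ← add_assoc]
  ring

/-- Absolute convergence permits summation over the fibres of k ↦ k 0; each fibre is the series in
one variable fewer at z+k. -/
theorem hasSum_regularizedTerm {m : ℕ} (a b : Fin m → ℂ) {y : Fin m → ℂ} (hy : ∀ i, ‖y i‖ < 1)
    (z : ℂ) : HasSum (regularizedTerm a b y z) (regularized a b y z) := by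
  induction m generalizing z with
  | zero =>
    have : regularized a b y z = ∑ k : Fin 0 → ℕ, regularizedTerm a b y z k := by
      simp [regularized, regularizedTerm]
    rw [this]
    exact hasSum_fintype _
  | succ m ih =>
    have hs := summable_regularizedTerm a b hy z
    have hs' : HasSum (fun p : ℕ × (Fin m → ℕ) ↦
        regularizedTerm a b y z (Fin.cons p.1 p.2 : Fin (m + 1) → ℕ))
        (∑' k, regularizedTerm a b y z k) :=
      ((Fin.consEquiv fun _ : Fin (m + 1) ↦ ℕ).hasSum_iff (f := regularizedTerm a b y z)).2 hs.hasSum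
    have hfib : ∀ k : ℕ, HasSum (fun k' : Fin m → ℕ ↦
        regularizedTerm a b y z (Fin.cons k k' : Fin (m + 1) → ℕ))
        (coeff (a 0) (b 0) k * y 0 ^ k *
          regularized (Fin.tail a) (Fin.tail b) (Fin.tail y) (z + k)) := by
      intro k
      simp only [regularizedTerm_cons]
      exact (ih (Fin.tail a) (Fin.tail b) (y := Fin.tail y) (fun i ↦ hy i.succ) (z + k)).mul_left _
    have hfs := (hs'.prod_fiberwise hfib).tsum_eq
    have : regularized a b y z = ∑' k, regularizedTerm a b y z k := by
      rw [← hfs]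
      exact shiftOp_of_norm_lt_one (hy 0) _ _ _ _
    rw [this]
    exact hs.hasSum

theorem seriesTerm_eq {m : ℕ} (a b y : Fin m → ℂ) {c : ℂ} (hc : ∀ n : ℕ, c ≠ -n) (k : Fin m → ℕ) :
    seriesTerm a b c y k = Complex.Gamma c * regularizedTerm a b y c k := by
  have hG := Gamma_add_nat_eq hc (∑ i, k i)
  have hG0 := Complex.Gamma_ne_zero hc
  rw [regularizedTerm, hG, seriesTerm, mul_inv]
  simp only [coeff, Finset.prod_mul_distrib, Finset.prod_div_distrib]
  field_simp

/-! ### Convergence of the series at infinity -/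

/-- A multinomial coefficient is at most m^{∑ kᵢ}; splitting off one index uses a single term of the
binomial expansion of (1+m)^{∑ kᵢ}. -/
theorem factorial_sum_le {m : ℕ} (k : Fin m → ℕ) :
    ((∑ i, k i)! : ℝ) ≤ (m : ℝ) ^ (∑ i, k i) * ∏ i, ((k i)! : ℝ) := by
  induction m with
  | zero => simp
  | succ m ih =>
    have h := ih fun i ↦ k i.succ
    rw [Fin.sum_univ_succ, Fin.prod_univ_succ]
    set K := ∑ i : Fin m, k i.succ
    have hch := choose_mul_pow_le (x := m) (by positivity) (k 0 + K) K
    have hf : ((k 0 + K)! : ℝ) = (k 0 + K).choose K * (k 0)! * K ! := by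
      rw [← Nat.add_choose_mul_factorial_mul_factorial, ← Nat.choose_symm_add]
      push_cast; ring
    calc ((k 0 + K)! : ℝ) = (k 0 + K).choose K * (k 0)! * K ! := hf
      _ ≤ (k 0 + K).choose K * (k 0)! * ((m : ℝ) ^ K * ∏ i : Fin m, ((k i.succ)! : ℝ)) := by gcongr
      _ = ((k 0 + K).choose K * (m : ℝ) ^ K) * ((k 0)! * ∏ i : Fin m, ((k i.succ)! : ℝ)) := by ring
      _ ≤ (1 + m : ℝ) ^ (k 0 + K) * ((k 0)! * ∏ i : Fin m, ((k i.succ)! : ℝ)) := by gcongr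
      _ = _ := by push_cast; ring

theorem exists_norm_inv_Gamma_sub_nat_le (w : ℂ) :
    ∃ C, 0 ≤ C ∧ ∀ n : ℕ, ‖(Complex.Gamma (w - n))⁻¹‖ ≤ C * (2 ^ n * n !) := by
  have hstep : ∀ n : ℕ, ‖(Complex.Gamma (w - (n + 1 : ℕ)))⁻¹‖ / (n + 1)! ≤
      (‖w‖ + 1 + n) / (1 + n) * (‖(Complex.Gamma (w - n))⁻¹‖ / n !) := by
    intro n
    have h1 : (Complex.Gamma (w - (n + 1 : ℕ)))⁻¹ =
        (w - (n + 1 : ℕ)) * (Complex.Gamma (w - n))⁻¹ := by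
      have := Complex.one_div_Gamma_eq_self_mul_one_div_Gamma_add_one (w - (n + 1 : ℕ))
      rw [this]
      congr 3
      push_cast; ring
    have h2 : ‖w - (n + 1 : ℕ)‖ ≤ ‖w‖ + 1 + n := by
      refine (norm_sub_le _ _).trans ?_
      rw [Complex.norm_natCast]; push_cast; linarith
    rw [h1, norm_mul, Nat.factorial_succ]
    push_cast at h2 ⊢
    calc _ ≤ (‖w‖ + 1 + n) * ‖(Complex.Gamma (w - n))⁻¹‖ / ((n + 1) * n !) := by gcongr
      _ = _ := by rw [div_mul_div_comm, add_comm (1 : ℝ) n]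
  obtain ⟨C, hC, h⟩ := exists_le_mul_pow_of_ratio (q := 2)
    (u := fun n : ℕ ↦ ‖(Complex.Gamma (w - n))⁻¹‖ / n !) (fun n ↦ by positivity) hstep
    (tendsto_add_div_add_atTop _ _) (by norm_num)
  refine ⟨C, hC, fun n ↦ ?_⟩
  have := (div_le_iff₀ (by positivity)).1 (h n)
  linarith

/-- The general term of the series in `1/y₁, …, 1/yₘ` with leading exponents `-αᵢ`, where
`βᵢ` is the other exponent in the `i`-th variable. -/
noncomputable def exponentTerm {m : ℕ} (α β y : Fin m → ℂ) (z : ℂ) (k : Fin m → ℕ) : ℂ :=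
  (∏ i, Complex.Gamma (β i - α i - k i) * Complex.Gamma (α i + k i) / (((k i)! : ℂ) * y i ^ k i)) *
    (Complex.Gamma (z - ∑ i, (α i + k i)))⁻¹

/-- The source of the constant 4m: a factor 2 from the Gamma products, 2 from 1/Γ(w-n) = O(2ⁿ n!),
and m from comparing (∑ kᵢ)! with ∏ kᵢ!. The parameters enter only through C, which is why the
radius depends on m alone. -/
theorem exists_norm_exponentTerm_le {m : ℕ} {α β : Fin m → ℂ} (hα : ∀ i, ∀ n : ℕ, α i ≠ -n)
    (hαβ : ∀ i, ∀ n : ℤ, α i - β i ≠ n) (z : ℂ) :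
    ∃ C, 0 ≤ C ∧ ∀ y k, ‖exponentTerm α β y z k‖ ≤ C * ∏ i, (4 * m * ‖y i‖⁻¹) ^ k i := by
  choose C hC0 hC using fun i ↦ exists_norm_Gamma_mul_Gamma_le (hα i) (hαβ i)
  obtain ⟨D, hD0, hD⟩ := exists_norm_inv_Gamma_sub_nat_le (z - ∑ i, α i)
  have hC' : 0 ≤ ∏ i, C i := Finset.prod_nonneg fun i _ ↦ hC0 i
  refine ⟨(∏ i, C i) * D, by positivity, fun y k ↦ ?_⟩
  have hz : z - ∑ i, (α i + k i) = z - ∑ i, α i - (∑ i, k i : ℕ) := by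
    rw [Finset.sum_add_distrib]; push_cast; ring
  rw [exponentTerm, norm_mul, norm_prod, hz]
  have h1 : ∏ i, ‖Complex.Gamma (β i - α i - k i) * Complex.Gamma (α i + k i) /
      (((k i)! : ℂ) * y i ^ k i)‖ ≤ ∏ i, (C i * (2 * ‖y i‖⁻¹) ^ k i * ((k i)! : ℝ)⁻¹) := by
    refine Finset.prod_le_prod (fun i _ ↦ norm_nonneg _) fun i _ ↦ ?_
    rw [norm_div, norm_mul (_ : ℂ) (y i ^ k i), Complex.norm_natCast, norm_pow]
    calc _ ≤ (C i * 2 ^ k i) / ((k i)! * ‖y i‖ ^ k i) := by gcongr; exact hC i (k i)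
      _ = _ := by rw [div_eq_mul_inv, mul_inv, mul_pow, inv_pow]; ring
  have hP : 0 ≤ ∏ i, (2 * ‖y i‖⁻¹) ^ k i := Finset.prod_nonneg fun i _ ↦ by positivity
  have hF : 0 < ∏ i, ((k i)! : ℝ) := Finset.prod_pos fun i _ ↦ by positivity
  calc _ ≤ (∏ i, (C i * (2 * ‖y i‖⁻¹) ^ k i * ((k i)! : ℝ)⁻¹)) *
        (D * (2 ^ (∑ i, k i) * ((m : ℝ) ^ (∑ i, k i) * ∏ i, ((k i)! : ℝ)))) := by
        gcongr
        · exact Finset.prod_nonneg fun i _ ↦ by have := hC0 i; positivity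
        · refine (hD _).trans ?_
          gcongr
          exact factorial_sum_le k
    _ = (∏ i, C i) * D * ((∏ i, (2 * ‖y i‖⁻¹) ^ k i) * (∏ i, (2 : ℝ) ^ k i) *
          ∏ i, (m : ℝ) ^ k i) := by
        rw [Finset.prod_mul_distrib, Finset.prod_mul_distrib, Finset.prod_inv_distrib,
          Finset.prod_pow_eq_pow_sum, Finset.prod_pow_eq_pow_sum]
        field_simp
    _ = _ := by
        rw [← Finset.prod_mul_distrib, ← Finset.prod_mul_distrib]
        congr 1
        refine Finset.prod_congr rfl fun i _ ↦ ?_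
        rw [← mul_pow, ← mul_pow]; ring

theorem summable_exponentTerm {m : ℕ} {α β : Fin m → ℂ} (hα : ∀ i, ∀ n : ℕ, α i ≠ -n)
    (hαβ : ∀ i, ∀ n : ℤ, α i - β i ≠ n) (z : ℂ) {y : Fin m → ℂ} (hy : ∀ i, 4 * m + 1 < ‖y i‖) :
    Summable (exponentTerm α β y z) := by
  obtain ⟨C, -, h⟩ := exists_norm_exponentTerm_le hα hαβ z
  refine Summable.of_norm_bounded ((summable_prod_pow (fun i ↦ by positivity)
    (fun i ↦ ?_)).mul_left C) (h y)
  have hm : (0 : ℝ) ≤ m := by positivity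
  rw [← div_eq_mul_inv, div_lt_one (by linarith [hy i])]
  linarith [hy i]

theorem differentiableAt_exponentTerm {m : ℕ} (α β : Fin m → ℂ) (z : ℂ) {y : Fin m → ℂ}
    (hy : ∀ i, y i ≠ 0) (k : Fin m → ℕ) :
    DifferentiableAt ℂ (fun y ↦ exponentTerm α β y z k) y := by
  unfold exponentTerm
  refine DifferentiableAt.mul_const ?_ _
  have h : ∀ i, DifferentiableAt ℂ (fun y : Fin m → ℂ ↦ Complex.Gamma (β i - α i - k i) *
      Complex.Gamma (α i + k i) / (((k i)! : ℂ) * y i ^ k i)) y := by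
    intro i
    have h0 : ((k i)! : ℂ) * y i ^ k i ≠ 0 :=
      mul_ne_zero (by exact_mod_cast (k i).factorial_ne_zero) (pow_ne_zero _ (hy i))
    fun_prop (disch := exact h0)
  exact (HasFDerivAt.finsetProd (u := Finset.univ) fun i _ ↦ (h i).hasFDerivAt).differentiableAt

theorem differentiableAt_tsum_exponentTerm {m : ℕ} {α β : Fin m → ℂ}
    (hα : ∀ i, ∀ n : ℕ, α i ≠ -n) (hαβ : ∀ i, ∀ n : ℤ, α i - β i ≠ n) (z : ℂ) {y : Fin m → ℂ}
    (hy : ∀ i, 4 * m + 1 < ‖y i‖) :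
    DifferentiableAt ℂ (fun y ↦ ∑' k, exponentTerm α β y z k) y := by
  obtain ⟨C, hC, h⟩ := exists_norm_exponentTerm_le hα hαβ z
  have hm : (0 : ℝ) ≤ m := by positivity
  have hs : {y : Fin m → ℂ | ∀ i, 4 * m + 1 < ‖y i‖} ∈ 𝓝 y := by
    refine IsOpen.mem_nhds ?_ hy
    simp only [Set.ofPred_forall]
    exact isOpen_iInter_of_finite fun i ↦ isOpen_lt (by fun_prop) (by fun_prop)
  refine differentiableAt_tsum_of_dominated hs
    (bound := fun k ↦ C * ∏ i, (4 * m * ((4 * m + 1 : ℝ))⁻¹) ^ k i) (fun y hy k ↦ ?_) ?_ ?_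
  · refine (h y k).trans ?_
    gcongr with i
    exact (hy i).le
  · refine (summable_prod_pow (fun i ↦ by positivity) (fun i ↦ ?_)).mul_left C
    rw [← div_eq_mul_inv, div_lt_one (by linarith)]
    linarith
  · intro k y hy
    refine differentiableAt_exponentTerm α β z (fun i ↦ ?_) k
    rw [← norm_pos_iff]
    linarith [hy i]

theorem exponentTerm_cons {m : ℕ} (α β y : Fin (m + 1) → ℂ) (z : ℂ) (k : ℕ) (k' : Fin m → ℕ) :
    exponentTerm α β y z (Fin.cons k k' : Fin (m + 1) → ℕ) =
      Complex.Gamma (β 0 - α 0 - k) * Complex.Gamma (α 0 + k) / ((k ! : ℂ) * y 0 ^ k) *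
        exponentTerm (Fin.tail α) (Fin.tail β) (Fin.tail y) (z - (α 0 + k)) k' := by
  simp only [exponentTerm, Fin.prod_univ_succ, Fin.sum_univ_succ, Fin.cons_zero, Fin.cons_succ,
    Fin.tail]
  rw [← sub_sub, mul_assoc]

/-- The contribution of the leading exponents `-αᵢ` to the expansion at infinity. -/
noncomputable def exponentSum {m : ℕ} (α β y : Fin m → ℂ) (z : ℂ) : ℂ :=
  (∏ i, (-y i) ^ (-α i)) * ∑' k, exponentTerm α β y z k

/-- The one-variable expansion evaluates the m-variable sum at z-(α₀+k), which is the fibre over k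
of the sum in m+1 variables. The power of -y 0 is left out, as it stands in front of the
one-variable expansion. -/
theorem hasSum_infinityShiftTerm_exponentSum {m : ℕ} {α β : Fin (m + 1) → ℂ}
    (hα : ∀ i, ∀ n : ℕ, α i ≠ -n) (hαβ : ∀ i, ∀ n : ℤ, α i - β i ≠ n) (z : ℂ)
    {y : Fin (m + 1) → ℂ} (hy : ∀ i, 4 * (m + 1 : ℕ) + 1 < ‖y i‖) :
    HasSum (infinityShiftTerm (α 0) (β 0) (y 0)
        (exponentSum (Fin.tail α) (Fin.tail β) (Fin.tail y)) z)
      ((∏ i : Fin m, (-y i.succ) ^ (-α i.succ)) * ∑' k, exponentTerm α β y z k) := by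
  have hs := summable_exponentTerm hα hαβ z hy
  have hs' : HasSum (fun p : ℕ × (Fin m → ℕ) ↦
      exponentTerm α β y z (Fin.cons p.1 p.2 : Fin (m + 1) → ℕ)) (∑' k, exponentTerm α β y z k) :=
    ((Fin.consEquiv fun _ : Fin (m + 1) ↦ ℕ).hasSum_iff (f := exponentTerm α β y z)).2 hs.hasSum
  have hy' : ∀ i : Fin m, 4 * (m : ℝ) + 1 < ‖(Fin.tail y : Fin m → ℂ) i‖ := fun i ↦ by
    have := hy i.succ
    push_cast at this
    exact lt_trans (by linarith) this
  have hfib : ∀ k : ℕ, HasSum (fun k' : Fin m → ℕ ↦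
      exponentTerm α β y z (Fin.cons k k' : Fin (m + 1) → ℕ))
      (Complex.Gamma (β 0 - α 0 - k) * Complex.Gamma (α 0 + k) / ((k ! : ℂ) * y 0 ^ k) *
        ∑' k', exponentTerm (Fin.tail α) (Fin.tail β) (Fin.tail y) (z - (α 0 + k)) k') := by
    intro k
    simp only [exponentTerm_cons]
    exact (summable_exponentTerm (α := Fin.tail α) (β := Fin.tail β) (fun i ↦ hα i.succ)
      (fun i ↦ hαβ i.succ) _ hy').hasSum.mul_left _
  have h := (hs'.prod_fiberwise hfib).mul_left (∏ i : Fin m, (-y i.succ) ^ (-α i.succ))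
  refine h.congr_fun fun k ↦ ?_
  simp only [infinityShiftTerm, exponentSum, Fin.tail]
  ring

/-! ### The expansion at infinity -/

/-- The exponents selected by `e` among `aᵢ` and `bᵢ`. -/
def selectExponent {m : ℕ} (e : Fin m → Bool) (a b : Fin m → ℂ) (i : Fin m) : ℂ :=
  cond (e i) (a i) (b i)

/-- The expansion at infinity of `regularized`. -/
noncomputable def infinityExpansion {m : ℕ} (a b y : Fin m → ℂ) (z : ℂ) : ℂ :=
  (∏ i, Complex.Gamma (a i) * Complex.Gamma (b i))⁻¹ *
    ∑ e : Fin m → Bool, exponentSum (selectExponent e a b) (selectExponent e b a) y z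

section

variable {m : ℕ} {a b : Fin m → ℂ} (e : Fin m → Bool)

theorem selectExponent_ne (hab : ∀ (i : Fin m) (n : ℕ), a i ≠ -(n : ℂ) ∧ b i ≠ -(n : ℂ))
    (i : Fin m) (n : ℕ) : selectExponent e a b i ≠ -n := by
  unfold selectExponent
  cases e i
  · exact (hab i n).2
  · exact (hab i n).1

theorem selectExponent_sub_ne (hd : ∀ (i : Fin m) (n : ℤ), a i - b i ≠ (n : ℂ))
    (i : Fin m) (n : ℤ) : selectExponent e a b i - selectExponent e b a i ≠ n := by
  unfold selectExponent
  cases e i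
  · intro h
    refine hd i (-n) ?_
    push_cast
    rw [← h]
    simp
  · exact hd i n

end

theorem differentiableAt_exponentSum {m : ℕ} {α β : Fin m → ℂ}
    (hα : ∀ i, ∀ n : ℕ, α i ≠ -n) (hαβ : ∀ i, ∀ n : ℤ, α i - β i ≠ n) (z : ℂ) {y : Fin m → ℂ}
    (hy : ∀ i, (y i).re < -(4 * m + 1)) :
    DifferentiableAt ℂ (fun y ↦ exponentSum α β y z) y := by
  have hm : (0 : ℝ) ≤ m := by positivity
  refine DifferentiableAt.mul ?_ (differentiableAt_tsum_exponentTerm hα hαβ z fun i ↦ ?_)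
  · have h : ∀ i, DifferentiableAt ℂ (fun y : Fin m → ℂ ↦ (-y i) ^ (-α i)) y := by
      intro i
      have h0 : -y i ∈ Complex.slitPlane := by
        left
        rw [Complex.neg_re]
        linarith [hy i]
      refine DifferentiableAt.cpow (by fun_prop) (by fun_prop) h0
    exact (HasFDerivAt.finsetProd (u := Finset.univ) fun i _ ↦ (h i).hasFDerivAt).differentiableAt
  · have := Complex.abs_re_le_norm (y i)
    have := neg_abs_le (y i).re
    linarith [hy i]

theorem mem_cutDomain_of_re_lt {m : ℕ} {R : ℝ} (hR : 0 ≤ R) {y : Fin m → ℂ}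
    (hy : ∀ i, (y i).re < -R) : y ∈ cutDomain m := fun i h ↦ by linarith [hy i, h.2]

theorem infinityShiftTerm_sum {ι : Type*} (s : Finset ι) (a b y C : ℂ) (g : ι → ℂ → ℂ) (z : ℂ)
    (k : ℕ) : infinityShiftTerm a b y (fun w ↦ C * ∑ i ∈ s, g i w) z k =
      C * ∑ i ∈ s, infinityShiftTerm a b y (g i) z k := by
  simp only [infinityShiftTerm, ← Finset.mul_sum]
  ring

/-- Induction on m, for all z at once, since the one-variable expansion needs the tail function at
every z-(α₀+k). The contour argument gives equality only for y 0 = -x with x beyond an uncontrolled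
X. With the tail fixed, both sides are holomorphic in y 0 on the half-plane of the statement, so
equality extends to all of it. -/
theorem regularized_eq_infinityExpansion {m : ℕ} {a b : Fin m → ℂ}
    (hab : ∀ (i : Fin m) (n : ℕ), a i ≠ -(n : ℂ) ∧ b i ≠ -(n : ℂ))
    (hd : ∀ (i : Fin m) (n : ℤ), a i - b i ≠ (n : ℂ)) {y : Fin m → ℂ}
    (hy : ∀ i, (y i).re < -(4 * m + 1)) (z : ℂ) :
    regularized a b y z = infinityExpansion a b y z := by
  induction m generalizing z with
  | zero =>
    simp [regularized, infinityExpansion, exponentSum, exponentTerm]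
  | succ m ih =>
    have hm : (0 : ℝ) ≤ m := by positivity
    push_cast at hy
    have hab' : ∀ (i : Fin m) (n : ℕ), Fin.tail a i ≠ -(n : ℂ) ∧ Fin.tail b i ≠ -(n : ℂ) :=
      fun i ↦ hab i.succ
    have hd' : ∀ (i : Fin m) (n : ℤ), Fin.tail a i - Fin.tail b i ≠ (n : ℂ) := fun i ↦ hd i.succ
    have ih' := ih hab' hd' (y := Fin.tail y) fun i ↦ lt_trans (hy i.succ) (by linarith)
    have htail : Fin.tail y ∈ cutDomain m :=
      mem_cutDomain_of_re_lt (R := 4 * (m + 1) + 1) (by positivity) fun i ↦ hy i.succ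
    set v : ℂ → Fin (m + 1) → ℂ := fun w ↦ Fin.cons (-w) (Fin.tail y) with hv
    have hvd : ∀ w, DifferentiableAt ℂ v w := by
      intro w
      rw [differentiableAt_pi]
      intro i
      refine Fin.cases ?_ (fun j ↦ ?_) i
      · simp only [hv, Fin.cons_zero]; fun_prop
      · simp only [hv, Fin.cons_succ]; fun_prop
    have hvre : ∀ {w : ℂ}, 4 * (m + 1) + 1 < w.re → ∀ i, (v w i).re < -(4 * (m + 1) + 1) := by
      intro w hw i
      refine Fin.cases ?_ (fun j ↦ ?_) i
      · simp only [hv, Fin.cons_zero, Complex.neg_re]; linarith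
      · simp only [hv, Fin.cons_succ]; exact hy j.succ
    have hvcut : ∀ {w : ℂ}, 4 * (m + 1) + 1 < w.re → v w ∈ cutDomain (m + 1) := fun hw ↦
      mem_cutDomain_of_re_lt (R := 4 * (m + 1) + 1) (by positivity) (hvre hw)
    have hadm := admissible_regularized hab' htail
    obtain ⟨C, A, hC, hA, hg⟩ := hadm.growth (2 * Real.pi / 3) (by linarith [Real.pi_pos])
    obtain ⟨X, hX, hXeq⟩ := exists_barnesShift_neg_eq_infinity (fun n ↦ (hab 0 n).1)
      (fun n ↦ (hab 0 n).2) (hd 0) hadm.differentiable hC hA hg z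
    have hreal : ∀ x : ℝ, X < x → 4 * (m + 1) + 1 < x →
        regularized a b (v x) z = infinityExpansion a b (v x) z := by
      intro x hx1 hx2
      have hx0 : 0 < x := by linarith
      have hnorm : ∀ i, 4 * ((m + 1 : ℕ) : ℝ) + 1 < ‖v x i‖ := fun i ↦ by
        have h1 := hvre (w := x) (by simpa using hx2) i
        have h2 := Complex.abs_re_le_norm (v x i)
        have h3 := neg_abs_le (v x i).re
        push_cast
        linarith
      have h1 : regularized a b (v x) z = barnesShift (a 0) (b 0) (-x)
          (regularized (Fin.tail a) (Fin.tail b) (Fin.tail y)) z :=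
        hadm.shiftOp_eq_barnesShift (fun n ↦ (hab 0 n).1) (fun n ↦ (hab 0 n).2) z
          (by simpa [hv] using hx0)
      have h2 : ∀ c : Bool, HasSum (infinityShiftTerm (cond c (a 0) (b 0)) (cond c (b 0) (a 0)) (-x)
          (regularized (Fin.tail a) (Fin.tail b) (Fin.tail y)) z)
          ((∏ i : Fin m, Complex.Gamma (a i.succ) * Complex.Gamma (b i.succ))⁻¹ *
            ∑ e : Fin m → Bool,
              (∏ i : Fin m, (-y i.succ) ^ (-selectExponent e (Fin.tail a) (Fin.tail b) i)) *
              ∑' k, exponentTerm (selectExponent (Fin.cons c e) a b)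
                (selectExponent (Fin.cons c e) b a) (v x) z k) := by
        intro c
        have hfun : regularized (Fin.tail a) (Fin.tail b) (Fin.tail y) =
            infinityExpansion (Fin.tail a) (Fin.tail b) (Fin.tail y) := funext ih'
        rw [hfun]
        have := (hasSum_sum fun (e : Fin m → Bool) (_ : e ∈ Finset.univ) ↦
          hasSum_infinityShiftTerm_exponentSum (selectExponent_ne (Fin.cons c e) hab)
          (selectExponent_sub_ne (Fin.cons c e) hd) z hnorm).mul_left
          (∏ i : Fin m, Complex.Gamma (a i.succ) * Complex.Gamma (b i.succ))⁻¹
        refine this.congr_fun fun k ↦ ?_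
        exact infinityShiftTerm_sum _ _ _ _ _ _ _ _
      obtain ⟨-, -, h3⟩ := hXeq x hx1
      have h4 : ∀ (c : Bool) (e : Fin m → Bool),
          exponentSum (selectExponent (Fin.cons c e : Fin (m + 1) → Bool) a b)
            (selectExponent (Fin.cons c e : Fin (m + 1) → Bool) b a) (v x) z =
          (x : ℂ) ^ (-(cond c (a 0) (b 0))) *
            ((∏ i : Fin m, (-y i.succ) ^ (-selectExponent e (Fin.tail a) (Fin.tail b) i)) *
              ∑' k, exponentTerm (selectExponent (Fin.cons c e) a b)
                (selectExponent (Fin.cons c e) b a) (v x) z k) := by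
        intro c e
        rw [exponentSum, Fin.prod_univ_succ, mul_assoc]
        simp [hv, selectExponent, Fin.tail]
      -- Choosing the exponents for m+1 variables means choosing the first one and then the others;
      -- the first choice matches the two pole families of the one-variable expansion.
      have hsum : ∀ g : (Fin (m + 1) → Bool) → ℂ, ∑ e, g e =
          (∑ e : Fin m → Bool, g (Fin.cons true e)) + ∑ e : Fin m → Bool, g (Fin.cons false e) := by
        intro g
        rw [← (Fin.consEquiv fun _ : Fin (m + 1) ↦ Bool).sum_comp, Fintype.sum_prod_type,
          Fintype.sum_bool]
        rfl
      have ht := (h2 true).tsum_eq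
      have hf := (h2 false).tsum_eq
      simp only [cond_true, cond_false] at ht hf
      rw [h1, h3, ht, hf, infinityExpansion, hsum, Fin.prod_univ_succ, mul_inv]
      simp only [h4, cond_true, cond_false, ← Finset.mul_sum]
      ring
    have key := Complex.eqOn_of_eventually_real_eq
      (f := fun w ↦ regularized a b (v w) z) (g := fun w ↦ infinityExpansion a b (v w) z)
      (U := {w : ℂ | 4 * (m + 1) + 1 < w.re}) (isOpen_lt (by fun_prop) (by fun_prop))
      (convex_halfSpace_re_gt _).isPreconnected ?_ ?_
      (x₀ := max X (4 * (m + 1) + 1) + 1) ?_ ?_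
    · have h := key (x := -y 0) (by simpa using by linarith [hy 0])
      have hvy : v (-y 0) = y := by simp [hv]
      simpa only [hvy] using h
    · intro w hw
      exact (DifferentiableAt.comp (g := fun y ↦ regularized a b y z) w
        (differentiableAt_regularized hab (hvcut hw) z) (hvd w)).differentiableWithinAt
    · intro w hw
      refine DifferentiableAt.differentiableWithinAt (DifferentiableAt.const_mul
        (DifferentiableAt.fun_sum fun e _ ↦ ?_) _)
      exact DifferentiableAt.comp (g := fun y ↦ exponentSum (selectExponent e a b)
        (selectExponent e b a) y z) w (differentiableAt_exponentSum (selectExponent_ne e hab)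
        (selectExponent_sub_ne e hd) z (by push_cast; exact hvre hw)) (hvd w)
    · show (4 * (m + 1) + 1 : ℝ) < (((max X (4 * (m + 1) + 1) + 1 : ℝ)) : ℂ).re
      rw [Complex.ofReal_re]
      linarith [le_max_right X (4 * (m + 1) + 1)]
    · filter_upwards [lt_mem_nhds (lt_add_one (max X (4 * (m + 1) + 1 : ℝ)))] with x hx
      exact hreal x ((le_max_left _ _).trans_lt hx) ((le_max_right _ _).trans_lt hx)

/-! ### From Boolean choices back to subsets -/

theorem prod_mul_prod_compl_eq_prod_selectExponent {m : ℕ} (I : Finset (Fin m)) (a b : Fin m → ℂ)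
    (f : Fin m → ℂ → ℂ → ℂ) :
    (∏ i ∈ I, f i (a i) (b i)) * ∏ j ∈ Iᶜ, f j (b j) (a j) =
      ∏ i, f i (selectExponent (fun i ↦ decide (i ∈ I)) a b i)
        (selectExponent (fun i ↦ decide (i ∈ I)) b a i) := by
  rw [← Finset.prod_mul_prod_compl I]
  congr 1
  · exact Finset.prod_congr rfl fun i hi ↦ by simp [selectExponent, hi]
  · refine Finset.prod_congr rfl fun i hi ↦ ?_
    rw [Finset.mem_compl] at hi
    simp [selectExponent, hi]

theorem infinityTerm_eq {m : ℕ} (a b : Fin m → ℂ) (c : ℂ) (I : Finset (Fin m)) (y : Fin m → ℂ) :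
    infinityTerm a b c I y = exponentTerm (selectExponent (fun i ↦ decide (i ∈ I)) a b)
      (selectExponent (fun i ↦ decide (i ∈ I)) b a) y c := by
  funext k
  have hsum : ∑ i, (selectExponent (fun i ↦ decide (i ∈ I)) a b i + k i) =
      ∑ i ∈ I, (a i + k i) + ∑ j ∈ Iᶜ, (b j + k j) := by
    rw [← Finset.sum_add_sum_compl I]
    congr 1
    · exact Finset.sum_congr rfl fun i hi ↦ by simp [selectExponent, hi]
    · refine Finset.sum_congr rfl fun i hi ↦ ?_
      rw [Finset.mem_compl] at hi
      simp [selectExponent, hi]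
  rw [infinityTerm, exponentTerm, hsum, one_div, ← sub_sub,
    prod_mul_prod_compl_eq_prod_selectExponent I a b fun i α β ↦ Complex.Gamma (β - α - k i) *
      Complex.Gamma (α + k i) / (((k i)! : ℂ) * y i ^ k i)]

theorem sum_exponentSum_eq {m : ℕ} (a b : Fin m → ℂ) (c : ℂ) (y : Fin m → ℂ) :
    ∑ e : Fin m → Bool, exponentSum (selectExponent e a b) (selectExponent e b a) y c =
      ∑ I : Finset (Fin m), (∏ i ∈ I, (-y i) ^ (-a i)) * (∏ j ∈ Iᶜ, (-y j) ^ (-b j)) *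
        ∑' k : Fin m → ℕ, infinityTerm a b c I y k := by
  refine (Fintype.sum_bijective (fun (I : Finset (Fin m)) i ↦ decide (i ∈ I)) ⟨?_, ?_⟩ _ _
    fun I ↦ ?_).symm
  · intro I J h
    ext i
    have := congrFun h i
    simpa using this
  · intro e
    exact ⟨Finset.univ.filter fun i ↦ e i = true, by ext i; simp⟩
  · rw [infinityTerm_eq, exponentSum,
      prod_mul_prod_compl_eq_prod_selectExponent I a b fun i α _ ↦ (-y i) ^ (-α)]

/-! ### Existence and uniqueness of the continuation -/

theorem isLauricellaB_regularized {m : ℕ} {a b : Fin m → ℂ} {c : ℂ} (hc : ∀ n : ℕ, c ≠ -(n : ℂ))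
    (hab : ∀ (i : Fin m) (n : ℕ), a i ≠ -(n : ℂ) ∧ b i ≠ -(n : ℂ)) :
    IsLauricellaB a b c fun y ↦ Complex.Gamma c * regularized a b y c where
  differentiableOn _ hy :=
    ((differentiableAt_regularized hab hy c).const_mul _).differentiableWithinAt
  hasSum y hy := by
    have h := (hasSum_regularizedTerm a b hy c).mul_left (Complex.Gamma c)
    exact h.congr_fun fun k ↦ seriesTerm_eq a b y hc k

theorem ofReal_smul_mem_cutDomain {m : ℕ} {y : Fin m → ℂ} (hy : y ∈ cutDomain m) {t : ℝ}
    (h0 : 0 ≤ t) (h1 : t ≤ 1) : (t • y) ∈ cutDomain m := by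
  rintro i ⟨him, hre⟩
  simp only [Pi.smul_apply, Complex.real_smul, Complex.mul_im, Complex.mul_re, Complex.ofReal_re,
    Complex.ofReal_im, zero_mul, add_zero, sub_zero] at him hre
  have ht : t ≠ 0 := by rintro rfl; norm_num at hre
  refine hy i ⟨(mul_eq_zero.1 him).resolve_left ht, ?_⟩
  have : 0 < t := lt_of_le_of_ne h0 ht.symm
  nlinarith

theorem starConvex_cutDomain (m : ℕ) : StarConvex ℝ 0 (cutDomain m) := by
  rw [starConvex_zero_iff]
  intro y hy t h0 h1
  exact ofReal_smul_mem_cutDomain hy h0 h1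

/-- On the complex line t ↦ t • y the preimage of the cut domain is open, star-shaped about 0 and
contains 1. Near t = 0 both functions are sums of the same series, so they agree at t = 1. -/
theorem IsLauricellaB.eqOn {m : ℕ} {a b : Fin m → ℂ} {c : ℂ} {F G : (Fin m → ℂ) → ℂ}
    (hG : IsLauricellaB a b c G) (hF : IsLauricellaB a b c F) : Set.EqOn G F (cutDomain m) := by
  intro y hy
  set U : Set ℂ := {t | t • y ∈ cutDomain m} with hU
  have hcont : Continuous fun t : ℂ ↦ t • y := by fun_prop
  have hopen : IsOpen U := (isOpen_cutDomain m).preimage hcont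
  have h0 : (0 : ℂ) ∈ U := by
    simp [hU, cutDomain]
  have h1 : (1 : ℂ) ∈ U := by simpa [hU] using hy
  have hconn : IsPreconnected U := by
    have : StarConvex ℝ 0 U := by
      rw [starConvex_zero_iff]
      intro t ht r hr0 hr1
      have := starConvex_zero_iff.1 (starConvex_cutDomain m) ht hr0 hr1
      show (r • t) • y ∈ cutDomain m
      rwa [smul_assoc]
    exact (this.isPathConnected h0).isConnected.isPreconnected
  have hana : ∀ {H : (Fin m → ℂ) → ℂ}, IsLauricellaB a b c H →
      AnalyticOnNhd ℂ (fun t : ℂ ↦ H (t • y)) U := by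
    intro H hH
    refine DifferentiableOn.analyticOnNhd ?_ hopen
    exact hH.differentiableOn.comp (by fun_prop) fun t ht ↦ ht
  have hev : (fun t : ℂ ↦ G (t • y)) =ᶠ[𝓝 0] fun t ↦ F (t • y) := by
    have : ∀ᶠ t : ℂ in 𝓝 0, ∀ i, ‖(t • y) i‖ < 1 := by
      rw [eventually_all]
      intro i
      have hc : Tendsto (fun t : ℂ ↦ ‖(t • y) i‖) (𝓝 0) (𝓝 ‖((0 : ℂ) • y) i‖) :=
        Continuous.tendsto (by fun_prop) 0
      exact hc.eventually (gt_mem_nhds (by simp))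
    filter_upwards [this] with t ht
    exact (hG.hasSum _ ht).unique (hF.hasSum _ ht)
  have := (hana hG).eqOn_of_preconnected_of_eventuallyEq (hana hF) hconn h0 hev h1
  simpa using this

end LauricellaB

end

/-! ### Conclusion -/

theorem proposition4p2p2 (m : ℕ) :
    ∃ R : ℝ, 0 < R ∧ ∀ (a b : Fin m → ℂ) (c : ℂ),
      (∀ n : ℕ, c ≠ -(n : ℂ)) →
      (∀ (i : Fin m) (n : ℕ), a i ≠ -(n : ℂ) ∧ b i ≠ -(n : ℂ)) →
      (∀ (i : Fin m) (n : ℤ), a i - b i ≠ (n : ℂ)) →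
      ∃ F : (Fin m → ℂ) → ℂ,
        LauricellaB.IsLauricellaB a b c F ∧
        (∀ G : (Fin m → ℂ) → ℂ, LauricellaB.IsLauricellaB a b c G →
          Set.EqOn G F (LauricellaB.cutDomain m)) ∧
        ∀ y : Fin m → ℂ, (∀ i, (y i).re < -R) →
          (∀ I : Finset (Fin m), Summable (LauricellaB.infinityTerm a b c I y)) ∧
          F y = Complex.Gamma c / (∏ i, Complex.Gamma (a i) * Complex.Gamma (b i)) *
            ∑ I : Finset (Fin m),
              (∏ i ∈ I, (-y i) ^ (-a i)) * (∏ j ∈ Iᶜ, (-y j) ^ (-b j)) *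
                ∑' k : Fin m → ℕ, LauricellaB.infinityTerm a b c I y k := by
  -- Re yᵢ < -(4m+1) gives |yᵢ| > 4m+1, so the ratios 4m/|yᵢ| of the dominating geometric series are
  -- below 1; the summand 1 also keeps the radius positive when m = 0.
  refine ⟨4 * m + 1, by positivity, fun a b c hc hab hd ↦ ⟨_,
    LauricellaB.isLauricellaB_regularized hc hab,
    fun G hG ↦ hG.eqOn (LauricellaB.isLauricellaB_regularized hc hab), fun y hy ↦ ⟨fun I ↦ ?_, ?_⟩⟩⟩
  · rw [LauricellaB.infinityTerm_eq]
    refine LauricellaB.summable_exponentTerm (LauricellaB.selectExponent_ne _ hab)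
      (LauricellaB.selectExponent_sub_ne _ hd) c fun i ↦ ?_
    have := Complex.abs_re_le_norm (y i)
    have := neg_abs_le (y i).re
    linarith [hy i]
  · simp only [LauricellaB.regularized_eq_infinityExpansion hab hd hy,
      LauricellaB.infinityExpansion, LauricellaB.sum_exponentSum_eq]
    rw [div_eq_mul_inv, mul_assoc]
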